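/- Let $q\in(-1,1)$ be nonzero, and let $A_q=C(SU_q(2))$ be the universal unital $C^*$-algebra generated by two elements $\alpha,\beta$ subject to $$\alpha^*\alpha+\beta^*\beta=1,\quad \alpha\alpha^*+q^2\beta\beta^*=1,\quad \alpha\beta=q\beta\alpha,\quad \alpha\beta^*=q\beta^*\alpha,\quad \beta^*\beta=\beta\beta^*,$$ with coproduct $\Delta(\alpha)=\alpha\otimes\alpha-q\beta^*\otimes\beta$, $\Delta(\beta)=\beta\otimes\alpha+\alpha^*\otimes\beta$. The Haar state $h$ of $A_q$ is the state with $(h\otimes\rho)\Delta(a)=h(a)\rho(1)=(\rho\otimes h)\Delta(a)$ for all $a\in A_q$ and all continuous linear functionals $\rho$ on $A_q$. Put $g(n)=(1-q^{2n})^{1/2}$ and $\Gamma=\{(n,i,j): n\in\tfrac12\mathbb N,\ i,j\in\{-n,-n+1,\dots,n\}\}$, and let $e^n_{ij}$ be the canonical orthonormal basis of $\ell^2(\Gamma)$. The Haar state exists, and its GNS space $L^2(SU_q(2))$ is identified with $\ell^2(\Gamma)$ in such a way that the GNS vector becomes $e^0_{00}$ and the GNS representation becomes the representation $\lambda_q$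 of $A_q$ on $\ell^2(\Gamma)$ with $$\lambda_q(\alpha)e^n_{ij}=a_+e^{n+1/2}_{i-1/2,j-1/2}+a_-e^{n-1/2}_{i-1/2,j-1/2},\qquad \lambda_q(\beta)e^n_{ij}=b_+e^{n+1/2}_{i+1/2,j-1/2}+b_-e^{n-1/2}_{i+1/2,j-1/2},$$ $$a_+=q^{2n+i+j+1}\frac{g(n-j+1)g(n-i+1)}{g(2n+1)g(2n+2)},\quad a_-=\frac{g(n+j)g(n+i)}{g(2n)g(2n+1)},$$ $$b_+=-q^{n+j}\frac{g(n-j+1)g(n+i+1)}{g(2n+1)g(2n+2)},\quad b_-=q^{n+i}\frac{g(n+j)g(n-i)}{g(2n)g(2n+1)},$$ where terms whose target index lies outside $\Gamma$ are $0$ (these properties determine the identification, since the GNS vector is cyclic). Let $S$ denote the left shift $e_k\mapsto e_{k-1}$ on $\ell^2(\mathbb N)$ (with $Se_0=0$) and on $\ell^2(\mathbb Z)$, let $Ne_k=ke_k$ on $\ell^2(\mathbb N)$, let $\mathcal H_\pi=\ell^2(\mathbb N)\otimes\ell^2(\mathbb Z)$, and let $\pi_q$ be the representation of $A_q$ on $\mathcal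 H_\pi$ given by $\pi_q(\alpha)=S\sqrt{I-q^{2N}}\otimes I$, $\pi_q(\beta)=q^N\otimes S$ (the direct integral of the infinite-dimensional irreducible representations of $A_q$). Let $\mathcal H_{mult}=\ell^2(\mathbb N)$, write $e(r,s,t)=e_r\otimes e_s\otimes e_t$ for the canonical basis of $\mathcal H_{mult}\otimes\mathcal H_\pi$, and let $U:\ell^2(\Gamma)\to\mathcal H_{mult}\otimes\mathcal H_\pi$ be the unitary $$Ue^n_{ij}=(-1)^{(i\vee j)-j}\,e\bigl(n-(i\vee j),\,n+(i\wedge j),\,j-i\bigr).$$ Let $\mathscr T\subset\mathcal L(\ell^2(\mathbb N))$ be the Toeplitz algebra, i.e. the $C^*$-algebra generated by $S$, and let $\mathscr T\otimes\mathcal K(\mathcal H_\pi)\subset\mathcal L(\mathcal H_{mult}\otimes\mathcal H_\pi)$ be the closed linear span of the operators $X\otimes Y$ with $X\in\mathscr T$ and $Y$ compact. Then for every $a\in C(SU_q(2))$, $$U\lambda_q(a)U^*-I\otimes\pi_q(a)\in\mathscr T\otimes\mathcal K(\mathcal H_\pi).$$ -/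

import Mathlib

open scoped TensorProduct ENNReal ComplexOrder InnerProductSpace

noncomputable section

namespace SUq2

/-- The defining relations of `C(SU_q(2))` for a pair of elements of a `*`-algebra. -/
structure Relations {B : Type*} [Ring B] [StarRing B] [Algebra ℂ B] (q : ℝ) (a b : B) : Prop where
  star_mul_add : star a * a + star b * b = 1
  mul_star_add : a * star a + ((q : ℂ) ^ 2) • (b * star b) = 1
  comm : a * b = (q : ℂ) • (b * a)
  comm_star : a * star b = (q : ℂ) • (star b * a)
  normal : star b * b = b * star b

/-- A nonzero unital `C*`-algebra with a pair of elements satisfying the relations. (A `C*`-algebra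
generated by two elements is separable, so algebras in `Type` suffice for universality.) -/
structure Model (q : ℝ) : Type 1 where
  carrier : Type
  [cstar : CStarAlgebra carrier]
  [nontrivial : Nontrivial carrier]
  a : carrier
  b : carrier
  rel : Relations q a b

attribute [instance] Model.cstar Model.nontrivial

/-- The `ℓ^∞`-product of all models. -/
abbrev ModelProd (q : ℝ) : Type 1 := lp (fun m : Model q => m.carrier) ∞

instance (q : ℝ) : CStarAlgebra (ModelProd q) where

theorem Relations.norm_le {B : Type*} [CStarAlgebra B] [Nontrivial B] {q : ℝ} {a b : B}
    (h : Relations q a b) : ‖a‖ ≤ 1 ∧ ‖b‖ ≤ 1 := by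
  let _ := CStarAlgebra.spectralOrder B
  have _ := CStarAlgebra.spectralOrderedRing B
  have ha := star_mul_self_nonneg a
  have hb := star_mul_self_nonneg b
  have key : ∀ x : B, star x * x ≤ 1 → ‖x‖ ≤ 1 := fun x hx => by
    have := (CStarAlgebra.norm_le_one_iff_of_nonneg _ (star_mul_self_nonneg x)).2 hx
    rw [CStarRing.norm_star_mul_self] at this
    nlinarith [norm_nonneg x]
  constructor
  · exact key a (by rw [← h.star_mul_add]; exact le_add_of_nonneg_right hb)
  · exact key b (by rw [← h.star_mul_add]; exact le_add_of_nonneg_left ha)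

/-- The tuple of all the `a`s. -/
def prodA (q : ℝ) : ModelProd q :=
  ⟨fun m => m.a, memℓp_infty ⟨1, by rintro _ ⟨m, rfl⟩; exact m.rel.norm_le.1⟩⟩

/-- The tuple of all the `b`s. -/
def prodB (q : ℝ) : ModelProd q :=
  ⟨fun m => m.b, memℓp_infty ⟨1, by rintro _ ⟨m, rfl⟩; exact m.rel.norm_le.2⟩⟩

/-- The `C*`-subalgebra generated by the two universal tuples. -/
def gen (q : ℝ) : StarSubalgebra ℂ (ModelProd q) :=
  (StarAlgebra.adjoin ℂ {prodA q, prodB q}).topologicalClosure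

instance (q : ℝ) : IsClosed (gen q : Set (ModelProd q)) :=
  StarSubalgebra.isClosed_topologicalClosure _

/-- `A_q = C(SU_q(2))`: the universal unital `C*`-algebra generated by two elements
satisfying the relations, realised in the product of all models. -/
def A (q : ℝ) : Type 1 := gen q

instance (q : ℝ) : CStarAlgebra (A q) := inferInstanceAs (CStarAlgebra (gen q))
instance (q : ℝ) : PartialOrder (A q) := CStarAlgebra.spectralOrder (A q)
instance (q : ℝ) : StarOrderedRing (A q) := CStarAlgebra.spectralOrderedRing (A q)

/-- The generator `α_q`. -/
def alpha (q : ℝ) : A q :=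
  ⟨prodA q, StarSubalgebra.le_topologicalClosure _ (StarAlgebra.subset_adjoin ℂ _ (by simp))⟩

/-- The generator `β_q`. -/
def beta (q : ℝ) : A q :=
  ⟨prodB q, StarSubalgebra.le_topologicalClosure _ (StarAlgebra.subset_adjoin ℂ _ (by simp))⟩

theorem relations (q : ℝ) : Relations q (alpha q) (beta q) where
  star_mul_add := Subtype.ext (lp.ext (funext fun m => m.rel.star_mul_add))
  mul_star_add := Subtype.ext (lp.ext (funext fun m => m.rel.mul_star_add))
  comm := Subtype.ext (lp.ext (funext fun m => m.rel.comm))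
  comm_star := Subtype.ext (lp.ext (funext fun m => m.rel.comm_star))
  normal := Subtype.ext (lp.ext (funext fun m => m.rel.normal))

/-- The universal property: a pair satisfying the relations in a unital `C*`-algebra
defines a unital `*`-homomorphism on `A_q`. -/
def lift {B : Type} [CStarAlgebra B] [Nontrivial B] {q : ℝ} {a b : B}
    (h : Relations q a b) : A q →⋆ₐ[ℂ] B where
  toFun x := x.1.1 (⟨B, a, b, h⟩ : Model q)
  map_one' := rfl
  map_mul' _ _ := rfl
  map_zero' := rfl
  map_add' _ _ := rfl
  commutes' _ := rfl
  map_star' _ := rfl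

theorem lift_alpha {B : Type} [CStarAlgebra B] [Nontrivial B] {q : ℝ} {a b : B}
    (h : Relations q a b) : lift h (alpha q) = a := rfl

theorem lift_beta {B : Type} [CStarAlgebra B] [Nontrivial B] {q : ℝ} {a b : B}
    (h : Relations q a b) : lift h (beta q) = b := rfl

open scoped CStarAlgebra in
/-- Two unital `*`-homomorphisms on `A_q` that agree on the generators are equal. -/
theorem hom_ext {B : Type*} [CStarAlgebra B] {q : ℝ} {φ ψ : A q →⋆ₐ[ℂ] B}
    (ha : φ (alpha q) = ψ (alpha q)) (hb : φ (beta q) = ψ (beta q)) : φ = ψ := by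
  have hc : ∀ χ : A q →⋆ₐ[ℂ] B, Continuous χ := fun χ => map_continuous χ
  refine StarAlgHom.ext_topologicalClosure (S := StarAlgebra.adjoin ℂ {prodA q, prodB q})
    (φ := φ) (ψ := ψ) (hc φ) (hc ψ) ?_
  refine StarAlgHom.ext_adjoin fun x hx => ?_
  obtain ⟨x, hx'⟩ := x
  rcases hx with rfl | rfl
  · exact ha
  · exact hb

/-- The letters of noncommutative `*`-polynomials in `α, β`. -/
inductive Letter
  | a
  | b
  | aStar
  | bStar

/-- Noncommutative `*`-polynomials in `α, β`. -/
abbrev Poly : Type := FreeAlgebra ℂ Letter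

/-- Evaluation `p ↦ p(α_q, β_q)`; its range is the dense `*`-subalgebra of `A_q` generated by
`α_q, β_q`. -/
def ev (q : ℝ) : Poly →ₐ[ℂ] A q :=
  FreeAlgebra.lift ℂ fun
    | .a => alpha q
    | .b => beta q
    | .aStar => star (alpha q)
    | .bStar => star (beta q)

/-- The coproduct `p ↦ p(Δ(α_q), Δ(β_q))`, where
`Δ(α) = α ⊗ α - q β^* ⊗ β` and `Δ(β) = β ⊗ α + α^* ⊗ β`. -/
def coproduct (q : ℝ) : Poly →ₐ[ℂ] A q ⊗[ℂ] A q :=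
  FreeAlgebra.lift ℂ fun
    | .a => alpha q ⊗ₜ alpha q - (q : ℂ) • (star (beta q) ⊗ₜ beta q)
    | .b => beta q ⊗ₜ alpha q + star (alpha q) ⊗ₜ beta q
    | .aStar => star (alpha q) ⊗ₜ star (alpha q) - (q : ℂ) • (beta q ⊗ₜ star (beta q))
    | .bStar => star (beta q) ⊗ₜ star (alpha q) + alpha q ⊗ₜ star (beta q)

/-- `σ` is the convolution product `ρ₁ ∗ ρ₂ = (ρ₁ ⊗ ρ₂)Δ` (tested on the dense `*`-subalgebra
generated by `α_q, β_q`, which determines a continuous functional). -/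
def IsConvolution {q : ℝ} (ρ₁ ρ₂ σ : A q →ₗ[ℂ] ℂ) : Prop :=
  ∀ p : Poly, σ (ev q p) =
    LinearMap.mul' ℂ ℂ (TensorProduct.map ρ₁ ρ₂ (coproduct q p))

/-- `h` is the Haar state: `h ∗ ρ = ρ(1) h = ρ ∗ h` for all continuous linear functionals `ρ`. -/
structure IsHaarState {q : ℝ} (h : A q →ₚ[ℂ] ℂ) : Prop where
  map_one : h 1 = 1
  right_inv : ∀ ρ : A q →L[ℂ] ℂ,
    IsConvolution h.toLinearMap ρ.toLinearMap (ρ 1 • h.toLinearMap)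
  left_inv : ∀ ρ : A q →L[ℂ] ℂ,
    IsConvolution ρ.toLinearMap h.toLinearMap (ρ 1 • h.toLinearMap)

/-- `g(n) = (1 - q^{2n})^{1/2}`. -/
def g (q : ℝ) (n : ℕ) : ℝ := √(1 - q ^ (2 * n))

/-- The index set `{(n,i,j) : n ∈ ½ℕ, i,j ∈ {-n, …, n}}`; the element `(n,i,j)` is encoded by
`(N,I,J) = (2n, n+i, n+j)`. -/
abbrev Gam : Type := {p : ℕ × ℕ × ℕ // p.2.1 ≤ p.1 ∧ p.2.2 ≤ p.1}

/-- `ℓ²(ι)`. -/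
abbrev L2 (ι : Type) : Type := lp (fun _ : ι => ℂ) 2

/-- The canonical basis vector `e_i` of `ℓ²(ι)`. -/
def bv {ι : Type} [DecidableEq ι] (i : ι) : L2 ι := lp.single 2 i (1 : ℂ)

/-- `e^n_{ij}` with `(N,I,J) = (2n, n+i, n+j)`, and `0` outside the index set. -/
def eG (N I J : ℕ) : L2 Gam :=
  if h : I ≤ N ∧ J ≤ N then bv (⟨(N, I, J), h⟩ : Gam) else 0

/-- `a_+(n,i,j)`. -/
def aPlus (q : ℝ) (N I J : ℕ) : ℝ :=
  q ^ (I + J + 1) * (g q (N - J + 1) * g q (N - I + 1)) / (g q (N + 1) * g q (N + 2))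

/-- `a_-(n,i,j)`; it vanishes for `i = -n` and for `j = -n`. -/
def aMinus (q : ℝ) (N I J : ℕ) : ℝ :=
  g q J * g q I / (g q N * g q (N + 1))

/-- `b_+(n,i,j)`. -/
def bPlus (q : ℝ) (N I J : ℕ) : ℝ :=
  -q ^ J * (g q (N - J + 1) * g q (I + 1)) / (g q (N + 1) * g q (N + 2))

/-- `b_-(n,i,j)`; it vanishes for `i = n` and for `j = -n`. -/
def bMinus (q : ℝ) (N I J : ℕ) : ℝ :=
  q ^ I * (g q J * g q (N - I)) / (g q N * g q (N + 1))

/-- The identification `L²(SU_q(2)) ≅ ℓ²(Γ)` of the GNS space of `h` through the orthonormal basis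
`e^n_{ij}` of normalized matrix entries: it takes the GNS vector to `e^0_{00}` and turns the GNS
representation `λ_q` into
`λ_q(α) e^n_{ij} = a_+ e^{n+1/2}_{i-1/2,j-1/2} + a_- e^{n-1/2}_{i-1/2,j-1/2}`,
`λ_q(β) e^n_{ij} = b_+ e^{n+1/2}_{i+1/2,j-1/2} + b_- e^{n-1/2}_{i+1/2,j-1/2}`.
As the GNS vector is cyclic, these properties determine it. -/
structure IsPeterWeyl {q : ℝ} (h : A q →ₚ[ℂ] ℂ) (V : h.GNS ≃ₗᵢ[ℂ] L2 Gam) : Prop where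
  map_one : V ((h.toPreGNS 1 : h.PreGNS) : h.GNS) = eG 0 0 0
  alpha_apply : ∀ N I J : ℕ, I ≤ N → J ≤ N →
    V (h.gnsStarAlgHom (alpha q) (V.symm (eG N I J))) =
      (aPlus q N I J : ℂ) • eG (N + 1) I J + (aMinus q N I J : ℂ) • eG (N - 1) (I - 1) (J - 1)
  beta_apply : ∀ N I J : ℕ, I ≤ N → J ≤ N →
    V (h.gnsStarAlgHom (beta q) (V.symm (eG N I J))) =
      (bPlus q N I J : ℂ) • eG (N + 1) (I + 1) J + (bMinus q N I J : ℂ) • eG (N - 1) I (J - 1)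

/-- The weighted composition operator `(T x)(i) = w i * x (f i)` on `ℓ²`. -/
def wcomp {ι κ : Type} (w : ι → ℝ) (f : ι → κ) (hf : Function.Injective f)
    (hw : ∀ i, |w i| ≤ 1) : L2 κ →L[ℂ] L2 ι :=
  have bd : ∀ (x : L2 κ) (s : Finset ι),
      ∑ i ∈ s, ‖(w i : ℂ) * x (f i)‖ ^ (2 : ℝ≥0∞).toReal ≤ ‖x‖ ^ (2 : ℝ≥0∞).toReal := by
    intro x s
    calc ∑ i ∈ s, ‖(w i : ℂ) * x (f i)‖ ^ (2 : ℝ≥0∞).toReal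
        ≤ ∑ i ∈ s, ‖x (f i)‖ ^ (2 : ℝ≥0∞).toReal := by
          refine Finset.sum_le_sum fun i _ => ?_
          refine Real.rpow_le_rpow (norm_nonneg _) ?_ (by simp)
          rw [norm_mul, Complex.norm_real]
          exact mul_le_of_le_one_left (norm_nonneg _) (hw i)
      _ = ∑ j ∈ s.map ⟨f, hf⟩, ‖x j‖ ^ (2 : ℝ≥0∞).toReal := by simp
      _ ≤ ‖x‖ ^ (2 : ℝ≥0∞).toReal := lp.sum_rpow_le_norm_rpow (by simp) x _
  LinearMap.mkContinuous
    { toFun := fun x => ⟨fun i => (w i : ℂ) * x (f i), memℓp_gen' (bd x)⟩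
      map_add' := fun x y => by ext i; exact mul_add _ _ _
      map_smul' := fun c x => by ext i; exact mul_left_comm _ _ _ }
    1 fun x => by
      rw [one_mul]
      exact lp.norm_le_of_forall_sum_le (by simp) (norm_nonneg _) (bd x)

/-- The left shift `S` on `ℓ²(ℕ)`: `S e_k = e_{k-1}`, `S e_0 = 0`. -/
def shiftN : L2 ℕ →L[ℂ] L2 ℕ :=
  wcomp (fun _ => 1) (fun k => k + 1) (add_left_injective 1) (by simp)

/-- The left shift `S` on `ℓ²(ℤ)`: `S e_k = e_{k-1}`. -/
def shiftZ : L2 ℤ →L[ℂ] L2 ℤ :=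
  wcomp (fun _ => 1) (fun k => k + 1) (add_left_injective 1) (by simp)

/-- The diagonal operator with entries `w k`. -/
def diag (w : ℕ → ℝ) (hw : ∀ k, |w k| ≤ 1) : L2 ℕ →L[ℂ] L2 ℕ :=
  wcomp w id Function.injective_id hw

/-- The Hilbert space tensor product. -/
abbrev HTensor (H K : Type) [NormedAddCommGroup H] [InnerProductSpace ℂ H]
    [NormedAddCommGroup K] [InnerProductSpace ℂ K] : Type :=
  UniformSpace.Completion (H ⊗[ℂ] K)

section
variable {H K : Type} [NormedAddCommGroup H] [InnerProductSpace ℂ H]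
  [NormedAddCommGroup K] [InnerProductSpace ℂ K]

/-- The elementary tensor `x ⊗ y`. -/
def tmulH (x : H) (y : K) : HTensor H K := ((x ⊗ₜ[ℂ] y : H ⊗[ℂ] K) : HTensor H K)

/-- The tensor product `S ⊗ T` of two bounded operators. -/
def opTensor (S : H →L[ℂ] H) (T : K →L[ℂ] K) : HTensor H K →L[ℂ] HTensor H K :=
  (TensorProduct.mapL S T).completion

theorem opTensor_tmulH (S : H →L[ℂ] H) (T : K →L[ℂ] K) (x : H) (y : K) :
    opTensor S T (tmulH x y) = tmulH (S x) (T y) := by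
  simp [opTensor, tmulH]

theorem inner_tmulH (x x' : H) (y y' : K) :
    ⟪tmulH x y, tmulH x' y'⟫_ℂ = ⟪x, x'⟫_ℂ * ⟪y, y'⟫_ℂ := by
  simp [tmulH]

theorem continuous_tmulH : Continuous fun p : H × K => tmulH p.1 p.2 :=
  (UniformSpace.Completion.continuous_coe _).comp TensorProduct.continuous_tmul

theorem opTensor_ext {S T : HTensor H K →L[ℂ] HTensor H K}
    (h : ∀ x y, S (tmulH x y) = T (tmulH x y)) : S = T := by
  ext x
  induction x using UniformSpace.Completion.induction_on with
  | hp => exact isClosed_eq S.continuous T.continuous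
  | ih a =>
    induction a using TensorProduct.induction_on with
    | zero => rw [UniformSpace.Completion.coe_zero, map_zero, map_zero]
    | tmul x y => exact h x y
    | add a b ha hb => rw [UniformSpace.Completion.coe_add, map_add, map_add, ha, hb]

theorem opTensor_mul (S S' : H →L[ℂ] H) (T T' : K →L[ℂ] K) :
    opTensor S T * opTensor S' T' = opTensor (S * S') (T * T') :=
  opTensor_ext fun x y => by simp [opTensor_tmulH]

theorem opTensor_star [CompleteSpace H] [CompleteSpace K] (S : H →L[ℂ] H) (T : K →L[ℂ] K) :
    star (opTensor S T) = opTensor (star S) (star T) := by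
  rw [ContinuousLinearMap.star_eq_adjoint, eq_comm, ContinuousLinearMap.eq_adjoint_iff]
  intro x y
  induction x, y using UniformSpace.Completion.induction_on₂ with
  | hp => apply isClosed_eq <;> fun_prop
  | ih a b =>
    induction a using TensorProduct.induction_on with
    | zero => rw [UniformSpace.Completion.coe_zero, map_zero, inner_zero_left, inner_zero_left]
    | add a b ha hb =>
      rw [UniformSpace.Completion.coe_add, map_add, inner_add_left, inner_add_left, ha, hb]
    | tmul x y =>
      induction b using TensorProduct.induction_on with
      | zero =>
        rw [UniformSpace.Completion.coe_zero, map_zero, inner_zero_right, inner_zero_right]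
      | add a b ha hb =>
        rw [UniformSpace.Completion.coe_add, map_add, inner_add_right, inner_add_right, ha, hb]
      | tmul x' y' =>
        change ⟪opTensor _ _ (tmulH x y), tmulH x' y'⟫_ℂ =
          ⟪tmulH x y, opTensor _ _ (tmulH x' y')⟫_ℂ
        simp only [opTensor_tmulH, inner_tmulH, ContinuousLinearMap.star_eq_adjoint,
          ContinuousLinearMap.adjoint_inner_left]

theorem opTensor_add_left (S S' : H →L[ℂ] H) (T : K →L[ℂ] K) :
    opTensor (S + S') T = opTensor S T + opTensor S' T :=
  opTensor_ext fun x y => by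
    simp only [opTensor_tmulH, add_apply]
    simp only [tmulH, TensorProduct.add_tmul, UniformSpace.Completion.coe_add]

theorem opTensor_smul_left (c : ℂ) (S : H →L[ℂ] H) (T : K →L[ℂ] K) :
    opTensor (c • S) T = c • opTensor S T :=
  opTensor_ext fun x y => by
    simp only [opTensor_tmulH, smul_apply]
    simp only [tmulH, ← TensorProduct.smul_tmul', UniformSpace.Completion.coe_smul]

theorem opTensor_one : opTensor (1 : H →L[ℂ] H) (1 : K →L[ℂ] K) = 1 :=
  opTensor_ext fun x y => by simp [opTensor_tmulH]

end

theorem l2_add {ι : Type} (x y : L2 ι) (i : ι) : (x + y) i = x i + y i := rfl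

theorem l2_smul {ι : Type} (c : ℂ) (x : L2 ι) (i : ι) : (c • x) i = c * x i := rfl

theorem l2_mul {ι : Type} (S T : L2 ι →L[ℂ] L2 ι) (x : L2 ι) : (S * T) x = S (T x) := rfl

theorem shiftN_apply (x : L2 ℕ) (k : ℕ) : shiftN x k = x (k + 1) := by
  change ((1 : ℝ) : ℂ) * x (k + 1) = _
  simp

theorem shiftZ_apply (x : L2 ℤ) (k : ℤ) : shiftZ x k = x (k + 1) := by
  change ((1 : ℝ) : ℂ) * x (k + 1) = _
  simp

theorem diag_apply (w : ℕ → ℝ) (hw : ∀ k, |w k| ≤ 1) (x : L2 ℕ) (k : ℕ) :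
    diag w hw x k = (w k : ℂ) * x k := rfl

theorem inner_bv {ι : Type} [DecidableEq ι] (i : ι) (x : L2 ι) : ⟪bv i, x⟫_ℂ = x i := by
  simp [bv, lp.inner_single_left]

theorem bv_apply {ι : Type} [DecidableEq ι] (i j : ι) : bv i j = if j = i then (1 : ℂ) else 0 := by
  simp [bv, lp.single_apply, Pi.single_apply]

theorem star_apply {ι : Type} [DecidableEq ι] (T : L2 ι →L[ℂ] L2 ι) (x : L2 ι) (i : ι) :
    star T x i = ⟪T (bv i), x⟫_ℂ := by
  rw [← inner_bv, ContinuousLinearMap.star_eq_adjoint, ContinuousLinearMap.adjoint_inner_right]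

theorem star_shiftN_zero (x : L2 ℕ) : star shiftN x 0 = 0 := by
  rw [star_apply]
  have : shiftN (bv 0) = 0 := by
    ext k
    simp [shiftN_apply, bv_apply]
  simp [this]

theorem star_shiftN_succ (x : L2 ℕ) (k : ℕ) : star shiftN x (k + 1) = x k := by
  rw [star_apply]
  have : shiftN (bv (k + 1)) = bv k := by
    ext j
    simp [shiftN_apply, bv_apply]
  rw [this, inner_bv]

theorem star_shiftZ_apply (x : L2 ℤ) (k : ℤ) : star shiftZ x k = x (k - 1) := by
  rw [star_apply]
  have : shiftZ (bv k) = bv (k - 1) := by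
    ext j
    simp [shiftZ_apply, bv_apply, eq_sub_iff_add_eq]
  rw [this, inner_bv]

theorem star_diag (w : ℕ → ℝ) (hw : ∀ k, |w k| ≤ 1) : star (diag w hw) = diag w hw := by
  ext x k
  rw [star_apply, diag_apply]
  have : diag w hw (bv k) = (w k : ℂ) • bv k := by
    ext j
    rw [diag_apply, l2_smul, bv_apply]
    by_cases h : j = k <;> simp [h]
  rw [this, inner_smul_left, inner_bv]
  simp

theorem shiftZ_star_mul : star shiftZ * shiftZ = 1 := by
  ext x k
  simp [star_shiftZ_apply, shiftZ_apply]

theorem shiftZ_mul_star : shiftZ * star shiftZ = 1 := by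
  ext x k
  simp [star_shiftZ_apply, shiftZ_apply]

theorem abs_pow_le_one' {q : ℝ} (hq : |q| < 1) (k : ℕ) : |q ^ k| ≤ 1 := by
  rw [abs_pow]
  exact pow_le_one₀ (abs_nonneg q) hq.le

theorem one_sub_nonneg {q : ℝ} (hq : |q| < 1) (k : ℕ) : 0 ≤ 1 - q ^ (2 * k) :=
  sub_nonneg.2 ((le_abs_self _).trans (abs_pow_le_one' hq _))

theorem abs_g_le_one (q : ℝ) (k : ℕ) : |g q k| ≤ 1 := by
  rw [g, abs_of_nonneg (Real.sqrt_nonneg _)]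
  refine Real.sqrt_le_one.2 ?_
  have : 0 ≤ q ^ (2 * k) := by rw [pow_mul]; positivity
  linarith

theorem g_mul_self {q : ℝ} (hq : |q| < 1) (k : ℕ) :
    (g q k : ℂ) * (g q k : ℂ) = 1 - (q : ℂ) ^ (2 * k) := by
  rw [← Complex.ofReal_mul, g, Real.mul_self_sqrt (one_sub_nonneg hq k)]
  push_cast
  rfl

/-- `S √(1 - q^{2N})` on `ℓ²(ℕ)`. -/
def piAlpha (q : ℝ) : L2 ℕ →L[ℂ] L2 ℕ := shiftN * diag (fun k => g q k) (abs_g_le_one q)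

/-- `q^N` on `ℓ²(ℕ)`. -/
def piBeta (q : ℝ) (hq : |q| < 1) : L2 ℕ →L[ℂ] L2 ℕ :=
  diag (fun k => q ^ k) (abs_pow_le_one' hq)

/-- `H_π = ℓ²(ℕ) ⊗ ℓ²(ℤ)`. -/
abbrev HPi : Type := HTensor (L2 ℕ) (L2 ℤ)

theorem norm_bv {ι : Type} [DecidableEq ι] (i : ι) : ‖bv i‖ = 1 := by
  simp [bv, lp.norm_single]

instance : Nontrivial HPi := by
  refine ⟨tmulH (bv 0) (bv 0), 0, fun h => ?_⟩
  have h2 : ⟪(tmulH (bv 0) (bv 0) : HPi), tmulH (bv 0) (bv 0)⟫_ℂ = 0 := by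
    rw [h, inner_zero_left]
  rw [inner_tmulH, inner_bv, inner_bv, bv_apply, bv_apply] at h2
  simp at h2

theorem pi_relations {q : ℝ} (hq : |q| < 1) :
    Relations q (opTensor (piAlpha q) (1 : L2 ℤ →L[ℂ] L2 ℤ)) (opTensor (piBeta q hq) shiftZ) where
  star_mul_add := by
    simp only [opTensor_star, opTensor_mul, shiftZ_star_mul, star_one, one_mul]
    rw [← opTensor_add_left, ← opTensor_one]
    congr 1
    ext x k
    simp only [piAlpha, piBeta, star_mul, star_diag, add_apply, l2_mul,
      l2_add, diag_apply, one_apply_eq_self, Complex.ofReal_pow]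
    cases k with
    | zero =>
      rw [star_shiftN_zero]
      simp
    | succ k =>
      have := g_mul_self hq (k + 1)
      rw [star_shiftN_succ, shiftN_apply, diag_apply, ← mul_assoc, this]
      ring
  mul_star_add := by
    simp only [opTensor_star, opTensor_mul, shiftZ_mul_star, star_one, one_mul]
    rw [← opTensor_smul_left, ← opTensor_add_left, ← opTensor_one]
    congr 1
    ext x k
    simp only [piAlpha, piBeta, star_mul, star_diag, add_apply, smul_apply,
      l2_mul, l2_add, l2_smul, diag_apply, shiftN_apply,
      one_apply_eq_self, star_shiftN_succ, Complex.ofReal_pow]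
    rw [← mul_assoc (g q (k + 1) : ℂ), g_mul_self hq (k + 1)]
    ring
  comm := by
    simp only [opTensor_mul, one_mul, mul_one]
    rw [← opTensor_smul_left]
    congr 1
    ext x k
    simp only [piAlpha, piBeta, smul_apply, l2_mul, l2_smul, diag_apply,
      shiftN_apply, Complex.ofReal_pow]
    ring
  comm_star := by
    simp only [opTensor_star, opTensor_mul, one_mul, mul_one]
    rw [← opTensor_smul_left]
    congr 1
    ext x k
    simp only [piAlpha, piBeta, star_diag, smul_apply, l2_mul, l2_smul,
      diag_apply, shiftN_apply, Complex.ofReal_pow]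
    ring
  normal := by
    simp only [opTensor_star, opTensor_mul, shiftZ_mul_star, shiftZ_star_mul, piBeta, star_diag]

/-- The representation `π_q` of `A_q` on `H_π`:
`π_q(α) = S √(1 - q^{2N}) ⊗ I`, `π_q(β) = q^N ⊗ S`. -/
def piRep (q : ℝ) (hq : |q| < 1) : A q →⋆ₐ[ℂ] (HPi →L[ℂ] HPi) :=
  lift (B := HPi →L[ℂ] HPi) (pi_relations hq)

/-- `H_mult ⊗ H_π` with `H_mult = ℓ²(ℕ)`. -/
abbrev HTot : Type := HTensor (L2 ℕ) HPi

/-- The basis vector `e(r,s,t) = e_r ⊗ e_s ⊗ e_t` of `H_mult ⊗ H_π`. -/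
def eT (r s : ℕ) (t : ℤ) : HTot := tmulH (bv r) (tmulH (bv s) (bv t))

/-- The vector `U e^n_{ij} = (-1)^{(i∨j)-j} e(n-(i∨j), n+(i∧j), j-i)`. -/
def UVec (p : Gam) : HTot :=
  (-1 : ℂ) ^ (max p.1.2.1 p.1.2.2 - p.1.2.2) •
    eT (p.1.1 - max p.1.2.1 p.1.2.2) (min p.1.2.1 p.1.2.2) ((p.1.2.2 : ℤ) - p.1.2.1)

theorem inner_eT (r r' s s' : ℕ) (t t' : ℤ) :
    ⟪eT r s t, eT r' s' t'⟫_ℂ = if r = r' ∧ s = s' ∧ t = t' then 1 else 0 := by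
  rw [eT, eT, inner_tmulH, inner_tmulH]
  simp only [inner_bv, bv_apply]
  by_cases h1 : r = r' <;> by_cases h2 : s = s' <;> by_cases h3 : t = t' <;> simp [h1, h2, h3]

theorem UVec_orthonormal : Orthonormal ℂ UVec := by
  rw [orthonormal_iff_ite]
  rintro ⟨⟨N, I, J⟩, hI, hJ⟩ ⟨⟨N', I', J'⟩, hI', hJ'⟩
  simp only at hI hJ hI' hJ'
  have key : ((N - max I J = N' - max I' J') ∧ min I J = min I' J' ∧
      (J : ℤ) - I = (J' : ℤ) - I') ↔
      ((⟨(N, I, J), hI, hJ⟩ : Gam) = ⟨(N', I', J'), hI', hJ'⟩) := by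
    constructor
    · rintro ⟨h1, h2, h3⟩
      apply Subtype.ext
      simp only [Prod.mk.injEq]
      omega
    · intro h
      have h' := congrArg Subtype.val h
      simp only [Prod.mk.injEq] at h'
      omega
  simp only [UVec]
  rw [inner_smul_left, inner_smul_right, inner_eT]
  by_cases h : (⟨(N, I, J), hI, hJ⟩ : Gam) = ⟨(N', I', J'), hI', hJ'⟩
  · rw [if_pos (key.2 h), if_pos h]
    have h' := congrArg Subtype.val h
    simp only [Prod.mk.injEq] at h'
    obtain ⟨rfl, rfl, rfl⟩ := h'
    simp [← mul_pow]
  · rw [if_neg (fun h' => h (key.1 h')), if_neg h]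
    simp

theorem bv_dense {ι : Type} [DecidableEq ι] :
    (Submodule.span ℂ (Set.range (bv : ι → L2 ι))).topologicalClosure = ⊤ := by
  set b : HilbertBasis ι ℂ (L2 ι) := ⟨LinearIsometryEquiv.refl ℂ (L2 ι)⟩ with hb
  have h : (b : ι → L2 ι) = bv := by
    funext i
    rw [← b.repr_symm_single i]
    rfl
  rw [← h]
  exact b.dense_span

theorem mem_closed_of_bv {ι : Type} [DecidableEq ι] {E : Type} [NormedAddCommGroup E]
    [InnerProductSpace ℂ E] (K : Submodule ℂ E) (hK : IsClosed (K : Set E)) (T : L2 ι →L[ℂ] E)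
    (h : ∀ i, T (bv i) ∈ K) (x : L2 ι) : T x ∈ K := by
  have h1 : (Submodule.span ℂ (Set.range (bv : ι → L2 ι))).topologicalClosure ≤
      K.comap (T : L2 ι →ₗ[ℂ] E) := by
    refine Submodule.topologicalClosure_minimal _ ?_ (hK.preimage T.continuous)
    rw [Submodule.span_le]
    rintro _ ⟨i, rfl⟩
    exact h i
  exact h1 (bv_dense (ι := ι) ▸ Submodule.mem_top)

section
variable {H K : Type} [NormedAddCommGroup H] [InnerProductSpace ℂ H]
  [NormedAddCommGroup K] [InnerProductSpace ℂ K]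

theorem exists_tmul_right (x : H) : ∃ T : K →L[ℂ] HTensor H K, ∀ y, T y = tmulH x y :=
  ⟨(UniformSpace.Completion.toComplL (𝕜 := ℂ) (E := H ⊗[ℂ] K)) ∘L TensorProduct.mkL ℂ H K x,
    fun _ => rfl⟩

theorem exists_tmul_left (y : K) : ∃ T : H →L[ℂ] HTensor H K, ∀ x, T x = tmulH x y :=
  ⟨(UniformSpace.Completion.toComplL (𝕜 := ℂ) (E := H ⊗[ℂ] K)) ∘L
    (TensorProduct.mkL ℂ H K).flip y, fun _ => rfl⟩

theorem tensor_top {E : Type} [NormedAddCommGroup E] [InnerProductSpace ℂ E]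
    (W : Submodule ℂ E) (hW : IsClosed (W : Set E)) (T : HTensor H K →L[ℂ] E)
    (h : ∀ x y, T (tmulH x y) ∈ W) (z : HTensor H K) : T z ∈ W := by
  induction z using UniformSpace.Completion.induction_on with
  | hp => exact hW.preimage T.continuous
  | ih a =>
    induction a using TensorProduct.induction_on with
    | zero => rw [UniformSpace.Completion.coe_zero, map_zero]; exact W.zero_mem
    | tmul x y => exact h x y
    | add a b ha hb =>
      rw [UniformSpace.Completion.coe_add, map_add]; exact W.add_mem ha hb

end

theorem eT_mem (r s : ℕ) (t : ℤ) : eT r s t ∈ Submodule.span ℂ (Set.range UVec) := by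
  obtain ⟨N, I, J, hI, hJ, h1, h2, h3⟩ : ∃ N I J : ℕ, I ≤ N ∧ J ≤ N ∧ N - max I J = r ∧
      min I J = s ∧ (J : ℤ) - I = t :=
    ⟨r + s + t.natAbs, s + (-t).toNat, s + t.toNat, by omega, by omega, by omega, by omega,
      by omega⟩
  have h : eT r s t = (-1 : ℂ) ^ (max I J - J) • UVec ⟨(N, I, J), hI, hJ⟩ := by
    simp only [UVec, h1, h2, h3, smul_smul, ← mul_pow]
    simp
  rw [h]
  exact Submodule.smul_mem _ _ (Submodule.subset_span ⟨_, rfl⟩)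

theorem UVec_dense : ⊤ ≤ (Submodule.span ℂ (Set.range UVec)).topologicalClosure := by
  set W := (Submodule.span ℂ (Set.range UVec)).topologicalClosure with hWdef
  have hW : IsClosed (W : Set HTot) := Submodule.isClosed_topologicalClosure _
  have h0 : ∀ r s t, eT r s t ∈ W := fun r s t => Submodule.le_topologicalClosure _ (eT_mem r s t)
  rintro z -
  refine tensor_top W hW (ContinuousLinearMap.id ℂ HTot) (fun x z => ?_) z
  change tmulH x z ∈ W
  obtain ⟨T, hT⟩ := exists_tmul_right (K := HPi) x
  rw [← hT]
  refine tensor_top W hW T (fun y w => ?_) z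
  rw [hT]
  obtain ⟨T₁, hT₁⟩ := exists_tmul_left (H := L2 ℕ) (tmulH y w)
  rw [← hT₁]
  refine mem_closed_of_bv W hW T₁ (fun r => ?_) x
  rw [hT₁]
  obtain ⟨T₂, hT₂⟩ := exists_tmul_right (K := HPi) (bv r)
  obtain ⟨T₃, hT₃⟩ := exists_tmul_left (H := L2 ℕ) w
  rw [← hT₂, ← hT₃]
  refine mem_closed_of_bv W hW (T₂ ∘L T₃) (fun s => ?_) y
  obtain ⟨T₄, hT₄⟩ := exists_tmul_right (K := L2 ℤ) (bv s)
  rw [ContinuousLinearMap.comp_apply, hT₃, ← hT₄]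
  refine mem_closed_of_bv W hW (T₂ ∘L T₄) (fun t => ?_) w
  rw [ContinuousLinearMap.comp_apply, hT₄, hT₂]
  exact h0 r s t

/-- The vectors `U e^n_{ij}` as an orthonormal basis of `H_mult ⊗ H_π`. -/
def UBasis : HilbertBasis Gam ℂ HTot := HilbertBasis.mk UVec_orthonormal UVec_dense

/-- The unitary `U : ℓ²(Γ) → H_mult ⊗ H_π`. -/
def U : L2 Gam ≃ₗᵢ[ℂ] HTot := UBasis.repr.symm

theorem U_apply (p : Gam) : U (bv p) = UVec p := by
  rw [U, bv, UBasis.repr_symm_single, UBasis, HilbertBasis.coe_mk]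

/-- The Toeplitz algebra: the `C*`-algebra generated by the shift on `ℓ²(ℕ)`. -/
def toeplitz : StarSubalgebra ℂ (L2 ℕ →L[ℂ] L2 ℕ) := StarAlgebra.elemental ℂ shiftN

/-- `𝒯 ⊗ K(H_π)`: the closed linear span of the operators `S ⊗ T` on `H_mult ⊗ H_π` with `S` in the
Toeplitz algebra and `T` compact. -/
def toeplitzCompact : Submodule ℂ (HTot →L[ℂ] HTot) :=
  (Submodule.span ℂ {X | ∃ S ∈ toeplitz, ∃ T : HPi →L[ℂ] HPi,
    IsCompactOperator T ∧ X = opTensor S T}).topologicalClosure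

/-- The GNS representation `λ_q` of the state `h`, viewed on `ℓ²(Γ)` through `V`. -/
def lam {q : ℝ} (h : A q →ₚ[ℂ] ℂ) (V : h.GNS ≃ₗᵢ[ℂ] L2 Gam) (a : A q) : L2 Gam →L[ℂ] L2 Gam :=
  (V.toContinuousLinearEquiv : h.GNS →L[ℂ] L2 Gam) ∘L h.gnsStarAlgHom a ∘L
    (V.symm.toContinuousLinearEquiv : L2 Gam →L[ℂ] h.GNS)

/-- `U T U^*`, an operator on `H_mult ⊗ H_π`. -/
def conjU (T : L2 Gam →L[ℂ] L2 Gam) : HTot →L[ℂ] HTot :=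
  (U.toContinuousLinearEquiv : L2 Gam →L[ℂ] HTot) ∘L T ∘L
    (U.symm.toContinuousLinearEquiv : HTot →L[ℂ] L2 Gam)

end SUq2

end

/-! The formulas for λ_q define two bounded operators on ℓ²(Γ), each a sum of weighted shifts, and
these satisfy the relations of `A q` (`reg_relations`), so universality turns them into a
representation. The Haar state is its vector state at e^0_{00}. That vector is cyclic
(`orbit_dense`), hence the GNS space is ℓ²(Γ) with the prescribed action.

Invariance of the state is algebraic and is proved on the polynomial algebra. There the raising
operator E and the scaling K of U_q(sl₂) act, with ΔE = (id ⊗ E)Δ and ΔK = (id ⊗ K)Δ. As q is not a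
root of unity, a functional τ with τE = 0 and τK = τ is determined by τ(1) (`eq_zero_of_invariant`).
The state h has both properties, since it vanishes on all monomials except β^l β*^l, where it equals
(1 - q²)/(1 - q^{2l+2}) (`isPolHaar_haarLin`). For any ρ the functional (ρ ⊗ h)Δ inherits them, so
it is ρ(1)h. An automorphism that preserves h and reverses the coproduct yields the other
invariance. Uniqueness comes from evaluating (h ⊗ h')Δ in two ways.

For the comparison with I ⊗ π_q, the conjugated generators are written in the basis e(r,s,t) as sums
of products A W, where A is a tensor product of shifts and identities and W is diagonal
(`conjU_regAlpha_eT`, `conjU_regBeta_eT`). In each sum one term moves the basis as I ⊗ π_q does, and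
subtracting I ⊗ π_q only changes the diagonal of that term. All diagonal entries that remain are
O(|q|^{s+|t|}) uniformly in r and converge as r → ∞. Such a diagonal is a norm limit of finite sums
of (convergent diagonal) ⊗ (rank one projection), and convergent diagonals lie in 𝒯, so it belongs
to 𝒯 ⊗ K (`mem_toeplitzCompact_of_isDiag`). Multiplying by the shifts stays inside 𝒯 ⊗ K, which
settles the generators and their adjoints; multiplicativity and density give all of `A q`
(`sub_mem_of_generators`). -/

noncomputable section

namespace SUq2

/-! ### The polynomial algebra by generators and relations -/

/-- The defining relations of the polynomial algebra of `SU_q(2)`, for the images `v` of the four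
letters in an algebra without involution. -/
structure AlgRelations {B : Type*} [Ring B] [Algebra ℂ B] (q : ℂ) (v : Letter → B) : Prop where
  star_mul_add : v .aStar * v .a = 1 - v .b * v .bStar
  mul_star_add : v .a * v .aStar = 1 - (q ^ 2) • (v .b * v .bStar)
  a_b : v .a * v .b = q • (v .b * v .a)
  a_bStar : v .a * v .bStar = q • (v .bStar * v .a)
  b_aStar : v .b * v .aStar = q • (v .aStar * v .b)
  bStar_aStar : v .bStar * v .aStar = q • (v .aStar * v .bStar)
  bStar_b : v .bStar * v .b = v .b * v .bStar

/-- The relations of the polynomial algebra, as relations between noncommutative polynomials. -/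
inductive PolRel (q : ℂ) : Poly → Poly → Prop
  | star_mul_add : PolRel q (FreeAlgebra.ι ℂ .aStar * FreeAlgebra.ι ℂ .a)
      (1 - FreeAlgebra.ι ℂ .b * FreeAlgebra.ι ℂ .bStar)
  | mul_star_add : PolRel q (FreeAlgebra.ι ℂ .a * FreeAlgebra.ι ℂ .aStar)
      (1 - (q ^ 2) • (FreeAlgebra.ι ℂ .b * FreeAlgebra.ι ℂ .bStar))
  | a_b : PolRel q (FreeAlgebra.ι ℂ .a * FreeAlgebra.ι ℂ .b)
      (q • (FreeAlgebra.ι ℂ .b * FreeAlgebra.ι ℂ .a))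
  | a_bStar : PolRel q (FreeAlgebra.ι ℂ .a * FreeAlgebra.ι ℂ .bStar)
      (q • (FreeAlgebra.ι ℂ .bStar * FreeAlgebra.ι ℂ .a))
  | b_aStar : PolRel q (FreeAlgebra.ι ℂ .b * FreeAlgebra.ι ℂ .aStar)
      (q • (FreeAlgebra.ι ℂ .aStar * FreeAlgebra.ι ℂ .b))
  | bStar_aStar : PolRel q (FreeAlgebra.ι ℂ .bStar * FreeAlgebra.ι ℂ .aStar)
      (q • (FreeAlgebra.ι ℂ .aStar * FreeAlgebra.ι ℂ .bStar))
  | bStar_b : PolRel q (FreeAlgebra.ι ℂ .bStar * FreeAlgebra.ι ℂ .b)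
      (FreeAlgebra.ι ℂ .b * FreeAlgebra.ι ℂ .bStar)

/-- The polynomial algebra of `SU_q(2)`. -/
def PolAlg (q : ℂ) : Type := RingQuot (PolRel q)

instance (q : ℂ) : Ring (PolAlg q) := inferInstanceAs (Ring (RingQuot (PolRel q)))
instance (q : ℂ) : Algebra ℂ (PolAlg q) := inferInstanceAs (Algebra ℂ (RingQuot (PolRel q)))

/-- The quotient map from noncommutative polynomials. -/
def polMk (q : ℂ) : Poly →ₐ[ℂ] PolAlg q := RingQuot.mkAlgHom ℂ (PolRel q)

/-- The generators of the polynomial algebra. -/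
def letter (q : ℂ) (x : Letter) : PolAlg q := polMk q (FreeAlgebra.ι ℂ x)

theorem polMk_ι (q : ℂ) (x : Letter) : polMk q (FreeAlgebra.ι ℂ x) = letter q x := rfl

theorem polMk_surjective (q : ℂ) : Function.Surjective (polMk q) :=
  RingQuot.mkAlgHom_surjective ℂ (PolRel q)

theorem polMk_rel {q : ℂ} {x y : Poly} (h : PolRel q x y) : polMk q x = polMk q y :=
  RingQuot.mkAlgHom_rel ℂ h

theorem letter_relations (q : ℂ) : AlgRelations q (letter q) := by
  constructor
  · simpa only [map_mul, map_sub, map_one, map_smul, polMk_ι] using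
      polMk_rel (PolRel.star_mul_add (q := q))
  · simpa only [map_mul, map_sub, map_one, map_smul, polMk_ι] using
      polMk_rel (PolRel.mul_star_add (q := q))
  · simpa only [map_mul, map_sub, map_one, map_smul, polMk_ι] using
      polMk_rel (PolRel.a_b (q := q))
  · simpa only [map_mul, map_sub, map_one, map_smul, polMk_ι] using
      polMk_rel (PolRel.a_bStar (q := q))
  · simpa only [map_mul, map_sub, map_one, map_smul, polMk_ι] using
      polMk_rel (PolRel.b_aStar (q := q))
  · simpa only [map_mul, map_sub, map_one, map_smul, polMk_ι] using
      polMk_rel (PolRel.bStar_aStar (q := q))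
  · simpa only [map_mul, map_sub, map_one, map_smul, polMk_ι] using
      polMk_rel (PolRel.bStar_b (q := q))

section
variable {B : Type*} [Ring B] [Algebra ℂ B] {q : ℂ}

/-- The universal property of the polynomial algebra. -/
def polLift {v : Letter → B} (h : AlgRelations q v) : PolAlg q →ₐ[ℂ] B :=
  RingQuot.liftAlgHom ℂ ⟨FreeAlgebra.lift ℂ v, by
    rintro _ _ (_ | _ | _ | _ | _ | _ | _) <;>
      simp only [map_mul, map_sub, map_one, map_smul, FreeAlgebra.lift_ι_apply]
    exacts [h.star_mul_add, h.mul_star_add, h.a_b, h.a_bStar, h.b_aStar, h.bStar_aStar,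
      h.bStar_b]⟩

theorem polLift_polMk {v : Letter → B} (h : AlgRelations q v) (p : Poly) :
    polLift h (polMk q p) = FreeAlgebra.lift ℂ v p :=
  RingQuot.liftAlgHom_mkAlgHom_apply ℂ _ _ _

theorem polLift_letter {v : Letter → B} (h : AlgRelations q v) (x : Letter) :
    polLift h (letter q x) = v x := by
  rw [letter, polLift_polMk, FreeAlgebra.lift_ι_apply]

theorem pol_induction {motive : PolAlg q → Prop}
    (algebraMap : ∀ r, motive (algebraMap ℂ (PolAlg q) r))
    (letter : ∀ x, motive (letter q x))
    (mul : ∀ a b, motive a → motive b → motive (a * b))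
    (add : ∀ a b, motive a → motive b → motive (a + b)) (x : PolAlg q) : motive x := by
  obtain ⟨p, rfl⟩ := polMk_surjective q x
  induction p using FreeAlgebra.induction with
  | grade0 r => rw [AlgHom.commutes]; exact algebraMap r
  | grade1 x => exact letter x
  | mul a b ha hb => rw [map_mul]; exact mul _ _ ha hb
  | add a b ha hb => rw [map_add]; exact add _ _ ha hb

theorem pol_hom_ext {φ ψ : PolAlg q →ₐ[ℂ] B} (h : ∀ x, φ (letter q x) = ψ (letter q x)) :
    φ = ψ := by
  refine RingQuot.ringQuot_ext' ℂ φ ψ (FreeAlgebra.hom_ext (funext fun x => ?_))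
  exact h x

theorem qcomm_pow_right {x y : B} {s : ℂ} (h : x * y = s • (y * x)) (n : ℕ) :
    x * y ^ n = s ^ n • (y ^ n * x) := by
  induction n with
  | zero => simp
  | succ n ih =>
    rw [pow_succ, ← mul_assoc, ih, smul_mul_assoc, mul_assoc, h, mul_smul_comm, smul_smul,
      mul_assoc, pow_succ]

theorem qcomm_pow_left {x y : B} {s : ℂ} (h : x * y = s • (y * x)) (n : ℕ) :
    x ^ n * y = s ^ n • (y * x ^ n) := by
  induction n with
  | zero => simp
  | succ n ih =>
    rw [pow_succ, mul_assoc, h, mul_smul_comm, ← mul_assoc, ih, smul_mul_assoc, smul_smul,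
      mul_assoc, pow_succ, mul_comm s]

theorem qcomm_symm {x y : B} {s : ℂ} (hs : s ≠ 0) (h : x * y = s • (y * x)) :
    y * x = s⁻¹ • (x * y) := by
  rw [h, smul_smul, inv_mul_cancel₀ hs, one_smul]

end

/-! ### Monomials -/

section
variable (q : ℂ)

/-- The monomial `α^i β^j β*^l`. -/
def aMon (i j l : ℕ) : PolAlg q := letter q .a ^ i * (letter q .b ^ j * letter q .bStar ^ l)

/-- The monomial `α*^i β^j β*^l`. -/
def dMon (i j l : ℕ) : PolAlg q := letter q .aStar ^ i * (letter q .b ^ j * letter q .bStar ^ l)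

theorem aMon_zero (j l : ℕ) : aMon q 0 j l = dMon q 0 j l := by simp [aMon, dMon]

variable {q}

theorem bStar_mul_b_pow (j : ℕ) :
    letter q .bStar * letter q .b ^ j = letter q .b ^ j * letter q .bStar :=
  (Commute.pow_right (letter_relations q).bStar_b j)

theorem bStar_mul_mon (j l : ℕ) :
    letter q .bStar * (letter q .b ^ j * letter q .bStar ^ l) =
      letter q .b ^ j * letter q .bStar ^ (l + 1) := by
  rw [← mul_assoc, bStar_mul_b_pow, mul_assoc, pow_succ']

theorem b_mul_mon (j l : ℕ) :
    letter q .b * (letter q .b ^ j * letter q .bStar ^ l) =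
      letter q .b ^ (j + 1) * letter q .bStar ^ l := by
  rw [← mul_assoc, pow_succ']

theorem b_mul_aMon (hq : q ≠ 0) (i j l : ℕ) :
    letter q .b * aMon q i j l = q⁻¹ ^ i • aMon q i (j + 1) l := by
  rw [aMon, ← mul_assoc, qcomm_pow_right (qcomm_symm hq (letter_relations q).a_b),
    smul_mul_assoc, mul_assoc, b_mul_mon, aMon]

theorem bStar_mul_aMon (hq : q ≠ 0) (i j l : ℕ) :
    letter q .bStar * aMon q i j l = q⁻¹ ^ i • aMon q i j (l + 1) := by
  rw [aMon, ← mul_assoc, qcomm_pow_right (qcomm_symm hq (letter_relations q).a_bStar),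
    smul_mul_assoc, mul_assoc, bStar_mul_mon, aMon]

theorem b_mul_dMon (i j l : ℕ) :
    letter q .b * dMon q i j l = q ^ i • dMon q i (j + 1) l := by
  rw [dMon, ← mul_assoc, qcomm_pow_right (letter_relations q).b_aStar,
    smul_mul_assoc, mul_assoc, b_mul_mon, dMon]

theorem bStar_mul_dMon (i j l : ℕ) :
    letter q .bStar * dMon q i j l = q ^ i • dMon q i j (l + 1) := by
  rw [dMon, ← mul_assoc, qcomm_pow_right (letter_relations q).bStar_aStar,
    smul_mul_assoc, mul_assoc, bStar_mul_mon, dMon]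

theorem a_mul_aMon (i j l : ℕ) : letter q .a * aMon q i j l = aMon q (i + 1) j l := by
  rw [aMon, ← mul_assoc, ← pow_succ', aMon]

theorem aStar_mul_dMon (i j l : ℕ) : letter q .aStar * dMon q i j l = dMon q (i + 1) j l := by
  rw [dMon, ← mul_assoc, ← pow_succ', dMon]

/-- Here α*α = 1 - ββ*, and moving β and β* to the right of α^i costs q⁻¹ for each α and each of the
two letters. -/
theorem aStar_mul_aMon (hq : q ≠ 0) (i j l : ℕ) : letter q .aStar * aMon q (i + 1) j l =
    aMon q i j l - (q⁻¹ ^ i * q⁻¹ ^ i) • aMon q i (j + 1) (l + 1) := by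
  rw [← a_mul_aMon, ← mul_assoc, (letter_relations q).star_mul_add, sub_mul, one_mul, mul_assoc,
    bStar_mul_aMon hq, mul_smul_comm, b_mul_aMon hq, smul_smul]

theorem a_mul_dMon (i j l : ℕ) : letter q .a * dMon q (i + 1) j l =
    dMon q i j l - (q ^ 2 * (q ^ i * q ^ i)) • dMon q i (j + 1) (l + 1) := by
  rw [← aStar_mul_dMon, ← mul_assoc, (letter_relations q).mul_star_add, sub_mul, one_mul,
    smul_mul_assoc, mul_assoc, bStar_mul_dMon, mul_smul_comm, b_mul_dMon, smul_smul, smul_smul,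
    mul_assoc]

/-- The span contains 1 and is stable under left multiplication by every letter, by the rewriting
rules above; hence it is a left ideal containing 1. -/
theorem mon_span (hq : q ≠ 0) (x : PolAlg q) : x ∈ Submodule.span ℂ
    ({x | ∃ i j l, x = aMon q i j l} ∪ {x | ∃ i j l, x = dMon q i j l}) := by
  set M := Submodule.span ℂ
    ({x | ∃ i j l, x = aMon q i j l} ∪ {x | ∃ i j l, x = dMon q i j l}) with hM
  have hA : ∀ i j l, aMon q i j l ∈ M := fun i j l =>
    Submodule.subset_span (Or.inl ⟨i, j, l, rfl⟩)
  have hD : ∀ i j l, dMon q i j l ∈ M := fun i j l =>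
    Submodule.subset_span (Or.inr ⟨i, j, l, rfl⟩)
  have key : ∀ x y : PolAlg q, y ∈ M → x * y ∈ M := by
    intro x
    induction x using pol_induction with
    | algebraMap r =>
      intro y hy
      rw [← Algebra.smul_def]
      exact M.smul_mem r hy
    | mul a b ha hb => intro y hy; rw [mul_assoc]; exact ha _ (hb _ hy)
    | add a b ha hb => intro y hy; rw [add_mul]; exact M.add_mem (ha _ hy) (hb _ hy)
    | letter x =>
      intro y hy
      induction hy using Submodule.span_induction with
      | zero => rw [mul_zero]; exact M.zero_mem
      | add y z _ _ hy hz => rw [mul_add]; exact M.add_mem hy hz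
      | smul c y _ hy => rw [mul_smul_comm]; exact M.smul_mem c hy
      | mem y hy =>
        rcases hy with ⟨i, j, l, rfl⟩ | ⟨i, j, l, rfl⟩
        · cases x with
          | a => rw [a_mul_aMon]; exact hA _ _ _
          | b => rw [b_mul_aMon hq]; exact M.smul_mem _ (hA _ _ _)
          | bStar => rw [bStar_mul_aMon hq]; exact M.smul_mem _ (hA _ _ _)
          | aStar =>
            cases i with
            | zero => rw [aMon_zero, aStar_mul_dMon]; exact hD _ _ _
            | succ i =>
              rw [aStar_mul_aMon hq]
              exact M.sub_mem (hA _ _ _) (M.smul_mem _ (hA _ _ _))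
        · cases x with
          | aStar => rw [aStar_mul_dMon]; exact hD _ _ _
          | b => rw [b_mul_dMon]; exact M.smul_mem _ (hD _ _ _)
          | bStar => rw [bStar_mul_dMon]; exact M.smul_mem _ (hD _ _ _)
          | a =>
            cases i with
            | zero => rw [← aMon_zero, a_mul_aMon]; exact hA _ _ _
            | succ i =>
              rw [a_mul_dMon]
              exact M.sub_mem (hD _ _ _) (M.smul_mem _ (hD _ _ _))
  have h1 : (1 : PolAlg q) ∈ M := by
    have := hA 0 0 0
    simpa [aMon] using this
  simpa using key x 1 h1

/-- The α-monomials need testing only from exponent 1 on, because those of exponent 0 are also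
α*-monomials. -/
theorem functional_ext (hq : q ≠ 0) {σ τ : PolAlg q →ₗ[ℂ] ℂ}
    (ha : ∀ i j l, σ (aMon q (i + 1) j l) = τ (aMon q (i + 1) j l))
    (hd : ∀ i j l, σ (dMon q i j l) = τ (dMon q i j l)) : σ = τ := by
  ext x
  refine LinearMap.eqOn_span (s := {x | ∃ i j l, x = aMon q i j l} ∪
    {x | ∃ i j l, x = dMon q i j l}) ?_ (mon_span hq x)
  rintro _ (⟨i, j, l, rfl⟩ | ⟨i, j, l, rfl⟩)
  · cases i with
    | zero => rw [aMon_zero]; exact hd _ _ _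
    | succ i => exact ha i j l
  · exact hd i j l

/-! ### The twisted derivation -/

/-- The generators of the upper triangular representation encoding a twisted derivation. -/
def raiseGen (q : ℂ) : Letter → Matrix (Fin 2) (Fin 2) (PolAlg q)
  | .a => !![q • letter q .a, 0; 0, letter q .a]
  | .b => !![q • letter q .b, 0; 0, letter q .b]
  | .bStar => !![q⁻¹ • letter q .bStar, -q⁻¹ • letter q .a; 0, letter q .bStar]
  | .aStar => !![q⁻¹ • letter q .aStar, letter q .b; 0, letter q .aStar]

/-- A homomorphism x ↦ [[K x, E x], [0, x]] into upper triangular matrices amounts to a homomorphism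
K together with a map E obeying E(xy) = K(x)E(y) + E(x)y. Checking the relations on matrices
therefore constructs the scaling and the raising operator simultaneously. -/
theorem raiseGen_relations (hq : q ≠ 0) : AlgRelations q (raiseGen q) := by
  have h := letter_relations q
  constructor <;> ext i j <;> fin_cases i <;> fin_cases j <;>
    simp [raiseGen, Matrix.mul_apply, Fin.sum_univ_two, h.star_mul_add, h.mul_star_add, h.a_b,
      h.a_bStar, h.b_aStar, h.bStar_aStar, h.bStar_b, smul_smul, hq]
  · rw [sq]
  · have h1 : q⁻¹ * q ^ 2 = q := by field_simp
    rw [smul_sub, smul_sub, smul_smul, h1]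
    abel

/-- The representation by upper triangular matrices encoding a twisted derivation. -/
def raiseHom (hq : q ≠ 0) : PolAlg q →ₐ[ℂ] Matrix (Fin 2) (Fin 2) (PolAlg q) :=
  polLift (raiseGen_relations hq)

theorem raiseHom_lower (hq : q ≠ 0) (x : PolAlg q) :
    raiseHom hq x 1 0 = 0 ∧ raiseHom hq x 1 1 = x := by
  induction x using pol_induction with
  | algebraMap r => simp [AlgHom.commutes, Matrix.algebraMap_matrix_apply]
  | letter x => rw [raiseHom, polLift_letter]; cases x <;> simp [raiseGen]
  | mul a b ha hb => simp [Matrix.mul_apply, Fin.sum_univ_two, ha, hb]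
  | add a b ha hb => simp [ha, hb]

/-- The scaling automorphism. -/
def scaling (hq : q ≠ 0) : PolAlg q →ₗ[ℂ] PolAlg q where
  toFun x := raiseHom hq x 0 0
  map_add' := by simp
  map_smul' := by simp

/-- The twisted derivation given by the raising operator of `U_q(sl₂)`. -/
def raise (hq : q ≠ 0) : PolAlg q →ₗ[ℂ] PolAlg q where
  toFun x := raiseHom hq x 0 1
  map_add' := by simp
  map_smul' := by simp

theorem scaling_mul (hq : q ≠ 0) (x y : PolAlg q) :
    scaling hq (x * y) = scaling hq x * scaling hq y := by
  simp [scaling, Matrix.mul_apply, Fin.sum_univ_two, raiseHom_lower]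

theorem raise_mul (hq : q ≠ 0) (x y : PolAlg q) :
    raise hq (x * y) = scaling hq x * raise hq y + raise hq x * y := by
  simp [scaling, raise, Matrix.mul_apply, Fin.sum_univ_two, raiseHom_lower]

theorem scaling_algebraMap (hq : q ≠ 0) (r : ℂ) :
    scaling hq (algebraMap ℂ _ r) = algebraMap ℂ _ r := by
  simp [scaling, AlgHom.commutes, Matrix.algebraMap_matrix_apply]

theorem raise_algebraMap (hq : q ≠ 0) (r : ℂ) : raise hq (algebraMap ℂ _ r) = 0 := by
  simp [raise, AlgHom.commutes, Matrix.algebraMap_matrix_apply]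

theorem scaling_one (hq : q ≠ 0) : scaling hq 1 = 1 := by
  simpa using scaling_algebraMap hq 1

theorem raise_one (hq : q ≠ 0) : raise hq 1 = 0 := by
  simpa using raise_algebraMap hq 1

theorem scaling_pow (hq : q ≠ 0) (x : PolAlg q) (n : ℕ) :
    scaling hq (x ^ n) = scaling hq x ^ n := by
  induction n with
  | zero => simp [scaling_one]
  | succ n ih => rw [pow_succ, scaling_mul, ih, pow_succ]

theorem raise_a (hq : q ≠ 0) : raise hq (letter q .a) = 0 := by
  simp [raise, raiseHom, polLift_letter, raiseGen]

theorem raise_b (hq : q ≠ 0) : raise hq (letter q .b) = 0 := by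
  simp [raise, raiseHom, polLift_letter, raiseGen]

theorem raise_bStar (hq : q ≠ 0) : raise hq (letter q .bStar) = -q⁻¹ • letter q .a := by
  simp [raise, raiseHom, polLift_letter, raiseGen]

theorem raise_aStar (hq : q ≠ 0) : raise hq (letter q .aStar) = letter q .b := by
  simp [raise, raiseHom, polLift_letter, raiseGen]

theorem scaling_a (hq : q ≠ 0) : scaling hq (letter q .a) = q • letter q .a := by
  simp [scaling, raiseHom, polLift_letter, raiseGen]

theorem scaling_b (hq : q ≠ 0) : scaling hq (letter q .b) = q • letter q .b := by
  simp [scaling, raiseHom, polLift_letter, raiseGen]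

theorem scaling_bStar (hq : q ≠ 0) : scaling hq (letter q .bStar) = q⁻¹ • letter q .bStar := by
  simp [scaling, raiseHom, polLift_letter, raiseGen]

theorem scaling_aStar (hq : q ≠ 0) : scaling hq (letter q .aStar) = q⁻¹ • letter q .aStar := by
  simp [scaling, raiseHom, polLift_letter, raiseGen]

/-- The coefficient of `α β*^(l-1)` in the derivative of `β*^l`. -/
def raiseCoeffB (q : ℂ) : ℕ → ℂ
  | 0 => 0
  | l + 1 => -q⁻¹ + q⁻¹ * q⁻¹ * raiseCoeffB q l

/-- The coefficient of `α*^(i-1) β` in the derivative of `α*^i`. -/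
def raiseCoeffA (q : ℂ) : ℕ → ℂ
  | 0 => 0
  | i + 1 => q ^ i + q⁻¹ * raiseCoeffA q i

/-- The recursion sums a geometric series. The closed form is what exposes the nonvanishing of the
coefficient for l > 0 when q is not a root of unity. -/
theorem raiseCoeffB_eq (hq : q ≠ 0) (hq2 : q ^ 2 ≠ 1) (l : ℕ) :
    raiseCoeffB q l = -(q * (q⁻¹ ^ (2 * l) * (1 - q ^ (2 * l)))) / (1 - q ^ 2) := by
  have h : 1 - q ^ 2 ≠ 0 := sub_ne_zero.2 hq2.symm
  induction l with
  | zero => simp [raiseCoeffB]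
  | succ l ih =>
    rw [raiseCoeffB, ih]
    simp only [inv_pow]
    field_simp
    ring

theorem raiseCoeffA_eq (hq : q ≠ 0) (hq2 : q ^ 2 ≠ 1) (i : ℕ) :
    raiseCoeffA q i = q * q⁻¹ ^ i * (1 - q ^ (2 * i)) / (1 - q ^ 2) := by
  have h : 1 - q ^ 2 ≠ 0 := sub_ne_zero.2 hq2.symm
  induction i with
  | zero => simp [raiseCoeffA]
  | succ l ih =>
    rw [raiseCoeffA, ih]
    simp only [inv_pow]
    field_simp
    ring

theorem raise_b_pow (hq : q ≠ 0) (j : ℕ) : raise hq (letter q .b ^ j) = 0 := by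
  induction j with
  | zero => simp [raise_one]
  | succ j ih => rw [pow_succ, raise_mul, ih, raise_b, mul_zero, zero_mul, add_zero]

theorem raise_a_pow (hq : q ≠ 0) (j : ℕ) : raise hq (letter q .a ^ j) = 0 := by
  induction j with
  | zero => simp [raise_one]
  | succ j ih => rw [pow_succ, raise_mul, ih, raise_a, mul_zero, zero_mul, add_zero]

theorem raise_bStar_pow (hq : q ≠ 0) (l : ℕ) : raise hq (letter q .bStar ^ (l + 1)) =
    raiseCoeffB q (l + 1) • (letter q .a * letter q .bStar ^ l) := by
  induction l with
  | zero => simp [raiseCoeffB, raise_bStar]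
  | succ l ih =>
    rw [pow_succ', raise_mul, ih, raise_bStar, scaling_bStar, raiseCoeffB.eq_2 q (l + 1),
      smul_mul_smul_comm, ← mul_assoc (letter q .bStar),
      qcomm_symm hq (letter_relations q).a_bStar, smul_mul_assoc, mul_assoc (letter q .a),
      ← pow_succ', smul_smul, smul_mul_assoc, ← add_smul]
    congr 1
    ring

theorem raise_aStar_pow (hq : q ≠ 0) (i : ℕ) : raise hq (letter q .aStar ^ (i + 1)) =
    raiseCoeffA q (i + 1) • (letter q .aStar ^ i * letter q .b) := by
  induction i with
  | zero => simp [raiseCoeffA, raise_aStar]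
  | succ i ih =>
    rw [pow_succ', raise_mul, ih, raise_aStar, scaling_aStar, raiseCoeffA.eq_2 q (i + 1), smul_mul_smul_comm,
      ← mul_assoc (letter q .aStar), ← pow_succ',
      qcomm_pow_right (letter_relations q).b_aStar, ← add_smul]
    congr 1
    ring

theorem raise_mon (hq : q ≠ 0) (j l : ℕ) :
    raise hq (letter q .b ^ j * letter q .bStar ^ (l + 1)) =
      raiseCoeffB q (l + 1) • aMon q 1 j l := by
  rw [raise_mul, raise_b_pow, zero_mul, add_zero, raise_bStar_pow, scaling_pow, scaling_b,
    smul_pow, smul_mul_smul_comm, ← mul_assoc, qcomm_pow_left (qcomm_symm hq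
    (letter_relations q).a_b), smul_mul_assoc, smul_smul, aMon, pow_one, mul_assoc (letter q .a)]
  -- Scaling β^j produces q^j, which cancels the q^{-j} from moving α to the left of β^j.
  congr 1
  rw [inv_pow]
  field_simp

theorem raise_aMon (hq : q ≠ 0) (i j l : ℕ) : raise hq (aMon q i j (l + 1)) =
    (q ^ i * raiseCoeffB q (l + 1)) • aMon q (i + 1) j l := by
  rw [aMon, raise_mul, raise_a_pow, zero_mul, add_zero, raise_mon, scaling_pow, scaling_a,
    smul_pow, smul_mul_smul_comm, aMon, aMon, pow_one, ← mul_assoc, ← pow_succ]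

theorem raise_aMon_zero (hq : q ≠ 0) (i j : ℕ) : raise hq (aMon q i j 0) = 0 := by
  rw [aMon, pow_zero, mul_one, raise_mul, raise_b_pow, raise_a_pow, mul_zero, zero_mul, add_zero]

theorem raise_dMon_zero (hq : q ≠ 0) (i j : ℕ) : raise hq (dMon q (i + 1) j 0) =
    raiseCoeffA q (i + 1) • dMon q i (j + 1) 0 := by
  rw [dMon, pow_zero, mul_one, raise_mul, raise_b_pow, mul_zero, zero_add, raise_aStar_pow,
    smul_mul_assoc, mul_assoc, ← pow_succ', dMon, pow_zero, mul_one]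

/-- Differentiating α*^{i+1} gives the first term. Differentiating β*^{l+1} creates an α next to
α*^{i+1}, and α*α = 1 - ββ* splits that contribution into two monomials. -/
theorem raise_dMon (hq : q ≠ 0) (i j l : ℕ) : raise hq (dMon q (i + 1) j (l + 1)) =
    raiseCoeffA q (i + 1) • dMon q i (j + 1) (l + 1) +
      (q⁻¹ ^ (i + 1) * raiseCoeffB q (l + 1)) • (dMon q i j l - dMon q i (j + 1) (l + 1)) := by
  have h1 : letter q .aStar ^ (i + 1) * aMon q 1 j l = dMon q i j l - dMon q i (j + 1) (l + 1) := by
    have := aStar_mul_aMon hq 0 j l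
    rw [pow_succ, mul_assoc, this, aMon_zero, aMon_zero]
    simp [mul_sub, dMon]
  rw [dMon, raise_mul, raise_mon, raise_aStar_pow, scaling_pow, scaling_aStar, smul_pow,
    smul_mul_smul_comm, h1, smul_mul_assoc, mul_assoc, b_mul_mon, ← dMon, add_comm]

theorem scaling_dMon (hq : q ≠ 0) (i j l : ℕ) :
    scaling hq (dMon q i j l) = (q⁻¹ ^ i * (q ^ j * q⁻¹ ^ l)) • dMon q i j l := by
  rw [dMon, scaling_mul, scaling_mul, scaling_pow, scaling_pow, scaling_pow, scaling_aStar,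
    scaling_b, scaling_bStar, smul_pow, smul_pow, smul_pow, smul_mul_smul_comm,
    smul_mul_smul_comm]

theorem scaling_aMon (hq : q ≠ 0) (i j l : ℕ) :
    scaling hq (aMon q i j l) = (q ^ i * (q ^ j * q⁻¹ ^ l)) • aMon q i j l := by
  rw [aMon, scaling_mul, scaling_mul, scaling_pow, scaling_pow, scaling_pow, scaling_a,
    scaling_b, scaling_bStar, smul_pow, smul_pow, smul_pow, smul_mul_smul_comm,
    smul_mul_smul_comm]

/-- A functional invariant under the raising operator and the scaling is determined by its value
at `1`. -/
theorem eq_zero_of_invariant (hq : q ≠ 0) (hq1 : ∀ n, n ≠ 0 → q ^ n ≠ 1)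
    {τ : PolAlg q →ₗ[ℂ] ℂ} (h1 : τ 1 = 0) (hr : ∀ x, τ (raise hq x) = 0)
    (hs : ∀ x, τ (scaling hq x) = τ x) : τ = 0 := by
  have hne : ∀ n, n ≠ 0 → 1 - q ^ n ≠ 0 := fun n hn => sub_ne_zero.2 (hq1 n hn).symm
  have hB : ∀ l, raiseCoeffB q (l + 1) ≠ 0 := fun l => by
    rw [raiseCoeffB_eq hq (hq1 2 two_ne_zero)]
    have := hne (2 * (l + 1)) (by omega)
    have h2 := hne 2 two_ne_zero
    simp [*]
  have hA : ∀ i, raiseCoeffA q (i + 1) ≠ 0 := fun l => by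
    rw [raiseCoeffA_eq hq (hq1 2 two_ne_zero)]
    have := hne (2 * (l + 1)) (by omega)
    have h2 := hne 2 two_ne_zero
    simp [*]
  -- This is the total coefficient of α*^i β^{j+1} β*^{l+1} in `raise_dMon`; the two closed forms
  -- combine into a single factor 1 - q^{2(i+1)+2(l+1)}.
  have hAB : ∀ i l, raiseCoeffA q (i + 1) - q⁻¹ ^ (i + 1) * raiseCoeffB q (l + 1) ≠ 0 := by
    intro i l
    have h3 : raiseCoeffA q (i + 1) - q⁻¹ ^ (i + 1) * raiseCoeffB q (l + 1) =
        q * q⁻¹ ^ (i + 1) * q⁻¹ ^ (2 * (l + 1)) * (1 - q ^ (2 * (i + 1) + 2 * (l + 1))) /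
          (1 - q ^ 2) := by
      have := hne 2 two_ne_zero
      rw [raiseCoeffB_eq hq (hq1 2 two_ne_zero), raiseCoeffA_eq hq (hq1 2 two_ne_zero)]
      simp only [inv_pow]
      field_simp
      ring
    rw [h3]
    have := hne (2 * (i + 1) + 2 * (l + 1)) (by omega)
    have h2 := hne 2 two_ne_zero
    simp [*]
  refine functional_ext hq (fun i j l => ?_) (fun i j l => ?_)
  -- Every monomial containing α is a nonzero multiple of a derivative.
  · have := hr (aMon q i j (l + 1))
    rw [raise_aMon, map_smul, smul_eq_mul] at this
    have h2 : q ^ i * raiseCoeffB q (l + 1) ≠ 0 := mul_ne_zero (pow_ne_zero _ hq) (hB l)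
    simpa [h2] using this
  · rw [LinearMap.zero_apply]
    -- Without β the monomial is an eigenvector of the scaling with eigenvalue q^{-(i+l)}, which
    -- differs from 1 unless the monomial is 1.
    have hj : ∀ l, τ (dMon q i 0 l) = 0 := by
      intro l
      by_cases h0 : i + l = 0
      · obtain ⟨rfl, rfl⟩ : i = 0 ∧ l = 0 := by omega
        simpa [dMon] using h1
      · have := hs (dMon q i 0 l)
        rw [scaling_dMon, map_smul, smul_eq_mul, ← sub_eq_zero, ← sub_one_mul] at this
        refine (mul_eq_zero.1 this).resolve_left fun h => hq1 _ h0 ?_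
        rw [sub_eq_zero, pow_zero, one_mul, ← pow_add, inv_pow, inv_eq_one] at h
        exact h
    -- Derivatives relate the value at (j+1, l+1) to the value at (j, l), so each monomial descends
    -- along its diagonal until one exponent is 0.
    induction l generalizing j with
    | zero =>
      cases j with
      | zero => exact hj 0
      | succ j =>
        have := hr (dMon q (i + 1) j 0)
        rw [raise_dMon_zero, map_smul, smul_eq_mul] at this
        exact (mul_eq_zero.1 this).resolve_left (hA i)
    | succ l ih =>
      cases j with
      | zero => exact hj _
      | succ j =>
        have := hr (dMon q (i + 1) j (l + 1))
        rw [raise_dMon, map_add, map_smul, map_smul, map_sub, ih j, smul_eq_mul, smul_eq_mul]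
          at this
        have h3 : (raiseCoeffA q (i + 1) - q⁻¹ ^ (i + 1) * raiseCoeffB q (l + 1)) *
            τ (dMon q i (j + 1) (l + 1)) = 0 := by linear_combination this
        exact (mul_eq_zero.1 h3).resolve_left (hAB i l)

end

/-! ### The coproduct of the polynomial algebra -/

/-- The images of the generators under the coproduct, for the images `v` of the generators. -/
def coprodGen {B : Type*} [Ring B] [Algebra ℂ B] (q : ℂ) (v : Letter → B) : Letter → B ⊗[ℂ] B
  | .a => v .a ⊗ₜ v .a - q • (v .bStar ⊗ₜ v .b)
  | .b => v .b ⊗ₜ v .a + v .aStar ⊗ₜ v .b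
  | .aStar => v .aStar ⊗ₜ v .aStar - q • (v .b ⊗ₜ v .bStar)
  | .bStar => v .bStar ⊗ₜ v .aStar + v .a ⊗ₜ v .bStar

theorem coprodGen_relations {B : Type*} [Ring B] [Algebra ℂ B] {q : ℂ} {v : Letter → B}
    (h : AlgRelations q v) : AlgRelations q (coprodGen q v) := by
  constructor <;>
    simp only [coprodGen, mul_add, add_mul, mul_sub, sub_mul, smul_mul_assoc, mul_smul_comm,
      Algebra.TensorProduct.tmul_mul_tmul, h.star_mul_add, h.mul_star_add, h.a_b,
      h.a_bStar, h.b_aStar, h.bStar_aStar, h.bStar_b, TensorProduct.tmul_sub,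
      TensorProduct.sub_tmul, TensorProduct.tmul_smul, ← TensorProduct.smul_tmul',
      Algebra.TensorProduct.one_def] <;> module

/-- The coproduct of the polynomial algebra. -/
def polCoprod (q : ℂ) : PolAlg q →ₐ[ℂ] PolAlg q ⊗[ℂ] PolAlg q :=
  polLift (coprodGen_relations (letter_relations q))

theorem polCoprod_letter (q : ℂ) (x : Letter) :
    polCoprod q (letter q x) = coprodGen q (letter q) x := polLift_letter _ x

section
variable {q : ℂ}

open TensorProduct in
theorem polCoprod_scaling (hq : q ≠ 0) (x : PolAlg q) : polCoprod q (scaling hq x) =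
    map LinearMap.id (scaling hq) (polCoprod q x) := by
  have hmul : ∀ X Y : PolAlg q ⊗[ℂ] PolAlg q, map LinearMap.id (scaling hq) (X * Y) =
      map LinearMap.id (scaling hq) X * map LinearMap.id (scaling hq) Y := by
    intro X Y
    induction X using TensorProduct.induction_on with
    | zero => simp
    | add a b ha hb => simp only [add_mul, map_add, ha, hb]
    | tmul a b =>
      induction Y using TensorProduct.induction_on with
      | zero => simp
      | add a b ha hb => simp only [mul_add, map_add, ha, hb]
      | tmul a' b' => simp [scaling_mul]
  induction x using pol_induction with
  | algebraMap r =>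
    simp only [Algebra.algebraMap_eq_smul_one, map_smul, scaling_one, map_one,
      Algebra.TensorProduct.one_def, map_tmul, LinearMap.id_apply]
  | mul a b ha hb => rw [scaling_mul, map_mul, map_mul, hmul, ha, hb]
  | add a b ha hb => simp only [map_add, ha, hb]
  | letter x =>
    cases x <;> simp only [scaling_a, scaling_b, scaling_bStar, scaling_aStar, map_smul, map_add,
      map_sub, polCoprod_letter, coprodGen, map_tmul, LinearMap.id_apply, tmul_smul] <;> module

-- Both sides obey the same twisted Leibniz rule, with the scaling acting on the second leg, so
-- agreement on the letters suffices.
open TensorProduct in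
theorem polCoprod_raise (hq : q ≠ 0) (x : PolAlg q) : polCoprod q (raise hq x) =
    map LinearMap.id (raise hq) (polCoprod q x) := by
  have hmul : ∀ X Y : PolAlg q ⊗[ℂ] PolAlg q, map LinearMap.id (raise hq) (X * Y) =
      map LinearMap.id (scaling hq) X * map LinearMap.id (raise hq) Y +
        map LinearMap.id (raise hq) X * Y := by
    intro X Y
    induction X using TensorProduct.induction_on with
    | zero => simp
    | add a b ha hb => simp only [add_mul, map_add, ha, hb]; abel
    | tmul a b =>
      induction Y using TensorProduct.induction_on with
      | zero => simp
      | add a b ha hb => simp only [mul_add, map_add, ha, hb]; abel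
      | tmul a' b' => simp [raise_mul, tmul_add]
  induction x using pol_induction with
  | algebraMap r =>
    simp only [Algebra.algebraMap_eq_smul_one, map_smul, raise_one, map_one,
      Algebra.TensorProduct.one_def, map_tmul, tmul_zero, map_zero]
  | mul a b ha hb => rw [raise_mul, map_add, map_mul, map_mul, map_mul, hmul, ha, hb,
      polCoprod_scaling]
  | add a b ha hb => simp only [map_add, ha, hb]
  | letter x =>
    cases x <;> simp only [raise_a, raise_b, raise_bStar, raise_aStar, map_smul, map_add,
      map_sub, polCoprod_letter, coprodGen, map_tmul, LinearMap.id_apply, tmul_smul,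
      map_zero, tmul_zero]
    · module
    · module
    · match_scalars <;> field_simp
    · match_scalars <;> field_simp

/-! ### The transposition -/

/-- The images of the generators under transposition of the fundamental corepresentation. -/
def transGen (q : ℂ) : Letter → PolAlg q
  | .a => letter q .a
  | .b => (-q) • letter q .bStar
  | .bStar => (-q⁻¹) • letter q .b
  | .aStar => letter q .aStar

theorem transGen_relations (hq : q ≠ 0) : AlgRelations q (transGen q) := by
  have h := letter_relations q
  constructor <;>
    simp [transGen, h.star_mul_add, h.mul_star_add, h.a_b, h.a_bStar, h.b_aStar,
      h.bStar_aStar, h.bStar_b, smul_smul, hq]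

/-- The automorphism transposing the fundamental corepresentation. -/
def trans (hq : q ≠ 0) : PolAlg q →ₐ[ℂ] PolAlg q := polLift (transGen_relations hq)

theorem trans_letter (hq : q ≠ 0) (x : Letter) : trans hq (letter q x) = transGen q x :=
  polLift_letter _ x

theorem trans_trans (hq : q ≠ 0) (x : PolAlg q) : trans hq (trans hq x) = x := by
  have : (trans hq).comp (trans hq) = AlgHom.id ℂ _ := by
    refine pol_hom_ext fun x => ?_
    cases x <;> simp [trans_letter, transGen, smul_smul, hq]
  exact AlgHom.congr_fun this x

-- Transposition reverses the two legs of the coproduct; this is what converts left invariance of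
-- the Haar functional into right invariance.
open TensorProduct in
theorem polCoprod_trans (hq : q ≠ 0) (x : PolAlg q) : polCoprod q (trans hq x) =
    TensorProduct.comm ℂ _ _ (map (trans hq).toLinearMap (trans hq).toLinearMap
      (polCoprod q x)) := by
  have : (polCoprod q).comp (trans hq) = ((Algebra.TensorProduct.comm ℂ _ _).toAlgHom.comp
      (Algebra.TensorProduct.map (trans hq) (trans hq))).comp (polCoprod q) := by
    refine pol_hom_ext fun x => ?_
    cases x <;> simp only [AlgHom.comp_apply, trans_letter, transGen, map_smul, polCoprod_letter,
      coprodGen, map_add, map_sub, Algebra.TensorProduct.map_tmul, tmul_smul,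
      ← smul_tmul', smul_smul, smul_add]
    all_goals simp
    all_goals match_scalars <;> field_simp
  exact AlgHom.congr_fun this x

theorem trans_dMon (hq : q ≠ 0) (i j l : ℕ) :
    trans hq (dMon q i j l) = ((-q) ^ j * (-q⁻¹) ^ l) • dMon q i l j := by
  simp only [dMon, map_mul, map_pow, trans_letter, transGen, smul_pow, smul_mul_assoc,
    mul_smul_comm, smul_smul]
  rw [((show Commute (letter q .bStar) (letter q .b) from
    (letter_relations q).bStar_b).pow_pow j l).eq, mul_comm]

theorem trans_aMon (hq : q ≠ 0) (i j l : ℕ) :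
    trans hq (aMon q i j l) = ((-q) ^ j * (-q⁻¹) ^ l) • aMon q i l j := by
  simp only [aMon, map_mul, map_pow, trans_letter, transGen, smul_pow, smul_mul_assoc,
    mul_smul_comm, smul_smul]
  rw [((show Commute (letter q .bStar) (letter q .b) from
    (letter_relations q).bStar_b).pow_pow j l).eq, mul_comm]

/-! ### The Haar functional -/

/-- The values of the Haar functional on monomials. -/
structure IsPolHaar (h : PolAlg q →ₗ[ℂ] ℂ) : Prop where
  aMon : ∀ i j l, h (aMon q (i + 1) j l) = 0
  dMon : ∀ i j l, h (dMon q (i + 1) j l) = 0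
  mon_ne : ∀ j l, j ≠ l → h (SUq2.dMon q 0 j l) = 0
  mon : ∀ l, h (SUq2.dMon q 0 l l) = (1 - q ^ 2) / (1 - q ^ (2 * (l + 1)))

namespace IsPolHaar
variable {h : PolAlg q →ₗ[ℂ] ℂ} (H : IsPolHaar h)
include H

theorem map_one (hq1 : ∀ n, n ≠ 0 → q ^ n ≠ 1) : h 1 = 1 := by
  have := H.mon 0
  have h2 : 1 - q ^ 2 ≠ 0 := sub_ne_zero.2 (hq1 2 two_ne_zero).symm
  simpa [SUq2.dMon, h2] using this

theorem map_raise (hq : q ≠ 0) (hq1 : ∀ n, n ≠ 0 → q ^ n ≠ 1) (x : PolAlg q) :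
    h (raise hq x) = 0 := by
  have h0 : h ∘ₗ raise hq = 0 := by
    refine functional_ext hq (fun i j l => ?_) (fun i j l => ?_) <;>
      rw [LinearMap.comp_apply, LinearMap.zero_apply]
    · cases l with
      | zero => rw [raise_aMon_zero, map_zero]
      | succ l => rw [raise_aMon, map_smul, H.aMon, smul_zero]
    · rcases i with _ | _ | i
      · rw [← aMon_zero]
        cases l with
        | zero => rw [raise_aMon_zero, map_zero]
        | succ l => rw [raise_aMon, map_smul, H.aMon, smul_zero]
      · cases l with
        | zero => rw [raise_dMon_zero, map_smul, H.mon_ne _ _ (by omega), smul_zero]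
        | succ l =>
          rw [raise_dMon, map_add, map_smul, map_smul, map_sub]
          by_cases hjl : j = l
          · subst hjl
            -- This is the only case where nonzero values meet: the vanishing is a recursion between
            -- the values on β^j β*^j and β^{j+1} β*^{j+1}, and the prescribed values solve it.
            have h2 : 1 - q ^ 2 ≠ 0 := sub_ne_zero.2 (hq1 2 two_ne_zero).symm
            have h3 : 1 - q ^ (2 * (j + 1)) ≠ 0 := sub_ne_zero.2 (hq1 _ (by omega)).symm
            have h4 : 1 - q ^ (2 * (j + 1 + 1)) ≠ 0 := sub_ne_zero.2 (hq1 _ (by omega)).symm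
            rw [H.mon, H.mon, raiseCoeffA_eq hq (hq1 2 two_ne_zero),
              raiseCoeffB_eq hq (hq1 2 two_ne_zero)]
            simp only [inv_pow, smul_eq_mul]
            field_simp
            ring
          · rw [H.mon_ne _ _ hjl, H.mon_ne _ _ (by omega)]
            simp
      · cases l with
        | zero => rw [raise_dMon_zero, map_smul, H.dMon, smul_zero]
        | succ l => rw [raise_dMon, map_add, map_smul, map_smul, map_sub, H.dMon, H.dMon]; simp
  exact LinearMap.congr_fun h0 x

/-- The monomials with nonzero value are β^l β*^l, on which the scaling factors q^l and q^{-l}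
cancel. -/
theorem map_scaling (hq : q ≠ 0) (x : PolAlg q) : h (scaling hq x) = h x := by
  have h0 : h ∘ₗ scaling hq = h := by
    refine functional_ext hq (fun i j l => ?_) (fun i j l => ?_) <;> rw [LinearMap.comp_apply]
    · rw [scaling_aMon, map_smul, H.aMon, smul_zero]
    · rw [scaling_dMon, map_smul]
      cases i with
      | succ i => rw [H.dMon, smul_zero]
      | zero =>
        by_cases hjl : j = l
        · subst hjl
          simp [hq]
        · rw [H.mon_ne _ _ hjl, smul_zero]
  exact LinearMap.congr_fun h0 x

/-- Transposition swaps the exponents of β and β* with the factor (-q)^j (-q⁻¹)^l, which is 1 on the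
monomials of nonzero value. -/
theorem map_trans (hq : q ≠ 0) (x : PolAlg q) : h (trans hq x) = h x := by
  have h0 : h ∘ₗ (trans hq).toLinearMap = h := by
    refine functional_ext hq (fun i j l => ?_) (fun i j l => ?_) <;>
      rw [LinearMap.comp_apply, AlgHom.toLinearMap_apply]
    · rw [trans_aMon, map_smul, H.aMon, H.aMon, smul_zero]
    · rw [trans_dMon, map_smul]
      cases i with
      | succ i => rw [H.dMon, H.dMon, smul_zero]
      | zero =>
        by_cases hjl : j = l
        · subst hjl
          rw [← mul_pow]
          simp [hq]
        · rw [H.mon_ne _ _ hjl, H.mon_ne _ _ (Ne.symm hjl), smul_zero]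
  exact LinearMap.congr_fun h0 x

/-- The difference of the two sides kills 1. Raising and scaling pass through the coproduct to the
second leg, where h absorbs them, so the difference is an invariant functional and vanishes. -/
theorem left_inv (hq : q ≠ 0) (hq1 : ∀ n, n ≠ 0 → q ^ n ≠ 1) (ρ : PolAlg q →ₗ[ℂ] ℂ)
    (x : PolAlg q) :
    LinearMap.mul' ℂ ℂ (TensorProduct.map ρ h (polCoprod q x)) = ρ 1 * h x := by
  have hc : ∀ (f : PolAlg q →ₗ[ℂ] PolAlg q) (X : PolAlg q ⊗[ℂ] PolAlg q),
      TensorProduct.map ρ h (TensorProduct.map LinearMap.id f X) =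
        TensorProduct.map ρ (h ∘ₗ f) X := fun f X => by
    rw [← LinearMap.comp_apply, ← TensorProduct.map_comp, LinearMap.comp_id]
  have h0 : LinearMap.mul' ℂ ℂ ∘ₗ TensorProduct.map ρ h ∘ₗ (polCoprod q).toLinearMap -
      ρ 1 • h = 0 := by
    refine eq_zero_of_invariant hq hq1 ?_ (fun x => ?_) (fun x => ?_)
    · simp [Algebra.TensorProduct.one_def, H.map_one hq1]
    · have : h ∘ₗ raise hq = 0 := LinearMap.ext (H.map_raise hq hq1)
      simp [polCoprod_raise, hc, this, H.map_raise hq hq1]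
    · have : h ∘ₗ scaling hq = h := LinearMap.ext (H.map_scaling hq)
      simp [polCoprod_scaling, hc, this, H.map_scaling hq]
  have := LinearMap.congr_fun h0 x
  simpa [sub_eq_zero] using this

/-- Left invariance is applied to the transposed functional at the transposed element; the flip of
the coproduct then exchanges the legs. -/
theorem right_inv (hq : q ≠ 0) (hq1 : ∀ n, n ≠ 0 → q ^ n ≠ 1) (ρ : PolAlg q →ₗ[ℂ] ℂ)
    (x : PolAlg q) :
    LinearMap.mul' ℂ ℂ (TensorProduct.map h ρ (polCoprod q x)) = ρ 1 * h x := by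
  have h1 := H.left_inv hq hq1 (ρ ∘ₗ (trans hq).toLinearMap) (trans hq x)
  rw [H.map_trans hq, LinearMap.comp_apply, AlgHom.toLinearMap_apply, _root_.map_one] at h1
  rw [← h1]
  nth_rw 1 [← trans_trans hq x]
  rw [polCoprod_trans hq (trans hq x)]
  have h2 : h ∘ₗ (trans hq).toLinearMap = h := LinearMap.ext (H.map_trans hq)
  generalize polCoprod q (trans hq x) = X
  induction X using TensorProduct.induction_on with
  | zero => simp
  | add a b ha hb => simp only [map_add, ha, hb]
  | tmul a b => simp [H.map_trans hq, mul_comm]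

end IsPolHaar
end

/-! ### Coefficients with integer indices -/

/-- `g(n) = (1 - q^{2n})^{1/2}` for integers `n`; it vanishes for `n ≤ 0`. -/
def gZ (q : ℝ) (n : ℤ) : ℝ := √(1 - (q ^ n) ^ 2)

section
variable {q : ℝ}

theorem gZ_natCast (q : ℝ) (n : ℕ) : gZ q n = g q n := by
  rw [gZ, g, zpow_natCast, ← pow_mul, mul_comm]

theorem gZ_zero (q : ℝ) : gZ q 0 = 0 := by simp [gZ]

theorem zpow_sq_lt_one (hq : |q| < 1) {n : ℤ} (hn : 0 < n) : (q ^ n) ^ 2 < 1 := by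
  lift n to ℕ using hn.le
  rw [zpow_natCast, sq_lt_one_iff_abs_lt_one, abs_pow]
  exact pow_lt_one₀ (abs_nonneg q) hq (by omega)

theorem gZ_pos (hq : |q| < 1) {n : ℤ} (hn : 0 < n) : 0 < gZ q n :=
  Real.sqrt_pos.2 (sub_pos.2 (zpow_sq_lt_one hq hn))

theorem gZ_sq (hq : |q| < 1) {n : ℤ} (hn : 0 ≤ n) :
    gZ q n ^ 2 = 1 - (q ^ n) ^ 2 := by
  rcases hn.eq_or_lt with rfl | hn
  · simp [gZ]
  · exact Real.sq_sqrt (sub_pos.2 (zpow_sq_lt_one hq hn)).le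

end

/-- `a_+` with integer indices. -/
def aUp (q : ℝ) (n i j : ℤ) : ℝ :=
  q ^ (i + j + 1) * (gZ q (n - j + 1) * gZ q (n - i + 1)) / (gZ q (n + 1) * gZ q (n + 2))

/-- `a_-` with integer indices. -/
def aDown (q : ℝ) (n i j : ℤ) : ℝ := gZ q j * gZ q i / (gZ q n * gZ q (n + 1))

/-- `b_+` with integer indices. -/
def bUp (q : ℝ) (n i j : ℤ) : ℝ :=
  -q ^ j * (gZ q (n - j + 1) * gZ q (i + 1)) / (gZ q (n + 1) * gZ q (n + 2))

/-- `b_-` with integer indices. -/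
def bDown (q : ℝ) (n i j : ℤ) : ℝ :=
  q ^ i * (gZ q j * gZ q (n - i)) / (gZ q n * gZ q (n + 1))

section
variable (q : ℝ)

/-- Integer indices let the identities below shift an index down without truncated subtraction. The
bounds on I and J make the truncated differences agree with the integer ones. -/
theorem aUp_natCast {N I J : ℕ} (hI : I ≤ N) (hJ : J ≤ N) : aUp q N I J = aPlus q N I J := by
  simp only [aUp, aPlus, ← gZ_natCast, ← zpow_natCast]
  push_cast [hI, hJ]
  rfl

theorem aDown_natCast (N I J : ℕ) : aDown q N I J = aMinus q N I J := by
  simp only [aDown, aMinus, ← gZ_natCast]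
  push_cast
  rfl

theorem bUp_natCast {N I J : ℕ} (hJ : J ≤ N) : bUp q N I J = bPlus q N I J := by
  simp only [bUp, bPlus, ← gZ_natCast, ← zpow_natCast]
  push_cast [hJ]
  rfl

theorem bDown_natCast {N I J : ℕ} (hI : I ≤ N) : bDown q N I J = bMinus q N I J := by
  simp only [bDown, bMinus, ← gZ_natCast, ← zpow_natCast]
  push_cast [hI]
  rfl

/-! ### Coefficient identities behind the defining relations -/

variable {q}

/-- This and the nine identities that follow compare the extreme coefficients of a product of two
generators, those moving the doubled index by +2 or -2. The square roots match factor by factor, so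
no formula for `gZ` squared is needed. -/
theorem aUp_aDown (hq0 : q ≠ 0) (n i j : ℤ) :
    aUp q n i j * aDown q (n + 1 + 1) (i + 1) (j + 1) +
      bUp q n i j * bDown q (n + 1 + 1) (i + 1) (j + 1) = 0 := by
  simp only [aUp, aDown, bUp, bDown, show n + 1 + 1 = n + 2 by ring,
    show n + 2 - (i + 1) = n - i + 1 by ring, show n + 2 + 1 = n + 1 + 2 by ring, zpow_add₀ hq0, zpow_one]
  ring

theorem aDown_aUp (hq0 : q ≠ 0) (n i j : ℤ) :
    aDown q n i j * aUp q (n - 1 - 1) (i - 1) (j - 1) +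
      bDown q n i j * bUp q (n - 1 - 1) (i - 1) (j - 1) = 0 := by
  have := aUp_aDown hq0 (n - 1 - 1) (i - 1) (j - 1)
  simp only [sub_add_cancel] at this
  linear_combination this

theorem up_mul_star (hq0 : q ≠ 0) (n i j : ℤ) :
    aDown q (n + 1) (i + 1) (j + 1) * aUp q (n + 1) (i + 1) (j + 1) +
      q ^ 2 * (bDown q (n + 1) i (j + 1) * bUp q (n + 1) i (j + 1)) = 0 := by
  simp only [aUp, aDown, bUp, bDown, show n + 1 - (i + 1) + 1 = n + 1 - i by ring,
    zpow_add₀ hq0, zpow_one]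
  ring

theorem down_mul_star (hq0 : q ≠ 0) (n i j : ℤ) :
    aUp q (n - 1) i j * aDown q (n - 1) i j +
      q ^ 2 * (bUp q (n - 1) (i - 1) j * bDown q (n - 1) (i - 1) j) = 0 := by
  simp only [aUp, aDown, bUp, bDown, show n - 1 - (i - 1) = n - 1 - i + 1 by ring, sub_add_cancel,
    zpow_add₀ hq0, zpow_sub₀ hq0, zpow_one]
  field_simp
  ring

theorem up_comm (hq0 : q ≠ 0) (n i j : ℤ) :
    bUp q n i j * aUp q (n + 1) (i + 1) j = q * (aUp q n i j * bUp q (n + 1) i j) := by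
  simp only [aUp, bUp, show n + 1 - (i + 1) + 1 = n - i + 1 by ring, zpow_add₀ hq0, zpow_one]
  ring

theorem down_comm (hq0 : q ≠ 0) (n i j : ℤ) :
    bDown q n i j * aDown q (n - 1) i (j - 1) =
      q * (aDown q n i j * bDown q (n - 1) (i - 1) (j - 1)) := by
  simp only [aDown, bDown, show n - 1 - (i - 1) = n - i by ring, zpow_sub₀ hq0, zpow_one]
  field_simp

theorem up_comm_star (hq0 : q ≠ 0) (n i j : ℤ) :
    bDown q (n + 1) i (j + 1) * aUp q (n + 1) i (j + 1) =
      q * (aUp q n i j * bDown q (n + 1 + 1) i (j + 1)) := by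
  simp only [aUp, bDown, show n + 1 - (j + 1) + 1 = n - j + 1 by ring,
    show n + 2 - i = n - i + 1 + 1 by ring, show n + 1 - i = n - i + 1 by ring,
    show n + 1 + 1 = n + 2 by ring, show n + 1 + 2 = n + 2 + 1 by ring, zpow_add₀ hq0, zpow_one]
  ring

theorem down_comm_star (hq0 : q ≠ 0) (n i j : ℤ) :
    bUp q (n - 1) (i - 1) j * aDown q (n - 1) (i - 1) j =
      q * (aDown q n i j * bUp q (n - 1 - 1) (i - 1 - 1) (j - 1)) := by
  simp only [aDown, bUp, show n - 1 - 1 - (j - 1) + 1 = n - 1 - j + 1 by ring,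
    show n - 1 - 1 + 2 = n by ring, show n - 1 + 2 = n + 1 by ring, sub_add_cancel,
    zpow_sub₀ hq0, zpow_one]
  field_simp

theorem up_normal (hq0 : q ≠ 0) (n i j : ℤ) :
    bUp q n i j * bDown q (n + 1 + 1) (i + 1) (j + 1) =
      bDown q (n + 1) i (j + 1) * bUp q (n + 1) i (j + 1) := by
  simp only [bDown, bUp, show n + 1 - (j + 1) + 1 = n - j + 1 by ring,
    show n + 2 - (i + 1) = n + 1 - i by ring,
    show n + 1 + 1 = n + 2 by ring, show n + 1 + 2 = n + 2 + 1 by ring, zpow_add₀ hq0, zpow_one]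
  ring

theorem down_normal (hq0 : q ≠ 0) (n i j : ℤ) :
    bDown q n i j * bUp q (n - 1 - 1) (i - 1) (j - 1) =
      bUp q (n - 1) (i - 1) j * bDown q (n - 1) (i - 1) j := by
  simp only [bDown, bUp, show n - 1 - 1 - (j - 1) + 1 = n - 1 - j + 1 by ring,
    show n - 1 - (i - 1) = n - i by ring,
    show n - 1 - 1 + 2 = n by ring, show n - 1 + 2 = n + 1 by ring, sub_add_cancel,
    zpow_sub₀ hq0, zpow_one]
  field_simp

/-- The index triples of the basis of `L²(SU_q(2))`. -/
def IsIndex (n i j : ℤ) : Prop := 0 ≤ i ∧ i ≤ n ∧ 0 ≤ j ∧ j ≤ n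

/-- These are the squares of the denominators `gZ q (n + 1)`, `gZ q (n + 2)` and, for n > 0, `gZ q
n`, written with x = q^n in both orders of the factors so that `field_simp` recognises them. -/
theorem one_sub_ne (hq : |q| < 1) (hq0 : q ≠ 0) {n : ℤ} (hn : 0 ≤ n) :
    1 - q ^ 2 * (q ^ n) ^ 2 ≠ 0 ∧ 1 - q ^ 4 * (q ^ n) ^ 2 ≠ 0 ∧
      1 - (q ^ n) ^ 2 * q ^ 2 ≠ 0 ∧ 1 - (q ^ n) ^ 2 * q ^ 4 ≠ 0 ∧
      (0 < n → 1 - (q ^ n) ^ 2 ≠ 0) := by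
  simp only [mul_comm ((q ^ n) ^ 2)]
  have h1 : 1 - q ^ 2 * (q ^ n) ^ 2 ≠ 0 := by
    have := (sub_pos.2 (zpow_sq_lt_one hq (n := n + 1) (by omega))).ne'
    rwa [zpow_add₀ hq0, zpow_one, mul_pow, mul_comm (_ ^ 2)] at this
  have h2 : 1 - q ^ 4 * (q ^ n) ^ 2 ≠ 0 := by
    have := (sub_pos.2 (zpow_sq_lt_one hq (n := n + 2) (by omega))).ne'
    rwa [zpow_add₀ hq0, zpow_ofNat, mul_pow, mul_comm (_ ^ 2), ← pow_mul] at this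
  exact ⟨h1, h2, h1, h2, fun h => (sub_pos.2 (zpow_sq_lt_one hq h)).ne'⟩

/-- The diagonal coefficients involve only squares of `gZ`; after substitution the claim is a
rational identity in x = q^n, y = q^i, z = q^j. -/
theorem diag_star_mul (hq : |q| < 1) (hq0 : q ≠ 0) {n i j : ℤ} (h : IsIndex n i j) :
    aUp q n i j ^ 2 + aDown q n i j ^ 2 + bUp q n i j ^ 2 + bDown q n i j ^ 2 = 1 := by
  obtain ⟨h1, h2, h3, h4⟩ := h
  obtain ⟨n1, n2, m1, m2, n0⟩ := one_sub_ne hq hq0 (h1.trans h2)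
  simp only [aUp, aDown, bUp, bDown, div_pow, mul_pow, neg_sq, gZ_sq hq (h1.trans h2),
    gZ_sq hq h1, gZ_sq hq h3, gZ_sq hq (show 0 ≤ n - j + 1 by omega),
    gZ_sq hq (show 0 ≤ n - i + 1 by omega), gZ_sq hq (show 0 ≤ i + 1 by omega),
    gZ_sq hq (show 0 ≤ n - i by omega), gZ_sq hq (show 0 ≤ n + 1 by omega),
    gZ_sq hq (show 0 ≤ n + 2 by omega)]
  simp only [zpow_add₀ hq0, zpow_sub₀ hq0, zpow_ofNat]
  have hx := zpow_ne_zero n hq0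
  have hy := zpow_ne_zero i hq0
  have hz := zpow_ne_zero j hq0
  -- At n = 0 the denominator `gZ q 0` is 0 and quotients by it are 0 by convention, as they should
  -- be, so this case is computed separately.
  rcases (h1.trans h2).eq_or_lt with rfl | hn
  · obtain rfl : i = 0 := by omega
    obtain rfl : j = 0 := by omega
    simp only [zpow_zero, one_pow, mul_one] at *
    field_simp
    ring
  · specialize n0 hn
    generalize q ^ n = x at *
    generalize q ^ i = y at *
    generalize q ^ j = z at *
    field_simp
    ring

theorem diag_mul_star (hq : |q| < 1) (hq0 : q ≠ 0) {n i j : ℤ} (h : IsIndex n i j) :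
    aUp q (n - 1) i j ^ 2 + aDown q (n + 1) (i + 1) (j + 1) ^ 2 +
      q ^ 2 * (bUp q (n - 1) (i - 1) j ^ 2 + bDown q (n + 1) i (j + 1) ^ 2) = 1 := by
  obtain ⟨h1, h2, h3, h4⟩ := h
  obtain ⟨n1, n2, m1, m2, n0⟩ := one_sub_ne hq hq0 (h1.trans h2)
  simp only [aUp, aDown, bUp, bDown, div_pow, mul_pow, neg_sq, sub_add_cancel,
    show n - 1 - j + 1 = n - j by ring, show n - 1 - i + 1 = n - i by ring,
    show n - 1 + 2 = n + 1 by ring, show n + 1 + 1 = n + 2 by ring, gZ_sq hq (h1.trans h2),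
    gZ_sq hq h1, gZ_sq hq (show 0 ≤ n - j by omega),
    gZ_sq hq (show 0 ≤ n - i by omega), gZ_sq hq (show 0 ≤ i + 1 by omega),
    gZ_sq hq (show 0 ≤ j + 1 by omega), gZ_sq hq (show 0 ≤ n + 1 by omega),
    gZ_sq hq (show 0 ≤ n + 1 - i by omega), gZ_sq hq (show 0 ≤ n + 2 by omega)]
  simp only [zpow_add₀ hq0, zpow_sub₀ hq0, zpow_ofNat]
  have hx := zpow_ne_zero n hq0
  have hy := zpow_ne_zero i hq0
  have hz := zpow_ne_zero j hq0
  rcases (h1.trans h2).eq_or_lt with rfl | hn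
  · obtain rfl : i = 0 := by omega
    obtain rfl : j = 0 := by omega
    simp only [zpow_zero, one_pow, mul_one] at *
    field_simp
    ring
  · specialize n0 hn
    generalize q ^ n = x at *
    generalize q ^ i = y at *
    generalize q ^ j = z at *
    field_simp
    ring

theorem diag_normal (hq : |q| < 1) (hq0 : q ≠ 0) {n i j : ℤ} (h : IsIndex n i j) :
    bUp q n i j ^ 2 + bDown q n i j ^ 2 =
      bUp q (n - 1) (i - 1) j ^ 2 + bDown q (n + 1) i (j + 1) ^ 2 := by
  obtain ⟨h1, h2, h3, h4⟩ := h
  obtain ⟨n1, n2, m1, m2, n0⟩ := one_sub_ne hq hq0 (h1.trans h2)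
  simp only [bUp, bDown, div_pow, mul_pow, neg_sq, sub_add_cancel,
    show n - 1 - j + 1 = n - j by ring,
    show n - 1 + 2 = n + 1 by ring, show n + 1 + 1 = n + 2 by ring, gZ_sq hq (h1.trans h2),
    gZ_sq hq h1, gZ_sq hq h3, gZ_sq hq (show 0 ≤ n - j by omega),
    gZ_sq hq (show 0 ≤ n - j + 1 by omega),
    gZ_sq hq (show 0 ≤ n - i by omega), gZ_sq hq (show 0 ≤ i + 1 by omega),
    gZ_sq hq (show 0 ≤ j + 1 by omega), gZ_sq hq (show 0 ≤ n + 1 by omega),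
    gZ_sq hq (show 0 ≤ n + 1 - i by omega), gZ_sq hq (show 0 ≤ n + 2 by omega)]
  simp only [zpow_add₀ hq0, zpow_sub₀ hq0, zpow_ofNat]
  have hx := zpow_ne_zero n hq0
  have hy := zpow_ne_zero i hq0
  have hz := zpow_ne_zero j hq0
  rcases (h1.trans h2).eq_or_lt with rfl | hn
  · obtain rfl : i = 0 := by omega
    obtain rfl : j = 0 := by omega
    simp only [zpow_zero, one_pow, mul_one] at *
    field_simp
    ring
  · specialize n0 hn
    generalize q ^ n = x at *
    generalize q ^ i = y at *
    generalize q ^ j = z at *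
    field_simp
    ring

theorem diag_comm (hq : |q| < 1) (hq0 : q ≠ 0) {n i j : ℤ} (h : IsIndex n i j) :
    bUp q n i j * aDown q (n + 1) (i + 1) j + bDown q n i j * aUp q (n - 1) i (j - 1) =
      q * (aUp q n i j * bDown q (n + 1) i j + aDown q n i j * bUp q (n - 1) (i - 1) (j - 1)) := by
  obtain ⟨h1, h2, h3, h4⟩ := h
  obtain ⟨n1, n2, m1, m2, n0⟩ := one_sub_ne hq hq0 (h1.trans h2)
  rcases (h1.trans h2).eq_or_lt with rfl | hn
  · obtain rfl : j = 0 := by omega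
    simp [aDown, bDown, gZ_zero]
  -- All four products share the factor g(j) g(n-j+1), a product of unrelated square roots. Once it
  -- is removed only squares remain.
  · have key : -q ^ j * gZ q (i + 1) ^ 2 / (gZ q (n + 1) ^ 2 * gZ q (n + 2) ^ 2) +
        q ^ i * q ^ (i + j) * gZ q (n - i) ^ 2 / (gZ q n ^ 2 * gZ q (n + 1) ^ 2) =
      q * (q ^ (i + j + 1) * q ^ i * gZ q (n - i + 1) ^ 2 /
          (gZ q (n + 1) ^ 2 * gZ q (n + 2) ^ 2) -
        q ^ (j - 1) * gZ q i ^ 2 / (gZ q n ^ 2 * gZ q (n + 1) ^ 2)) := by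
      simp only [gZ_sq hq (h1.trans h2),
        gZ_sq hq h1, gZ_sq hq (show 0 ≤ n - i by omega), gZ_sq hq (show 0 ≤ i + 1 by omega),
        gZ_sq hq (show 0 ≤ n + 1 by omega),
        gZ_sq hq (show 0 ≤ n - i + 1 by omega), gZ_sq hq (show 0 ≤ n + 2 by omega)]
      simp only [zpow_add₀ hq0, zpow_sub₀ hq0, zpow_ofNat]
      have hx := zpow_ne_zero n hq0
      have hy := zpow_ne_zero i hq0
      have hz := zpow_ne_zero j hq0
      specialize n0 hn
      generalize q ^ n = x at *
      generalize q ^ i = y at *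
      generalize q ^ j = z at *
      field_simp
      ring
    simp only [aUp, aDown, bUp, bDown, sub_add_cancel,
      show n - 1 - (j - 1) + 1 = n - j + 1 by ring, show n - 1 - i + 1 = n - i by ring,
      show n - 1 + 2 = n + 1 by ring, show n + 1 + 1 = n + 2 by ring,
      show n + 1 - i = n - i + 1 by ring, show i + (j - 1) + 1 = i + j by ring]
    linear_combination (gZ q j * gZ q (n - j + 1)) * key

theorem diag_comm_star (hq : |q| < 1) (hq0 : q ≠ 0) {n i j : ℤ} (h : IsIndex n i j) :
    bUp q (n - 1) (i - 1) j * aUp q (n - 1) (i - 1) j +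
        bDown q (n + 1) i (j + 1) * aDown q (n + 1) i (j + 1) =
      q * (aUp q n i j * bUp q n (i - 1) j + aDown q n i j * bDown q n (i - 1) j) := by
  obtain ⟨h1, h2, h3, h4⟩ := h
  obtain ⟨n1, n2, m1, m2, n0⟩ := one_sub_ne hq hq0 (h1.trans h2)
  rcases (h1.trans h2).eq_or_lt with rfl | hn
  · obtain rfl : i = 0 := by omega
    simp [aDown, bUp, gZ_zero]
  -- Here the common factor is g(i) g(n-i+1).
  · have key : -q ^ j * q ^ (i + j) * gZ q (n - j) ^ 2 / (gZ q n ^ 2 * gZ q (n + 1) ^ 2) +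
        q ^ i * gZ q (j + 1) ^ 2 / (gZ q (n + 1) ^ 2 * gZ q (n + 2) ^ 2) =
      q * (-q ^ (i + j + 1) * q ^ j * gZ q (n - j + 1) ^ 2 /
          (gZ q (n + 1) ^ 2 * gZ q (n + 2) ^ 2) +
        q ^ (i - 1) * gZ q j ^ 2 / (gZ q n ^ 2 * gZ q (n + 1) ^ 2)) := by
      simp only [gZ_sq hq (h1.trans h2),
        gZ_sq hq h3, gZ_sq hq (show 0 ≤ n - j by omega), gZ_sq hq (show 0 ≤ j + 1 by omega),
        gZ_sq hq (show 0 ≤ n + 1 by omega),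
        gZ_sq hq (show 0 ≤ n - j + 1 by omega), gZ_sq hq (show 0 ≤ n + 2 by omega)]
      simp only [zpow_add₀ hq0, zpow_sub₀ hq0, zpow_ofNat]
      have hx := zpow_ne_zero n hq0
      have hy := zpow_ne_zero i hq0
      have hz := zpow_ne_zero j hq0
      specialize n0 hn
      generalize q ^ n = x at *
      generalize q ^ i = y at *
      generalize q ^ j = z at *
      field_simp
      ring
    simp only [aUp, aDown, bUp, bDown, sub_add_cancel,
      show n - 1 - (i - 1) + 1 = n - i + 1 by ring, show n - 1 - j + 1 = n - j by ring,
      show n - 1 + 2 = n + 1 by ring, show n + 1 + 1 = n + 2 by ring,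
      show n + 1 - i = n - i + 1 by ring, show n - (i - 1) = n - i + 1 by ring,
      show i - 1 + j + 1 = i + j by ring]
    linear_combination (gZ q i * gZ q (n - i + 1)) * key

end

/-! ### Weighted composition operators on basis vectors -/

theorem wcomp_apply {ι κ : Type} (w : ι → ℝ) (f : ι → κ) (hf : Function.Injective f)
    (hw : ∀ i, |w i| ≤ 1) (x : L2 κ) (i : ι) : wcomp w f hf hw x i = (w i : ℂ) * x (f i) := rfl

theorem wcomp_bv {ι κ : Type} [DecidableEq ι] [DecidableEq κ] (w : ι → ℝ) (f : ι → κ)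
    (hf : Function.Injective f) (hw : ∀ i, |w i| ≤ 1) (i : ι) :
    wcomp w f hf hw (bv (f i)) = (w i : ℂ) • bv i := by
  ext k
  rw [wcomp_apply, l2_smul, bv_apply, bv_apply]
  by_cases h : k = i
  · simp [h]
  · simp [h, hf.eq_iff]

theorem wcomp_bv_of_notMem {ι κ : Type} [DecidableEq κ] (w : ι → ℝ) (f : ι → κ)
    (hf : Function.Injective f) (hw : ∀ i, |w i| ≤ 1) (k : κ) (hk : ∀ i, f i ≠ k) :
    wcomp w f hf hw (bv k) = 0 := by
  ext i
  rw [wcomp_apply, bv_apply, if_neg (hk i)]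
  simp

theorem star_wcomp_bv {ι : Type} [DecidableEq ι] (w : ι → ℝ) (f : ι → ι)
    (hf : Function.Injective f) (hw : ∀ i, |w i| ≤ 1) (i : ι) :
    star (wcomp w f hf hw) (bv i) = (w i : ℂ) • bv (f i) := by
  ext k
  rw [star_apply, l2_smul, ← inner_conj_symm, inner_bv, wcomp_apply, bv_apply, bv_apply]
  by_cases h : f i = k
  · subst h; simp
  · simp [h, Ne.symm h]

theorem bv_ext {ι : Type} [DecidableEq ι] {E : Type} [NormedAddCommGroup E]
    [InnerProductSpace ℂ E] {S T : L2 ι →L[ℂ] E} (h : ∀ i, S (bv i) = T (bv i)) : S = T := by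
  ext x
  have := mem_closed_of_bv (⊥ : Submodule ℂ E) isClosed_singleton (S - T)
    (fun i => by simp [h]) x
  simpa [sub_eq_zero] using this

/-! ### The shifts of the index set -/

/-- The shift `(N, I, J) ↦ (N + 1, I + s, J + t)` of the index set. -/
def shiftGam (s t : Fin 2) (p : Gam) : Gam :=
  ⟨(p.1.1 + 1, p.1.2.1 + s, p.1.2.2 + t), by
    have := p.2
    dsimp only
    omega⟩

theorem shiftGam_injective (s t : Fin 2) : Function.Injective (shiftGam s t) := by
  rintro ⟨⟨N, I, J⟩, h⟩ ⟨⟨N', I', J'⟩, h'⟩ he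
  simpa [shiftGam] using he

/-- The basis of `ℓ²(Γ)` with integer indices, extended by zero. -/
def eZ (n i j : ℤ) : L2 Gam :=
  if 0 ≤ i ∧ 0 ≤ j then if 0 ≤ n then eG n.toNat i.toNat j.toNat else 0 else 0

theorem eZ_natCast (N I J : ℕ) : eZ N I J = eG N I J := by simp [eZ]

theorem eG_val (p : Gam) : eG p.1.1 p.1.2.1 p.1.2.2 = bv p := by
  rw [eG, dif_pos p.2]

theorem eZ_val (p : Gam) : eZ p.1.1 p.1.2.1 p.1.2.2 = bv p := by
  rw [eZ_natCast, eG_val]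

theorem eZ_of_not {n i j : ℤ} (h : ¬ IsIndex n i j) : eZ n i j = 0 := by
  rw [IsIndex] at h
  rw [eZ]
  split_ifs with h1 h2
  · rw [eG, dif_neg]
    omega
  · rfl
  · rfl

theorem exists_gam {n i j : ℤ} (h : IsIndex n i j) :
    ∃ p : Gam, n = p.1.1 ∧ i = p.1.2.1 ∧ j = p.1.2.2 := by
  obtain ⟨h1, h2, h3, h4⟩ := h
  exact ⟨⟨(n.toNat, i.toNat, j.toNat), by dsimp only; omega⟩, by simp; omega, by simp; omega,
    by simp; omega⟩

theorem isIndex_gam (p : Gam) : IsIndex p.1.1 p.1.2.1 p.1.2.2 := by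
  have := p.2
  refine ⟨?_, ?_, ?_, ?_⟩ <;> omega

/-! ### Bounds on the coefficients and the weighted shifts they define -/

section
variable {q : ℝ}

theorem gZ_nonneg (n : ℤ) : 0 ≤ gZ q n := Real.sqrt_nonneg _

theorem gZ_mono (hq : |q| < 1) {m n : ℤ} (hm : 0 ≤ m) (h : m ≤ n) : gZ q m ≤ gZ q n := by
  lift m to ℕ using hm
  lift n to ℕ using by omega
  refine Real.sqrt_le_sqrt (sub_le_sub_left ?_ 1)
  rw [zpow_natCast, zpow_natCast, ← pow_mul, ← pow_mul, mul_comm, pow_mul, mul_comm, pow_mul]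
  exact pow_le_pow_of_le_one (sq_nonneg q) ((sq_lt_one_iff_abs_lt_one q).2 hq).le (by omega)

theorem abs_zpow_le_one (hq : |q| < 1) {n : ℤ} (hn : 0 ≤ n) : |q ^ n| ≤ 1 := by
  lift n to ℕ using hn
  rw [zpow_natCast]
  exact abs_pow_le_one' hq n

/-- Monotonicity of `gZ` bounds the numerator by the denominator; a vanishing denominator does no
harm, since the quotient is then 0. -/
theorem abs_mul_gZ_div_le (hq : |q| < 1) {c : ℝ} (hc : |c| ≤ 1) {k l m n : ℤ} (hk : 0 ≤ k)
    (hl : 0 ≤ l) (hkm : k ≤ m) (hln : l ≤ n) : |c * (gZ q k * gZ q l) / (gZ q m * gZ q n)| ≤ 1 := by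
  rw [mul_div_assoc, abs_mul]
  refine mul_le_one₀ hc (abs_nonneg _) ?_
  rw [abs_of_nonneg (div_nonneg (mul_nonneg (gZ_nonneg _) (gZ_nonneg _))
    (mul_nonneg (gZ_nonneg _) (gZ_nonneg _)))]
  exact div_le_one_of_le₀ (mul_le_mul (gZ_mono hq hk hkm) (gZ_mono hq hl hln) (gZ_nonneg _)
    (gZ_nonneg _)) (mul_nonneg (gZ_nonneg _) (gZ_nonneg _))

theorem abs_aUp_le (hq : |q| < 1) {n i j : ℤ} (h : IsIndex n i j) : |aUp q n i j| ≤ 1 := by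
  obtain ⟨h1, h2, h3, h4⟩ := h
  exact abs_mul_gZ_div_le hq (abs_zpow_le_one hq (by omega)) (by omega) (by omega) (by omega)
    (by omega)

theorem abs_aDown_le (hq : |q| < 1) {n i j : ℤ} (h : IsIndex n i j) : |aDown q n i j| ≤ 1 := by
  obtain ⟨h1, h2, h3, h4⟩ := h
  simpa [aDown] using abs_mul_gZ_div_le hq (c := 1) (by simp) h3 h1 h4 (show i ≤ n + 1 by omega)

theorem abs_bUp_le (hq : |q| < 1) {n i j : ℤ} (h : IsIndex n i j) : |bUp q n i j| ≤ 1 := by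
  obtain ⟨h1, h2, h3, h4⟩ := h
  exact abs_mul_gZ_div_le hq (by rw [abs_neg]; exact abs_zpow_le_one hq h3) (by omega) (by omega)
    (by omega) (by omega)

theorem abs_bDown_le (hq : |q| < 1) {n i j : ℤ} (h : IsIndex n i j) : |bDown q n i j| ≤ 1 := by
  obtain ⟨h1, h2, h3, h4⟩ := h
  exact abs_mul_gZ_div_le hq (abs_zpow_le_one hq h1) (by omega) (by omega) (by omega) (by omega)

/-- The operator `e_p ↦ c(p) e_{p + (1, s, t)}`. -/
def upOp (c : ℤ → ℤ → ℤ → ℝ) (s t : Fin 2) (hc : ∀ p : Gam, |c p.1.1 p.1.2.1 p.1.2.2| ≤ 1) :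
    L2 Gam →L[ℂ] L2 Gam :=
  star (wcomp (fun p : Gam => c p.1.1 p.1.2.1 p.1.2.2) (shiftGam s t) (shiftGam_injective s t) hc)

variable {c : ℤ → ℤ → ℤ → ℝ} {s t : Fin 2} {hc : ∀ p : Gam, |c p.1.1 p.1.2.1 p.1.2.2| ≤ 1}

theorem upOp_eZ {n i j : ℤ} (h : IsIndex n i j) :
    upOp c s t hc (eZ n i j) = (c n i j : ℂ) • eZ (n + 1) (i + (s : ℕ)) (j + (t : ℕ)) := by
  obtain ⟨p, rfl, rfl, rfl⟩ := exists_gam h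
  rw [eZ_val, upOp, star_wcomp_bv, ← eZ_val]
  simp [shiftGam]

theorem star_upOp_eZ {n i j : ℤ} (h : IsIndex n i j)
    (h0 : ¬ IsIndex (n - 1) (i - (s : ℕ)) (j - (t : ℕ)) →
      c (n - 1) (i - (s : ℕ)) (j - (t : ℕ)) = 0) :
    star (upOp c s t hc) (eZ n i j) =
      (c (n - 1) (i - (s : ℕ)) (j - (t : ℕ)) : ℂ) • eZ (n - 1) (i - (s : ℕ)) (j - (t : ℕ)) := by
  rw [upOp, star_star]
  by_cases h1 : IsIndex (n - 1) (i - (s : ℕ)) (j - (t : ℕ))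
  · obtain ⟨p, hp1, hp2, hp3⟩ := exists_gam h1
    rw [hp1, hp2, hp3, eZ_val]
    obtain rfl : n = p.1.1 + 1 := by omega
    obtain rfl : i = p.1.2.1 + (s : ℕ) := by omega
    obtain rfl : j = p.1.2.2 + (t : ℕ) := by omega
    have h2 : eZ (p.1.1 + 1) (p.1.2.1 + (s : ℕ)) (p.1.2.2 + (t : ℕ)) = bv (shiftGam s t p) := by
      rw [← eZ_val]
      simp [shiftGam]
    rw [h2, wcomp_bv]
  · rw [h0 h1]
    obtain ⟨p, rfl, rfl, rfl⟩ := exists_gam h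
    rw [eZ_val, wcomp_bv_of_notMem]
    · simp
    · rintro p' rfl
      refine h1 ?_
      have := isIndex_gam p'
      simpa [shiftGam] using this

/-! ### The left regular representation -/

/-- The operator `λ_q(α)`. -/
def regAlpha (hq : |q| < 1) : L2 Gam →L[ℂ] L2 Gam :=
  upOp (aUp q) 0 0 (fun p => abs_aUp_le hq (isIndex_gam p)) +
    -- The lowering part is the adjoint of a raising shift, whose weight at an index is the lowering
    -- coefficient at the raised index.
    star (upOp (fun n i j => aDown q (n + 1) (i + 1) (j + 1)) 1 1
      (fun p => abs_aDown_le hq (by obtain ⟨h1, h2, h3, h4⟩ := isIndex_gam p;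
                                    refine ⟨?_, ?_, ?_, ?_⟩ <;> omega)))

/-- The operator `λ_q(β)`. -/
def regBeta (hq : |q| < 1) : L2 Gam →L[ℂ] L2 Gam :=
  upOp (bUp q) 1 0 (fun p => abs_bUp_le hq (isIndex_gam p)) +
    star (upOp (fun n i j => bDown q (n + 1) i (j + 1)) 0 1
      (fun p => abs_bDown_le hq (by obtain ⟨h1, h2, h3, h4⟩ := isIndex_gam p;
                                    refine ⟨?_, ?_, ?_, ?_⟩ <;> omega)))

/-- Leaving the index set is possible only from its boundary, where one factor of the numerator is
`gZ q 0`. -/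
theorem aDown_eq_zero {n i j : ℤ} (h : IsIndex n i j) (h1 : ¬ IsIndex (n - 1) (i - 1) (j - 1)) :
    aDown q n i j = 0 := by
  obtain rfl | rfl : i = 0 ∨ j = 0 := by simp only [IsIndex] at h h1; omega
  all_goals simp [aDown, gZ_zero]

theorem aUp_eq_zero {n i j : ℤ} (h : IsIndex n i j) (h1 : ¬ IsIndex (n - 1) i j) :
    aUp q (n - 1) i j = 0 := by
  obtain rfl | rfl : i = n ∨ j = n := by simp only [IsIndex] at h h1; omega
  all_goals simp [aUp, gZ_zero]

theorem bDown_eq_zero {n i j : ℤ} (h : IsIndex n i j) (h1 : ¬ IsIndex (n - 1) i (j - 1)) :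
    bDown q n i j = 0 := by
  obtain rfl | rfl : i = n ∨ j = 0 := by simp only [IsIndex] at h h1; omega
  all_goals simp [bDown, gZ_zero]

theorem bUp_eq_zero {n i j : ℤ} (h : IsIndex n i j) (h1 : ¬ IsIndex (n - 1) (i - 1) j) :
    bUp q (n - 1) (i - 1) j = 0 := by
  obtain rfl | rfl : i = 0 ∨ j = n := by simp only [IsIndex] at h h1; omega
  all_goals simp [bUp, gZ_zero]

variable (hq : |q| < 1)

theorem regAlpha_eZ {n i j : ℤ} (h : IsIndex n i j) : regAlpha hq (eZ n i j) =
    (aUp q n i j : ℂ) • eZ (n + 1) i j + (aDown q n i j : ℂ) • eZ (n - 1) (i - 1) (j - 1) := by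
  rw [regAlpha, add_apply, upOp_eZ h, star_upOp_eZ h]
  · simp
  · simpa using aDown_eq_zero h

theorem star_regAlpha_eZ {n i j : ℤ} (h : IsIndex n i j) : star (regAlpha hq) (eZ n i j) =
    (aUp q (n - 1) i j : ℂ) • eZ (n - 1) i j +
      (aDown q (n + 1) (i + 1) (j + 1) : ℂ) • eZ (n + 1) (i + 1) (j + 1) := by
  rw [regAlpha, star_add, star_star, add_apply, upOp_eZ h, star_upOp_eZ h]
  · simp
  · simpa using aUp_eq_zero h

theorem regBeta_eZ {n i j : ℤ} (h : IsIndex n i j) : regBeta hq (eZ n i j) =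
    (bUp q n i j : ℂ) • eZ (n + 1) (i + 1) j + (bDown q n i j : ℂ) • eZ (n - 1) i (j - 1) := by
  rw [regBeta, add_apply, upOp_eZ h, star_upOp_eZ h]
  · simp
  · simpa using bDown_eq_zero h

theorem star_regBeta_eZ {n i j : ℤ} (h : IsIndex n i j) : star (regBeta hq) (eZ n i j) =
    (bUp q (n - 1) (i - 1) j : ℂ) • eZ (n - 1) (i - 1) j +
      (bDown q (n + 1) i (j + 1) : ℂ) • eZ (n + 1) i (j + 1) := by
  rw [regBeta, star_add, star_star, add_apply, upOp_eZ h, star_upOp_eZ h]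
  · simp
  · simpa using bUp_eq_zero h

theorem eZ_ext {S T : L2 Gam →L[ℂ] L2 Gam}
    (h : ∀ n i j, IsIndex n i j → S (eZ n i j) = T (eZ n i j)) : S = T :=
  bv_ext fun p => by rw [← eZ_val]; exact h _ _ _ (isIndex_gam p)

/-- This permits applying the formula for T at an intermediate index that may lie outside the index
set, because its coefficient is then zero. -/
theorem smul_map_eZ {c : ℝ} {n i j : ℤ} {T : L2 Gam →L[ℂ] L2 Gam} {x : L2 Gam}
    (hT : IsIndex n i j → T (eZ n i j) = x) (h : ¬ IsIndex n i j → c = 0) :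
    (c : ℂ) • T (eZ n i j) = (c : ℂ) • x := by
  by_cases h1 : IsIndex n i j
  · rw [hT h1]
  · simp [h h1]

/-- A product of two generators moves the doubled index n by 0, 2 or -2. In each relation `e1`,
`e2`, `e3` are the comparisons of the three corresponding coefficients. -/
theorem reg_relations (hq0 : q ≠ 0) : Relations q (regAlpha hq) (regBeta hq) where
  star_mul_add := eZ_ext fun n i j h => by
    have e1 := congrArg (Complex.ofReal) (diag_star_mul hq hq0 h)
    have e2 := congrArg (Complex.ofReal) (aUp_aDown hq0 n i j)
    have e3 := congrArg (Complex.ofReal) (aDown_aUp hq0 n i j)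
    push_cast at e1 e2 e3
    have u1 : IsIndex (n + 1) i j := by simp only [IsIndex] at h ⊢; omega
    have u2 : IsIndex (n + 1) (i + 1) j := by simp only [IsIndex] at h ⊢; omega
    simp only [add_apply, l2_mul, one_apply_eq_self, regAlpha_eZ hq h, regBeta_eZ hq h, map_add,
      map_smul, star_regAlpha_eZ hq u1, star_regBeta_eZ hq u2]
    rw [smul_map_eZ (star_regAlpha_eZ hq) (aDown_eq_zero h),
      smul_map_eZ (star_regBeta_eZ hq) (bDown_eq_zero h)]
    simp only [add_sub_cancel_right, sub_add_cancel]
    linear_combination (norm := skip) e1 • eZ n i j + e2 • eZ (n + 1 + 1) (i + 1) (j + 1) +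
      e3 • eZ (n - 1 - 1) (i - 1) (j - 1)
    module
  mul_star_add := eZ_ext fun n i j h => by
    have e1 := congrArg (Complex.ofReal) (diag_mul_star hq hq0 h)
    have e2 := congrArg (Complex.ofReal) (up_mul_star hq0 n i j)
    have e3 := congrArg (Complex.ofReal) (down_mul_star hq0 n i j)
    push_cast at e1 e2 e3
    have u1 : IsIndex (n + 1) (i + 1) (j + 1) := by simp only [IsIndex] at h ⊢; omega
    have u2 : IsIndex (n + 1) i (j + 1) := by simp only [IsIndex] at h ⊢; omega
    simp only [add_apply, smul_apply, l2_mul, one_apply_eq_self, star_regAlpha_eZ hq h,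
      star_regBeta_eZ hq h, map_add, map_smul, regAlpha_eZ hq u1, regBeta_eZ hq u2]
    rw [smul_map_eZ (regAlpha_eZ hq) (aUp_eq_zero h), smul_map_eZ (regBeta_eZ hq) (bUp_eq_zero h)]
    simp only [add_sub_cancel_right, sub_add_cancel]
    linear_combination (norm := skip) e1 • eZ n i j + e2 • eZ (n + 1 + 1) (i + 1) (j + 1) +
      e3 • eZ (n - 1 - 1) (i - 1) (j - 1)
    module
  comm := eZ_ext fun n i j h => by
    have e1 := congrArg (Complex.ofReal) (diag_comm hq hq0 h)
    have e2 := congrArg (Complex.ofReal) (up_comm hq0 n i j)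
    have e3 := congrArg (Complex.ofReal) (down_comm hq0 n i j)
    push_cast at e1 e2 e3
    have u1 : IsIndex (n + 1) (i + 1) j := by simp only [IsIndex] at h ⊢; omega
    have u2 : IsIndex (n + 1) i j := by simp only [IsIndex] at h ⊢; omega
    simp only [smul_apply, l2_mul, regAlpha_eZ hq h, regBeta_eZ hq h, map_add, map_smul,
      regAlpha_eZ hq u1, regBeta_eZ hq u2]
    rw [smul_map_eZ (regAlpha_eZ hq) (bDown_eq_zero h),
      smul_map_eZ (regBeta_eZ hq) (aDown_eq_zero h)]
    simp only [add_sub_cancel_right, sub_add_cancel]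
    linear_combination (norm := skip) e1 • eZ n i (j - 1) + e2 • eZ (n + 1 + 1) (i + 1) j +
      e3 • eZ (n - 1 - 1) (i - 1) (j - 1 - 1)
    module
  comm_star := eZ_ext fun n i j h => by
    have e1 := congrArg (Complex.ofReal) (diag_comm_star hq hq0 h)
    have e2 := congrArg (Complex.ofReal) (up_comm_star hq0 n i j)
    have e3 := congrArg (Complex.ofReal) (down_comm_star hq0 n i j)
    push_cast at e1 e2 e3
    have u1 : IsIndex (n + 1) i (j + 1) := by simp only [IsIndex] at h ⊢; omega
    have u2 : IsIndex (n + 1) i j := by simp only [IsIndex] at h ⊢; omega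
    simp only [smul_apply, l2_mul, regAlpha_eZ hq h, star_regBeta_eZ hq h, map_add, map_smul,
      regAlpha_eZ hq u1, star_regBeta_eZ hq u2]
    rw [smul_map_eZ (regAlpha_eZ hq) (bUp_eq_zero h),
      smul_map_eZ (star_regBeta_eZ hq) (aDown_eq_zero h)]
    simp only [add_sub_cancel_right, sub_add_cancel]
    linear_combination (norm := skip) e1 • eZ n (i - 1) j + e2 • eZ (n + 1 + 1) i (j + 1) +
      e3 • eZ (n - 1 - 1) (i - 1 - 1) (j - 1)
    module
  normal := eZ_ext fun n i j h => by
    have e1 := congrArg (Complex.ofReal) (diag_normal hq hq0 h)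
    have e2 := congrArg (Complex.ofReal) (up_normal hq0 n i j)
    have e3 := congrArg (Complex.ofReal) (down_normal hq0 n i j)
    push_cast at e1 e2 e3
    have u1 : IsIndex (n + 1) (i + 1) j := by simp only [IsIndex] at h ⊢; omega
    have u2 : IsIndex (n + 1) i (j + 1) := by simp only [IsIndex] at h ⊢; omega
    simp only [l2_mul, star_regBeta_eZ hq h, regBeta_eZ hq h, map_add, map_smul,
      star_regBeta_eZ hq u1, regBeta_eZ hq u2]
    rw [smul_map_eZ (star_regBeta_eZ hq) (bDown_eq_zero h),
      smul_map_eZ (regBeta_eZ hq) (bUp_eq_zero h)]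
    simp only [add_sub_cancel_right, sub_add_cancel]
    linear_combination (norm := skip) e1 • eZ n i j + e2 • eZ (n + 1 + 1) (i + 1) (j + 1) +
      e3 • eZ (n - 1 - 1) (i - 1) (j - 1)
    module

instance : Nontrivial (L2 Gam) :=
  ⟨eG 0 0 0, 0, fun h => by
    have h1 := norm_bv (⟨(0, 0, 0), le_rfl, le_rfl⟩ : Gam)
    rw [eG, dif_pos ⟨le_rfl, le_rfl⟩] at h
    rw [h, norm_zero] at h1
    exact zero_ne_one h1⟩

/-- The representation `λ_q` of `A_q` on `ℓ²(Γ)`. -/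
def regRep (hq0 : q ≠ 0) : A q →⋆ₐ[ℂ] (L2 Gam →L[ℂ] L2 Gam) :=
  lift (B := L2 Gam →L[ℂ] L2 Gam) (reg_relations hq hq0)

end

/-! ### From the polynomial algebra to `A_q` -/

section
variable {q : ℝ}

/-- The images of the four letters for a pair of elements of a `*`-algebra. -/
def starLetters {B : Type*} [Star B] (a b : B) : Letter → B
  | .a => a
  | .b => b
  | .aStar => star a
  | .bStar => star b

theorem Relations.algRelations {B : Type*} [Ring B] [StarRing B] [Algebra ℂ B] [StarModule ℂ B]
    {a b : B} (h : Relations q a b) : AlgRelations (q : ℂ) (starLetters a b) where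
  star_mul_add := eq_sub_of_add_eq (by
    have := h.star_mul_add
    rwa [h.normal] at this)
  mul_star_add := eq_sub_of_add_eq h.mul_star_add
  a_b := h.comm
  a_bStar := h.comm_star
  b_aStar := by simpa [starLetters] using congrArg star h.comm_star
  bStar_aStar := by simpa [starLetters] using congrArg star h.comm
  bStar_b := h.normal

/-- The canonical map from the polynomial algebra to `A_q`. -/
def polEv (q : ℝ) : PolAlg (q : ℂ) →ₐ[ℂ] A q := polLift (relations q).algRelations

theorem polEv_polMk (p : Poly) : polEv q (polMk q p) = ev q p := by
  rw [polEv, polLift_polMk, ev]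
  congr 2

theorem polEv_letter (x : Letter) :
    polEv q (letter q x) = starLetters (alpha q) (beta q) x := polLift_letter _ x

/-- The coproduct on words factors through the polynomial algebra, where invariance is already
known. -/
theorem coproduct_eq (p : Poly) : coproduct q p =
    TensorProduct.map (polEv q).toLinearMap (polEv q).toLinearMap (polCoprod q (polMk q p)) := by
  have : coproduct q = ((Algebra.TensorProduct.map (polEv q) (polEv q)).comp (polCoprod q)).comp
      (polMk q) := by
    refine FreeAlgebra.hom_ext (funext fun x => ?_)
    simp only [coproduct, Function.comp_apply, FreeAlgebra.lift_ι_apply, AlgHom.comp_apply, polMk_ι,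
      polCoprod_letter]
    cases x <;> simp only [coprodGen, map_add, map_sub, map_smul, Algebra.TensorProduct.map_tmul,
      polEv_letter, starLetters]
  exact AlgHom.congr_fun this p

theorem letter_mem_range_ev (x : Letter) :
    starLetters (alpha q) (beta q) x ∈ (ev q).range := by
  rw [← polEv_letter, ← polMk_ι, polEv_polMk]
  exact ⟨_, rfl⟩

theorem star_mem_range_ev {x : A q} (hx : x ∈ (ev q).range) : star x ∈ (ev q).range := by
  obtain ⟨p, rfl⟩ := hx
  change star (ev q p) ∈ _
  induction p using FreeAlgebra.induction with
  | grade0 r =>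
    rw [AlgHom.commutes, ← algebraMap_star_comm]
    exact Subalgebra.algebraMap_mem _ _
  | grade1 x =>
    rw [← polEv_polMk, polMk_ι, polEv_letter]
    cases x
    · exact letter_mem_range_ev .aStar
    · exact letter_mem_range_ev .bStar
    · simpa [starLetters] using letter_mem_range_ev (q := q) .a
    · simpa [starLetters] using letter_mem_range_ev (q := q) .b
  | mul a b ha hb => rw [map_mul, star_mul]; exact mul_mem hb ha
  | add a b ha hb => rw [map_add, star_add]; exact add_mem ha hb

/-- The values of words in the four letters form a `*`-subalgebra containing both generators, hence
contain the one whose closure defines `A q`. -/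
theorem denseRange_ev (q : ℝ) : DenseRange (ev q) := by
  have key : ∀ y ∈ StarAlgebra.adjoin ℂ {prodA q, prodB q},
      ∃ p, (ev q p : gen q).1 = y := by
    intro y hy
    suffices h : ∃ x ∈ (ev q).range, (x : gen q).1 = y by
      obtain ⟨_, ⟨p, rfl⟩, rfl⟩ := h
      exact ⟨p, rfl⟩
    induction hy using StarAlgebra.adjoin_induction with
    | mem y hy =>
      rcases hy with rfl | rfl
      · exact ⟨alpha q, letter_mem_range_ev .a, rfl⟩
      · exact ⟨beta q, letter_mem_range_ev .b, rfl⟩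
    | algebraMap r => exact ⟨algebraMap ℂ (A q) r, Subalgebra.algebraMap_mem _ _, rfl⟩
    | add x y _ _ hx hy =>
      obtain ⟨x, hx, rfl⟩ := hx
      obtain ⟨y, hy, rfl⟩ := hy
      exact ⟨x + y, add_mem hx hy, rfl⟩
    | mul x y _ _ hx hy =>
      obtain ⟨x, hx, rfl⟩ := hx
      obtain ⟨y, hy, rfl⟩ := hy
      exact ⟨x * y, mul_mem hx hy, rfl⟩
    | star x _ hx =>
      obtain ⟨x, hx, rfl⟩ := hx
      exact ⟨star x, star_mem_range_ev hx, rfl⟩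
  intro x
  have h1 : (x : gen q) ∈ closure (Set.range fun p => (ev q p : gen q)) := by
    have hx : (x : gen q).1 ∈ closure ((StarAlgebra.adjoin ℂ {prodA q, prodB q} :
        StarSubalgebra ℂ (ModelProd q)) : Set (ModelProd q)) := x.2
    refine closure_subtype.2 (closure_mono ?_ hx)
    intro y hy
    obtain ⟨p, hp⟩ := key y hy
    exact ⟨_, ⟨p, rfl⟩, hp⟩
  exact h1

end

/-! ### Homogeneous vectors -/

/-- The span of the basis vectors of the given bidegree. -/
def homog (s t : ℤ) : Submodule ℂ (L2 Gam) :=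
  Submodule.span ℂ {x | ∃ n i j, IsIndex n i j ∧ 2 * i - n = s ∧ 2 * j - n = t ∧ x = eZ n i j}

theorem eZ_mem_homog {n i j s t : ℤ} (hs : 2 * i - n = s) (ht : 2 * j - n = t) :
    eZ n i j ∈ homog s t := by
  by_cases h : IsIndex n i j
  · exact Submodule.subset_span ⟨n, i, j, h, hs, ht, rfl⟩
  · rw [eZ_of_not h]; exact Submodule.zero_mem _

theorem map_homog {T : L2 Gam →L[ℂ] L2 Gam} {s' t' : ℤ}
    (hT : ∀ n i j, IsIndex n i j → T (eZ n i j) ∈ homog (2 * i - n + s') (2 * j - n + t'))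
    {s t : ℤ} {x : L2 Gam} (hx : x ∈ homog s t) : T x ∈ homog (s + s') (t + t') := by
  induction hx using Submodule.span_induction with
  | zero => rw [map_zero]; exact Submodule.zero_mem _
  | add x y _ _ hx hy => rw [map_add]; exact Submodule.add_mem _ hx hy
  | smul c x _ hx => rw [map_smul]; exact Submodule.smul_mem _ _ hx
  | mem x hx =>
    obtain ⟨n, i, j, h, rfl, rfl, rfl⟩ := hx
    exact hT n i j h

theorem map_pow_homog {T : L2 Gam →L[ℂ] L2 Gam} {s' t' : ℤ}
    (hT : ∀ n i j, IsIndex n i j → T (eZ n i j) ∈ homog (2 * i - n + s') (2 * j - n + t'))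
    {s t : ℤ} {x : L2 Gam} (hx : x ∈ homog s t) (k : ℕ) :
    (T ^ k) x ∈ homog (s + k * s') (t + k * t') := by
  induction k with
  | zero => simpa using hx
  | succ k ih =>
    rw [pow_succ', l2_mul]
    have := map_homog hT ih
    convert this using 1
    push_cast
    congr 1 <;> ring

/-- The vector `e^0_{00}`. -/
def vac : L2 Gam := eZ 0 0 0

theorem vac_eq : vac = eG 0 0 0 := eZ_natCast 0 0 0

theorem isIndex_zero : IsIndex 0 0 0 := ⟨le_rfl, le_rfl, le_rfl, le_rfl⟩

theorem inner_eZ {n i j n' i' j' : ℤ} (h : IsIndex n i j) (h' : IsIndex n' i' j') :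
    ⟪eZ n i j, eZ n' i' j'⟫_ℂ = if n = n' ∧ i = i' ∧ j = j' then 1 else 0 := by
  obtain ⟨p, rfl, rfl, rfl⟩ := exists_gam h
  obtain ⟨p', rfl, rfl, rfl⟩ := exists_gam h'
  rw [eZ_val, eZ_val, inner_bv, bv_apply]
  congr 1
  simp [Subtype.ext_iff, Prod.ext_iff]

/-- The vacuum has bidegree (0,0), and basis vectors of different bidegrees are orthogonal. -/
theorem inner_vac_homog {s t : ℤ} (hst : s ≠ 0 ∨ t ≠ 0) {x : L2 Gam} (hx : x ∈ homog s t) :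
    ⟪vac, x⟫_ℂ = 0 := by
  induction hx using Submodule.span_induction with
  | zero => rw [inner_zero_right]
  | add x y _ _ hx hy => rw [inner_add_right, hx, hy, add_zero]
  | smul c x _ hx => rw [inner_smul_right, hx, mul_zero]
  | mem x hx =>
    obtain ⟨n, i, j, h, rfl, rfl, rfl⟩ := hx
    rw [vac, inner_eZ isIndex_zero h, if_neg]
    omega

section
variable {q : ℝ} (hq : |q| < 1)

/-- Both terms of λ_q(α) have bidegree (-1,-1), and both terms of λ_q(β) have (1,-1); adjoints have
the opposite bidegrees. This grading makes the state vanish on unbalanced monomials. -/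
theorem regAlpha_homog {s t : ℤ} {x : L2 Gam} (hx : x ∈ homog s t) (k : ℕ) :
    (regAlpha hq ^ k) x ∈ homog (s + k * (-1)) (t + k * (-1)) :=
  map_pow_homog (fun n i j h => by
    rw [regAlpha_eZ hq h]
    exact Submodule.add_mem _ (Submodule.smul_mem _ _ (eZ_mem_homog (by ring) (by ring)))
      (Submodule.smul_mem _ _ (eZ_mem_homog (by ring) (by ring)))) hx k

theorem star_regAlpha_homog {s t : ℤ} {x : L2 Gam} (hx : x ∈ homog s t) (k : ℕ) :
    (star (regAlpha hq) ^ k) x ∈ homog (s + k * 1) (t + k * 1) :=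
  map_pow_homog (fun n i j h => by
    rw [star_regAlpha_eZ hq h]
    exact Submodule.add_mem _ (Submodule.smul_mem _ _ (eZ_mem_homog (by ring) (by ring)))
      (Submodule.smul_mem _ _ (eZ_mem_homog (by ring) (by ring)))) hx k

theorem regBeta_homog {s t : ℤ} {x : L2 Gam} (hx : x ∈ homog s t) (k : ℕ) :
    (regBeta hq ^ k) x ∈ homog (s + k * 1) (t + k * (-1)) :=
  map_pow_homog (fun n i j h => by
    rw [regBeta_eZ hq h]
    exact Submodule.add_mem _ (Submodule.smul_mem _ _ (eZ_mem_homog (by ring) (by ring)))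
      (Submodule.smul_mem _ _ (eZ_mem_homog (by ring) (by ring)))) hx k

theorem star_regBeta_homog {s t : ℤ} {x : L2 Gam} (hx : x ∈ homog s t) (k : ℕ) :
    (star (regBeta hq) ^ k) x ∈ homog (s + k * (-1)) (t + k * 1) :=
  map_pow_homog (fun n i j h => by
    rw [star_regBeta_eZ hq h]
    exact Submodule.add_mem _ (Submodule.smul_mem _ _ (eZ_mem_homog (by ring) (by ring)))
      (Submodule.smul_mem _ _ (eZ_mem_homog (by ring) (by ring)))) hx k

/-- The second index stays 0, so the lowering term always leaves the index set. The remaining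
coefficients g(l+1)/g(l+2) telescope. -/
theorem star_regBeta_pow_vac (l : ℕ) : (star (regBeta hq) ^ l) vac =
    ((gZ q 1 / gZ q (l + 1) : ℝ) : ℂ) • eZ l 0 l := by
  induction l with
  | zero =>
    have := (gZ_pos hq one_pos).ne'
    simp [vac, this]
  | succ l ih =>
    have h : IsIndex l 0 l := by simp only [IsIndex]; omega
    have h0 : ¬ IsIndex ((l : ℤ) - 1) (0 - 1) l := by simp only [IsIndex]; omega
    rw [pow_succ', l2_mul, ih, map_smul, star_regBeta_eZ hq h, eZ_of_not h0, smul_zero, zero_add,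
      smul_smul, ← Complex.ofReal_mul]
    have e : gZ q 1 / gZ q (l + 1) * bDown q (l + 1) 0 (l + 1) = gZ q 1 / gZ q (l + 1 + 1) := by
      have h1 := (gZ_pos hq (n := l + 1) (by omega)).ne'
      simp only [bDown, sub_zero, zpow_zero, one_mul]
      field_simp
    rw [e]
    push_cast
    rfl

/-! ### The Haar state -/

variable (hq0 : q ≠ 0)

/-- The vector functional of the representation `λ_q` at `e^0_{00}`. -/
def haarLin : A q →ₗ[ℂ] ℂ where
  toFun a := ⟪vac, regRep hq hq0 a vac⟫_ℂ
  map_add' a b := by rw [map_add, add_apply, inner_add_right]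
  map_smul' c a := by rw [map_smul, smul_apply, inner_smul_right]; rfl

theorem regRep_polEv_letter (x : Letter) : regRep hq hq0 (polEv q (letter q x)) =
    starLetters (regAlpha hq) (regBeta hq) x := by
  rw [polEv_letter]
  cases x
  · rfl
  · rfl
  · exact map_star _ _
  · exact map_star _ _

theorem isPolHaar_haarLin : IsPolHaar (q := (q : ℂ)) (haarLin hq hq0 ∘ₗ (polEv q).toLinearMap) := by
  have hA : ∀ i j l, haarLin hq hq0 (polEv q (aMon q i j l)) =
      ⟪vac, (regAlpha hq ^ i) ((regBeta hq ^ j) ((star (regBeta hq) ^ l) vac))⟫_ℂ := by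
    intro i j l
    simp only [haarLin, LinearMap.coe_mk, AddHom.coe_mk, aMon, map_mul, map_pow,
      regRep_polEv_letter, starLetters, l2_mul]
  have hD : ∀ i j l, haarLin hq hq0 (polEv q (dMon q i j l)) =
      ⟪vac, (star (regAlpha hq) ^ i) ((regBeta hq ^ j) ((star (regBeta hq) ^ l) vac))⟫_ℂ := by
    intro i j l
    simp only [haarLin, LinearMap.coe_mk, AddHom.coe_mk, dMon, map_mul, map_pow,
      regRep_polEv_letter, starLetters, l2_mul]
  have hv : vac ∈ homog 0 0 := eZ_mem_homog (by ring) (by ring)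
  have hd : ∀ i j l, (i ≠ 0 ∨ j ≠ l) → haarLin hq hq0 (polEv q (dMon q i j l)) = 0 := by
    intro i j l h
    rw [hD]
    -- The bidegree is (i + j - l, i - j + l), which is (0,0) only for i = 0 and j = l.
    refine inner_vac_homog ?_ (star_regAlpha_homog hq (regBeta_homog hq
      (star_regBeta_homog hq hv l) j) i)
    omega
  constructor
  · intro i j l
    rw [LinearMap.comp_apply, AlgHom.toLinearMap_apply, hA]
    refine inner_vac_homog ?_ (regAlpha_homog hq (regBeta_homog hq
      (star_regBeta_homog hq hv l) j) (i + 1))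
    push_cast
    omega
  · intro i j l
    exact hd _ _ _ (Or.inl (by omega))
  · intro j l h
    exact hd _ _ _ (Or.inr h)
  · intro l
    rw [LinearMap.comp_apply, AlgHom.toLinearMap_apply, hD, pow_zero, one_apply_eq_self]
    -- The value on β^l β*^l is the squared norm of β*^l applied to the vacuum, namely
    -- g(1)²/g(l+1)².
    have h1 : ⟪vac, (regBeta hq ^ l) ((star (regBeta hq) ^ l) vac)⟫_ℂ =
        ⟪(star (regBeta hq) ^ l) vac, (star (regBeta hq) ^ l) vac⟫_ℂ := by
      rw [← star_pow, ContinuousLinearMap.star_eq_adjoint,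
        ContinuousLinearMap.adjoint_inner_left]
    have h : IsIndex l 0 l := by simp only [IsIndex]; omega
    have e1 := gZ_sq hq (n := 1) (by omega)
    have e2 := gZ_sq hq (n := l + 1) (by omega)
    rw [h1, star_regBeta_pow_vac, inner_smul_left, inner_smul_right, inner_eZ h h]
    simp only [and_self, if_true, mul_one, Complex.conj_ofReal]
    have e3 : q ^ ((l : ℤ) + 1) = q ^ (l + 1) := by exact_mod_cast zpow_natCast q (l + 1)
    rw [← Complex.ofReal_mul, ← sq, div_pow, e1, e2, e3, zpow_one, ← pow_mul, mul_comm (l + 1)]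
    push_cast
    rfl

end

section
variable {q : ℝ} (hq : |q| < 1) (hq0 : q ≠ 0)

theorem haarLin_star_mul (a b : A q) : haarLin hq hq0 (star a * b) =
    ⟪regRep hq hq0 a vac, regRep hq hq0 b vac⟫_ℂ := by
  change ⟪vac, regRep hq hq0 (star a * b) vac⟫_ℂ = _
  rw [map_mul, map_star, l2_mul, ContinuousLinearMap.star_eq_adjoint,
    ContinuousLinearMap.adjoint_inner_right]

/-- The Haar state of `A_q`. -/
def haar : A q →ₚ[ℂ] ℂ := PositiveLinearMap.mk₀ (haarLin hq hq0) fun x hx => by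
  obtain ⟨y, rfl⟩ := CStarAlgebra.nonneg_iff_eq_star_mul_self.1 hx
  rw [haarLin_star_mul, inner_self_eq_norm_sq_to_K, RCLike.ofReal_eq_complex_ofReal]
  exact_mod_cast sq_nonneg ‖regRep hq hq0 y vac‖

theorem haar_apply (a : A q) : haar hq hq0 a = haarLin hq hq0 a := rfl

include hq in
theorem cpow_ne_one (n : ℕ) (hn : n ≠ 0) : (q : ℂ) ^ n ≠ 1 := by
  intro h
  have := congrArg norm h
  rw [norm_pow, Complex.norm_real, norm_one, Real.norm_eq_abs] at this
  exact (pow_lt_one₀ (abs_nonneg q) hq hn).ne this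

theorem isHaarState_haar : IsHaarState (haar hq hq0) := by
  have H := isPolHaar_haarLin hq hq0
  have hc : (q : ℂ) ≠ 0 := Complex.ofReal_ne_zero.2 hq0
  have hm : ∀ ρ σ : A q →ₗ[ℂ] ℂ, ∀ p, TensorProduct.map ρ σ (coproduct q p) =
      TensorProduct.map (ρ ∘ₗ (polEv q).toLinearMap) (σ ∘ₗ (polEv q).toLinearMap)
        (polCoprod q (polMk q p)) := fun ρ σ p => by
    rw [coproduct_eq, ← LinearMap.comp_apply, ← TensorProduct.map_comp]
  refine ⟨?_, fun ρ p => ?_, fun ρ p => ?_⟩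
  · have := H.map_one (cpow_ne_one hq)
    simpa [haar_apply] using this
  · have := H.right_inv hc (cpow_ne_one hq) (ρ.toLinearMap ∘ₗ (polEv q).toLinearMap) (polMk q p)
    rw [hm]
    refine Eq.trans ?_ this.symm
    simp [polEv_polMk, haar_apply]
  · have := H.left_inv hc (cpow_ne_one hq) (ρ.toLinearMap ∘ₗ (polEv q).toLinearMap) (polMk q p)
    rw [hm]
    refine Eq.trans ?_ this.symm
    simp [polEv_polMk, haar_apply]

/-- A positive functional as a continuous linear functional. -/
def posCLM (h : A q →ₚ[ℂ] ℂ) : A q →L[ℂ] ℂ := ⟨h.toLinearMap, map_continuous h⟩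

/-- The functional (h ⊗ h')Δ equals h by invariance of h and equals h' by invariance of h'; both are
continuous, so words suffice. -/
theorem IsHaarState.unique {h h' : A q →ₚ[ℂ] ℂ} (H : IsHaarState h) (H' : IsHaarState h') :
    h = h' := by
  have key : ∀ p, h (ev q p) = h' (ev q p) := by
    intro p
    have h1 := H.right_inv (posCLM h') p
    have h2 := H'.left_inv (posCLM h) p
    have h3 := h1.trans h2.symm
    have e1 : posCLM h 1 = 1 := H.map_one
    have e2 : posCLM h' 1 = 1 := H'.map_one
    rw [e1, e2, one_smul, one_smul] at h3
    exact h3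
  have := (denseRange_ev q).equalizer (map_continuous h) (map_continuous h') (funext key)
  exact PositiveLinearMap.ext fun x => congrFun this x

/-! ### Cyclicity of the vacuum vector -/

/-- The linear map `a ↦ λ_q(a) e^0_{00}`. -/
def orbit : A q →ₗ[ℂ] L2 Gam where
  toFun a := regRep hq hq0 a vac
  map_add' a b := by rw [map_add, add_apply]
  map_smul' c a := by rw [map_smul, smul_apply, RingHom.id_apply]

theorem orbit_mul (a b : A q) : orbit hq hq0 (a * b) = regRep hq hq0 a (orbit hq hq0 b) := by
  simp only [orbit, LinearMap.coe_mk, AddHom.coe_mk, map_mul, l2_mul]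

theorem map_mem_range_orbit (a : A q) {x : L2 Gam} (hx : x ∈ LinearMap.range (orbit hq hq0)) :
    regRep hq hq0 a x ∈ LinearMap.range (orbit hq hq0) := by
  obtain ⟨b, rfl⟩ := hx
  exact ⟨a * b, orbit_mul hq hq0 a b⟩

/-- A basis vector at level n+1 is the upper term of one letter applied to a vector at level n; the
lower term lies at level n-1 and is already reached. The letter is α when i, j ≤ n, β* when only j =
n+1, β when only i = n+1, and α* at the corner. In each case the coefficient of the upper term is
nonzero. -/
theorem eZ_mem_range_orbit (n : ℕ) : ∀ i j, IsIndex n i j →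
    eZ n i j ∈ LinearMap.range (orbit hq hq0) := by
  induction n using Nat.strong_induction_on with
  | _ n ih =>
    set M := LinearMap.range (orbit hq hq0) with hM
    intro i j h
    cases n with
    | zero =>
      obtain ⟨h1, h2, h3, h4⟩ := h
      obtain rfl : i = 0 := by omega
      obtain rfl : j = 0 := by omega
      refine ⟨1, ?_⟩
      simp [orbit, vac]
    | succ n =>
      push_cast at h ⊢
      have hlow : ∀ i j, eZ ((n : ℤ) - 1) i j ∈ M := by
        intro i j
        by_cases h1 : IsIndex ((n : ℤ) - 1) i j
        · have h2 : 1 ≤ n := by simp only [IsIndex] at h1; omega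
          have := ih (n - 1) (by omega) i j (by push_cast [h2]; exact h1)
          push_cast [h2] at this
          exact this
        · rw [eZ_of_not h1]; exact M.zero_mem
      have hn : ∀ i j, IsIndex n i j → eZ n i j ∈ M := ih n (by omega)
      have key : ∀ {c d : ℝ} {x y z : L2 Gam}, c ≠ 0 → x ∈ M → y ∈ M →
          x = (c : ℂ) • z + (d : ℂ) • y → z ∈ M := by
        intro c d x y z hc hx hy hxy
        have h1 : (c : ℂ) • z ∈ M := by
          rw [show (c : ℂ) • z = x - (d : ℂ) • y by rw [hxy]; abel]
          exact M.sub_mem hx (M.smul_mem _ hy)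
        exact (M.smul_mem_iff (Complex.ofReal_ne_zero.2 hc)).1 h1
      have g0 : ∀ {m : ℤ}, 0 < m → gZ q m ≠ 0 := fun hm => (gZ_pos hq hm).ne'
      obtain ⟨h1, h2, h3, h4⟩ := h
      by_cases hi : i ≤ n <;> by_cases hj : j ≤ n
      · have h : IsIndex n i j := ⟨h1, hi, h3, hj⟩
        refine key ?_ (map_mem_range_orbit hq hq0 (alpha q) (hn i j h)) (hlow (i - 1) (j - 1))
          (regAlpha_eZ hq h)
        rw [aUp]
        have := g0 (m := n - j + 1) (by omega)
        have := g0 (m := n - i + 1) (by omega)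
        have := g0 (m := n + 1) (by omega)
        have := g0 (m := n + 2) (by omega)
        positivity
      · obtain rfl : j = n + 1 := by omega
        have h : IsIndex n i n := ⟨h1, hi, by omega, le_rfl⟩
        have e := star_regBeta_eZ hq h
        rw [add_comm] at e
        refine key ?_ (map_mem_range_orbit hq hq0 (star (beta q)) (hn i n h)) (hlow (i - 1) n)
          ((DFunLike.congr_fun (map_star (regRep hq hq0) (beta q)) _).trans e)
        rw [bDown]
        have := g0 (m := n + 1 - i) (by omega)
        have := g0 (m := n + 1) (by omega)
        have := g0 (m := n + 1 + 1) (by omega)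
        positivity
      · obtain rfl : i = n + 1 := by omega
        have h : IsIndex n n j := ⟨by omega, le_rfl, h3, hj⟩
        refine key ?_ (map_mem_range_orbit hq hq0 (beta q) (hn n j h)) (hlow n (j - 1))
          (regBeta_eZ hq h)
        rw [bUp]
        have := g0 (m := n - j + 1) (by omega)
        have := g0 (m := n + 1) (by omega)
        have := g0 (m := n + 2) (by omega)
        have := zpow_ne_zero j hq0
        simp [*]
      · obtain rfl : i = n + 1 := by omega
        obtain rfl : j = n + 1 := by omega
        have h : IsIndex n n n := ⟨by omega, le_rfl, by omega, le_rfl⟩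
        have e := star_regAlpha_eZ hq h
        rw [add_comm] at e
        refine key ?_ (map_mem_range_orbit hq hq0 (star (alpha q)) (hn n n h)) (hlow n n)
          ((DFunLike.congr_fun (map_star (regRep hq hq0) (alpha q)) _).trans e)
        rw [aDown]
        have := g0 (m := n + 1) (by omega)
        have := g0 (m := n + 1 + 1) (by omega)
        positivity

theorem orbit_dense : DenseRange (orbit hq hq0) := by
  intro x
  have := mem_closed_of_bv (LinearMap.range (orbit hq hq0)).topologicalClosure
    (Submodule.isClosed_topologicalClosure _) (ContinuousLinearMap.id ℂ _) (fun p => by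
      refine Submodule.le_topologicalClosure _ ?_
      rw [ContinuousLinearMap.id_apply, ← eZ_val]
      exact eZ_mem_range_orbit hq hq0 _ _ _ (isIndex_gam p)) x
  exact this

/-! ### The GNS space -/

/-- The isometric map `a ↦ λ_q(a) e^0_{00}` on the pre-GNS space. -/
def preGnsIso : (haar hq hq0).PreGNS →ₗᵢ[ℂ] L2 Gam where
  toLinearMap := orbit hq hq0 ∘ₗ (haar hq hq0).ofPreGNS.toLinearMap
  norm_map' x := by
    have h1 := (haar hq hq0).preGNS_norm_sq x
    rw [haar_apply, haarLin_star_mul, inner_self_eq_norm_sq_to_K,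
      RCLike.ofReal_eq_complex_ofReal] at h1
    have h2 : ‖x‖ ^ 2 = ‖regRep hq hq0 ((haar hq hq0).ofPreGNS x) vac‖ ^ 2 := by exact_mod_cast h1
    exact ((sq_eq_sq₀ (norm_nonneg _) (norm_nonneg _)).1 h2).symm

/-- The isometric map `a ↦ λ_q(a) e^0_{00}` on the GNS space. -/
def gnsIso : (haar hq hq0).GNS →ₗᵢ[ℂ] L2 Gam where
  toLinearMap := (preGnsIso hq hq0).toContinuousLinearMap.fromCompletion.toLinearMap
  norm_map' x := by
    induction x using UniformSpace.Completion.induction_on with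
    | hp => exact isClosed_eq (by fun_prop) (by fun_prop)
    | ih x => simp

theorem gnsIso_coe (x : (haar hq hq0).PreGNS) :
    gnsIso hq hq0 x = orbit hq hq0 ((haar hq hq0).ofPreGNS x) :=
  ContinuousLinearMap.fromCompletion_apply_coe _ _

/-- The range of an isometry of a complete space is closed, and cyclicity of the vacuum makes it
dense. -/
theorem gnsIso_surjective : Function.Surjective (gnsIso hq hq0) := by
  have hc : IsClosed (Set.range (gnsIso hq hq0)) :=
    (gnsIso hq hq0).isometry.isClosedEmbedding.isClosed_range
  have hd : DenseRange (gnsIso hq hq0) := by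
    refine (orbit_dense hq hq0).mono ?_
    rintro _ ⟨a, rfl⟩
    exact ⟨_, gnsIso_coe hq hq0 ((haar hq hq0).toPreGNS a)⟩
  rw [← Set.range_eq_univ, ← hc.closure_eq, hd.closure_range]

/-- The unitary identification of the GNS space with `ℓ²(Γ)`. -/
def gnsEquiv : (haar hq hq0).GNS ≃ₗᵢ[ℂ] L2 Gam :=
  LinearIsometryEquiv.ofSurjective (gnsIso hq hq0) (gnsIso_surjective hq hq0)

theorem gnsEquiv_gns (a : A q) (x : (haar hq hq0).GNS) :
    gnsEquiv hq hq0 ((haar hq hq0).gnsStarAlgHom a x) = regRep hq hq0 a (gnsEquiv hq hq0 x) := by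
  induction x using UniformSpace.Completion.induction_on with
  | hp => exact isClosed_eq (by fun_prop) (by fun_prop)
  | ih x =>
    have h1 : (haar hq hq0).gnsStarAlgHom a x = ((haar hq hq0).leftMulMapPreGNS a x :
        (haar hq hq0).PreGNS) := by
      exact (haar hq hq0).gnsNonUnitalStarAlgHom_apply_coe
    rw [h1]
    change gnsIso hq hq0 _ = regRep hq hq0 a (gnsIso hq hq0 _)
    rw [gnsIso_coe, gnsIso_coe, ← orbit_mul]
    rfl

theorem lam_gnsEquiv (a : A q) :
    lam (haar hq hq0) (gnsEquiv hq hq0) a = regRep hq hq0 a := by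
  ext1 x
  change gnsEquiv hq hq0 ((haar hq hq0).gnsStarAlgHom a ((gnsEquiv hq hq0).symm x)) = _
  rw [gnsEquiv_gns, LinearIsometryEquiv.apply_symm_apply]

/-! ### The prescribed formulas in natural number indices -/

theorem regAlpha_eG {N I J : ℕ} (hI : I ≤ N) (hJ : J ≤ N) : regAlpha hq (eG N I J) =
    (aPlus q N I J : ℂ) • eG (N + 1) I J + (aMinus q N I J : ℂ) • eG (N - 1) (I - 1) (J - 1) := by
  have h : IsIndex N I J := by simp only [IsIndex]; omega
  rw [← eZ_natCast N I J, regAlpha_eZ hq h, aUp_natCast q hI hJ, aDown_natCast]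
  congr 1
  -- When I or J is 0 the truncated predecessor is not the integer one, but the coefficient contains
  -- g(0) = 0.
  rcases Nat.eq_zero_or_pos I with rfl | hI0
  · simp [aMinus, g]
  rcases Nat.eq_zero_or_pos J with rfl | hJ0
  · simp [aMinus, g]
  rw [← eZ_natCast]
  push_cast [hI0, hJ0, hI0.trans_le hI]
  rfl

theorem regBeta_eG {N I J : ℕ} (hI : I ≤ N) (hJ : J ≤ N) : regBeta hq (eG N I J) =
    (bPlus q N I J : ℂ) • eG (N + 1) (I + 1) J + (bMinus q N I J : ℂ) • eG (N - 1) I (J - 1) := by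
  have h : IsIndex N I J := by simp only [IsIndex]; omega
  rw [← eZ_natCast N I J, regBeta_eZ hq h, bUp_natCast q hJ, bDown_natCast q hI]
  congr 1
  rcases Nat.eq_zero_or_pos J with rfl | hJ0
  · simp [bMinus, g]
  rw [← eZ_natCast]
  push_cast [hJ0, hJ0.trans_le hJ]
  rfl

theorem isPeterWeyl : IsPeterWeyl (haar hq hq0) (gnsEquiv hq hq0) where
  map_one := by
    change gnsIso hq hq0 _ = _
    rw [gnsIso_coe, ← vac_eq]
    simp [orbit]
  alpha_apply N I J hI hJ := by
    rw [gnsEquiv_gns, LinearIsometryEquiv.apply_symm_apply]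
    exact regAlpha_eG hq hI hJ
  beta_apply N I J hI hJ := by
    rw [gnsEquiv_gns, LinearIsometryEquiv.apply_symm_apply]
    exact regBeta_eG hq hI hJ

end

open Filter Topology

/-! ### Diagonal operators -/

theorem norm_wcomp_le {ι κ : Type} (w : ι → ℝ) (f : ι → κ) (hf : Function.Injective f)
    (hw : ∀ i, |w i| ≤ 1) : ‖wcomp w f hf hw‖ ≤ 1 := by
  unfold wcomp
  exact LinearMap.mkContinuous_norm_le _ zero_le_one _

theorem norm_le_of_diagonal {ι : Type} [DecidableEq ι] {T : L2 ι →L[ℂ] L2 ι} {c : ι → ℝ} {ε : ℝ}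
    (hε : 0 < ε) (hT : ∀ i, T (bv i) = (c i : ℂ) • bv i) (hc : ∀ i, |c i| ≤ ε) : ‖T‖ ≤ ε := by
  have h1 : ∀ i, |c i / ε| ≤ 1 := fun i => by
    rw [abs_div, abs_of_pos hε]
    exact (div_le_one hε).2 (hc i)
  have h2 : T = (ε : ℂ) • wcomp (fun i => c i / ε) id Function.injective_id h1 := by
    refine bv_ext fun i => ?_
    rw [hT, smul_apply]
    have h3 := wcomp_bv (fun i => c i / ε) id Function.injective_id h1 i
    rw [id_eq] at h3
    rw [h3, smul_smul]
    congr 1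
    have : (ε : ℂ) ≠ 0 := by exact_mod_cast hε.ne'
    push_cast
    field_simp
  rw [h2, norm_smul, Complex.norm_real, Real.norm_eq_abs, abs_of_pos hε]
  exact mul_le_of_le_one_right hε.le (norm_wcomp_le _ _ _ _)

theorem diag_bv (w : ℕ → ℝ) (hw : ∀ k, |w k| ≤ 1) (k : ℕ) :
    diag w hw (bv k) = (w k : ℂ) • bv k := wcomp_bv w id Function.injective_id hw k

theorem shiftN_bv_succ (k : ℕ) : shiftN (bv (k + 1)) = bv k := by
  ext j
  simp [shiftN_apply, bv_apply]

theorem star_shiftN_bv (k : ℕ) : star shiftN (bv k) = bv (k + 1) := by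
  ext j
  cases j with
  | zero => simp [star_shiftN_zero, bv_apply]
  | succ j => simp [star_shiftN_succ, bv_apply]

theorem shiftZ_bv (k : ℤ) : shiftZ (bv k) = bv (k - 1) := by
  ext j
  simp [shiftZ_apply, bv_apply, eq_sub_iff_add_eq]

theorem shiftN_pow_apply (r : ℕ) (x : L2 ℕ) (k : ℕ) : (shiftN ^ r) x k = x (k + r) := by
  induction r generalizing x with
  | zero => simp
  | succ r ih => rw [pow_succ, l2_mul, ih, shiftN_apply, add_assoc]

theorem star_shiftN_pow_bv (r : ℕ) : (star shiftN ^ r) (bv 0) = bv r := by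
  induction r with
  | zero => simp
  | succ r ih => rw [pow_succ', l2_mul, ih, star_shiftN_bv]

theorem one_sub_star_mul_apply (x : L2 ℕ) : (1 - star shiftN * shiftN) x = x 0 • bv 0 := by
  rw [sub_apply, l2_mul, one_apply_eq_self]
  ext k
  change x k - star shiftN (shiftN x) k = _
  rw [l2_smul, bv_apply]
  cases k with
  | zero => simp [star_shiftN_zero]
  | succ k => simp [star_shiftN_succ, shiftN_apply]

/-- As S is the left shift, 1 - S*S projects onto e_0, and conjugation by powers of the shift
carries it to the projection onto e_r. -/
theorem matrixUnit_apply (r : ℕ) (x : L2 ℕ) :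
    (star shiftN ^ r * (1 - star shiftN * shiftN) * shiftN ^ r) x = x r • bv r := by
  rw [l2_mul, l2_mul, one_sub_star_mul_apply, map_smul, star_shiftN_pow_bv, shiftN_pow_apply,
    zero_add]

/-! ### The Toeplitz algebra contains the convergent diagonals -/

theorem shiftN_mem_toeplitz : shiftN ∈ toeplitz := StarAlgebra.elemental.self_mem ℂ shiftN

/-- The operator is l·1 plus the diagonal with entries w_r - l. The latter tend to 0, so finite sums
of the projections onto e_r approximate it in norm. -/
theorem diag_mem_toeplitz {w : ℕ → ℝ} (hw : ∀ k, |w k| ≤ 1) {l : ℝ}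
    (hl : Tendsto w atTop (𝓝 l)) : diag w hw ∈ toeplitz := by
  set E : ℕ → L2 ℕ →L[ℂ] L2 ℕ := fun r =>
    star shiftN ^ r * (1 - star shiftN * shiftN) * shiftN ^ r with hE
  set F : ℕ → L2 ℕ →L[ℂ] L2 ℕ := fun n =>
    (l : ℂ) • 1 + ∑ r ∈ Finset.range n, ((w r - l : ℝ) : ℂ) • E r with hF
  have hEm : ∀ r, E r ∈ toeplitz := fun r =>
    mul_mem (mul_mem (pow_mem (star_mem shiftN_mem_toeplitz) r)
      (sub_mem (one_mem _) (mul_mem (star_mem shiftN_mem_toeplitz) shiftN_mem_toeplitz)))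
      (pow_mem shiftN_mem_toeplitz r)
  have hFm : ∀ n, F n ∈ toeplitz := fun n =>
    add_mem (SMulMemClass.smul_mem _ (one_mem _))
      (sum_mem fun r _ => SMulMemClass.smul_mem _ (hEm r))
  have hFb : ∀ n k, (diag w hw - F n) (bv k) =
      ((if k < n then 0 else w k - l : ℝ) : ℂ) • bv k := by
    intro n k
    have hs : (∑ r ∈ Finset.range n, ((w r - l : ℝ) : ℂ) • E r) (bv k) =
        ((if k < n then w k - l else 0 : ℝ) : ℂ) • bv k := by
      rw [sum_apply]
      have hterm : ∀ r, (((w r - l : ℝ) : ℂ) • E r) (bv k) =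
          if k = r then ((w k - l : ℝ) : ℂ) • bv k else 0 := by
        intro r
        rw [smul_apply, hE, matrixUnit_apply, bv_apply]
        by_cases h : k = r
        · rw [if_pos h, if_pos h.symm, h, one_smul]
        · rw [if_neg h, if_neg (Ne.symm h), zero_smul, smul_zero]
      rw [Finset.sum_congr rfl fun r _ => hterm r, Finset.sum_ite_eq]
      by_cases h : k < n <;> simp [h]
    rw [sub_apply, hF, add_apply, hs, diag_bv, smul_apply, one_apply_eq_self]
    split_ifs <;> push_cast <;> module
  have hlim : Tendsto F atTop (𝓝 (diag w hw)) := by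
    rw [tendsto_iff_norm_sub_tendsto_zero, Metric.tendsto_atTop]
    intro ε hε
    obtain ⟨n₀, hn₀⟩ := Metric.tendsto_atTop.1 hl (ε / 2) (half_pos hε)
    refine ⟨n₀, fun n hn => ?_⟩
    rw [dist_zero_right, norm_norm, norm_sub_rev]
    refine (norm_le_of_diagonal (half_pos hε) (hFb n) fun k => ?_).trans_lt (half_lt_self hε)
    split_ifs with h
    · simpa using (half_pos hε).le
    · exact (hn₀ k (by omega)).le
  exact (StarAlgebra.elemental.isClosed ℂ shiftN).mem_of_tendsto hlim (Eventually.of_forall hFm)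

/-! ### Operators on `H_mult ⊗ H_π` -/

section
variable {H : Type} [NormedAddCommGroup H] [InnerProductSpace ℂ H]

theorem continuousMul_clm : ContinuousMul (H →L[ℂ] H) := inferInstance

theorem norm_ofReal_smul_clm {ε : ℝ} (hε : 0 < ε) (T : H →L[ℂ] H) :
    ‖(ε : ℂ) • T‖ = ε * ‖T‖ := by
  rw [norm_smul, Complex.norm_real, Real.norm_eq_abs, abs_of_pos hε]

theorem tendsto_clm {F : ℕ → H →L[ℂ] H} {T : H →L[ℂ] H}
    (h : ∀ ε > 0, ∃ n₀, ∀ n ≥ n₀, ‖T - F n‖ < ε) : Tendsto F atTop (𝓝 T) := by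
  rw [Metric.tendsto_atTop]
  simpa only [dist_eq_norm, norm_sub_rev T] using h

theorem isCompactOperator_rankOne (v : H) : IsCompactOperator ((innerSL ℂ v).smulRight v) :=
  (isCompactOperator_of_locallyCompactSpace_rng
    (ContinuousLinearMap.toSpanSingleton ℂ v)).comp_clm (innerSL ℂ v)

end

instance : ContinuousMul (HTot →L[ℂ] HTot) := continuousMul_clm

/-- The index map is inverted by (I, J) = (s + t⁻, s + t⁺), with t⁺ and t⁻ the positive and negative
parts of t; then I ∨ J = s + |t| and N = r + s + |t|. -/
theorem exists_UVec (r s : ℕ) (t : ℤ) : ∃ p : Gam, p.1.1 - max p.1.2.1 p.1.2.2 = r ∧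
    min p.1.2.1 p.1.2.2 = s ∧ (p.1.2.2 : ℤ) - p.1.2.1 = t ∧
    eT r s t = (-1 : ℂ) ^ (max p.1.2.1 p.1.2.2 - p.1.2.2) • UVec p := by
  refine ⟨⟨(r + s + t.natAbs, s + (-t).toNat, s + t.toNat), by dsimp only; omega⟩,
    by dsimp only; omega, by dsimp only; omega, by dsimp only; omega, ?_⟩
  rw [UVec, smul_smul, ← mul_pow]
  norm_num
  congr 1 <;> omega

theorem eT_ext {E : Type} [NormedAddCommGroup E] [InnerProductSpace ℂ E] {S T : HTot →L[ℂ] E}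
    (h : ∀ r s t, S (eT r s t) = T (eT r s t)) : S = T := by
  refine ContinuousLinearMap.ext_on (s := Set.range UVec)
    (Submodule.dense_iff_topologicalClosure_eq_top.2 (top_le_iff.1 UVec_dense)) ?_
  rintro _ ⟨p, rfl⟩
  simp only [UVec, map_smul, h]

theorem conjU_apply_U (T : L2 Gam →L[ℂ] L2 Gam) (x : L2 Gam) : conjU T (U x) = U (T x) := by
  change U (T (U.symm (U x))) = _
  rw [U.symm_apply_apply]

/-- Conjugation with `U` as an isomorphism of `*`-algebras. -/
def conjUEquiv : (L2 Gam →L[ℂ] L2 Gam) ≃⋆ₐ[ℂ] (HTot →L[ℂ] HTot) := U.conjStarAlgEquiv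

theorem conjUEquiv_apply (T : L2 Gam →L[ℂ] L2 Gam) : conjUEquiv T = conjU T := rfl

theorem norm_conjU_le (T : L2 Gam →L[ℂ] L2 Gam) : ‖conjU T‖ ≤ ‖T‖ := by
  refine ContinuousLinearMap.opNorm_le_bound _ (norm_nonneg _) fun x => ?_
  change ‖U (T (U.symm x))‖ ≤ _
  rw [U.norm_map, ← U.symm.norm_map x]
  exact T.le_opNorm _

/-- `T` is diagonal in the basis `e(r,s,t)`, with entries `w r s t`. -/
def IsDiag (w : ℕ → ℕ → ℤ → ℝ) (T : HTot →L[ℂ] HTot) : Prop :=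
  ∀ r s t, T (eT r s t) = (w r s t : ℂ) • eT r s t

/-- Pulled back by U, the operator is multiplication by a bounded function on the index set. -/
theorem exists_isDiag_of_le_one {w : ℕ → ℕ → ℤ → ℝ} (hw : ∀ r s t, |w r s t| ≤ 1) :
    ∃ T, IsDiag w T ∧ star T = T ∧ ‖T‖ ≤ 1 := by
  set v : Gam → ℝ := fun p => w (p.1.1 - max p.1.2.1 p.1.2.2) (min p.1.2.1 p.1.2.2)
    ((p.1.2.2 : ℤ) - p.1.2.1) with hv
  set T := wcomp v id Function.injective_id (fun p => hw _ _ _) with hT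
  refine ⟨conjU T, fun r s t => ?_, ?_, (norm_conjU_le T).trans (norm_wcomp_le _ _ _ _)⟩
  · obtain ⟨p, rfl, rfl, rfl, hp⟩ := exists_UVec r s t
    rw [hp, map_smul, ← U_apply, conjU_apply_U]
    have : T (bv p) = (v p : ℂ) • bv p := wcomp_bv v id Function.injective_id _ p
    rw [this, map_smul, smul_comm]
  · rw [← conjUEquiv_apply, ← map_star]
    congr 1
    refine bv_ext fun p => ?_
    rw [hT, star_wcomp_bv]
    exact (wcomp_bv v id Function.injective_id _ p).symm

theorem exists_isDiag {w : ℕ → ℕ → ℤ → ℝ} {ε : ℝ} (hε : 0 < ε) (hw : ∀ r s t, |w r s t| ≤ ε) :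
    ∃ T, IsDiag w T ∧ star T = T ∧ ‖T‖ ≤ ε := by
  obtain ⟨T, h1, h2, h3⟩ := exists_isDiag_of_le_one (w := fun r s t => w r s t / ε)
    fun r s t => by
      rw [abs_div, abs_of_pos hε]
      exact (div_le_one hε).2 (hw r s t)
  refine ⟨(ε : ℂ) • T, fun r s t => ?_, ?_, ?_⟩
  · have : (ε : ℂ) ≠ 0 := by exact_mod_cast hε.ne'
    rw [smul_apply, h1, smul_smul]
    congr 1
    push_cast
    field_simp
  · rw [star_smul, h2]
    simp
  · exact (norm_ofReal_smul_clm hε T).trans_le (mul_le_of_le_one_right hε.le h3)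

theorem IsDiag.unique {w : ℕ → ℕ → ℤ → ℝ} {S T : HTot →L[ℂ] HTot} (hS : IsDiag w S)
    (hT : IsDiag w T) : S = T := eT_ext fun r s t => by rw [hS, hT]

theorem IsDiag.norm_le {w : ℕ → ℕ → ℤ → ℝ} {T : HTot →L[ℂ] HTot} (hT : IsDiag w T) {ε : ℝ}
    (hε : 0 < ε) (hw : ∀ r s t, |w r s t| ≤ ε) : ‖T‖ ≤ ε := by
  obtain ⟨S, h1, -, h3⟩ := exists_isDiag hε hw
  exact hT.unique h1 ▸ h3

/-! ### Membership in `𝒯 ⊗ K(H_π)` -/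

theorem isClosed_toeplitzCompact : IsClosed (toeplitzCompact : Set (HTot →L[ℂ] HTot)) :=
  Submodule.isClosed_topologicalClosure _

theorem opTensor_mem_toeplitzCompact {S : L2 ℕ →L[ℂ] L2 ℕ} (hS : S ∈ toeplitz)
    {T : HPi →L[ℂ] HPi} (hT : IsCompactOperator T) : opTensor S T ∈ toeplitzCompact :=
  Submodule.le_topologicalClosure _ (Submodule.subset_span ⟨S, hS, T, hT, rfl⟩)

theorem toeplitzCompact_le {W : Submodule ℂ (HTot →L[ℂ] HTot)}
    (hW : IsClosed (W : Set (HTot →L[ℂ] HTot)))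
    (h : ∀ S ∈ toeplitz, ∀ T : HPi →L[ℂ] HPi, IsCompactOperator T → opTensor S T ∈ W) :
    toeplitzCompact ≤ W := by
  refine Submodule.topologicalClosure_minimal _ (Submodule.span_le.2 ?_) hW
  rintro _ ⟨S, hS, T, hT, rfl⟩
  exact h S hS T hT

/-- Only the first leg is restricted to 𝒯: the second may be any bounded operator, because compact
operators form an ideal. -/
theorem opTensor_mul_mem {S : L2 ℕ →L[ℂ] L2 ℕ} (hS : S ∈ toeplitz) (Y : HPi →L[ℂ] HPi)
    {X : HTot →L[ℂ] HTot} (hX : X ∈ toeplitzCompact) : opTensor S Y * X ∈ toeplitzCompact := by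
  have h : toeplitzCompact ≤
      toeplitzCompact.comap (LinearMap.mulLeft ℂ (opTensor S Y)) := by
    refine toeplitzCompact_le (isClosed_toeplitzCompact.preimage
      (continuous_const.mul continuous_id)) fun S' hS' T hT => ?_
    rw [Submodule.mem_comap, LinearMap.mulLeft_apply, opTensor_mul]
    exact opTensor_mem_toeplitzCompact (mul_mem hS hS') (hT.clm_comp Y)
  exact h hX

theorem mul_opTensor_mem {S : L2 ℕ →L[ℂ] L2 ℕ} (hS : S ∈ toeplitz) (Y : HPi →L[ℂ] HPi)
    {X : HTot →L[ℂ] HTot} (hX : X ∈ toeplitzCompact) : X * opTensor S Y ∈ toeplitzCompact := by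
  have h : toeplitzCompact ≤
      toeplitzCompact.comap (LinearMap.mulRight ℂ (opTensor S Y)) := by
    refine toeplitzCompact_le (isClosed_toeplitzCompact.preimage
      (continuous_id.mul continuous_const)) fun S' hS' T hT => ?_
    rw [Submodule.mem_comap, LinearMap.mulRight_apply, opTensor_mul]
    exact opTensor_mem_toeplitzCompact (mul_mem hS' hS) (hT.comp_clm Y)
  exact h hX

theorem mul_mem_toeplitzCompact {X Y : HTot →L[ℂ] HTot} (hX : X ∈ toeplitzCompact)
    (hY : Y ∈ toeplitzCompact) : X * Y ∈ toeplitzCompact := by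
  have h : toeplitzCompact ≤ toeplitzCompact.comap (LinearMap.mulRight ℂ Y) :=
    toeplitzCompact_le (isClosed_toeplitzCompact.preimage (continuous_id.mul continuous_const))
      fun S hS T _ => opTensor_mul_mem hS T hY
  exact h hX

/-- The rank one projection onto `e_s ⊗ e_t`. -/
def unitProj (s : ℕ) (t : ℤ) : HPi →L[ℂ] HPi :=
  (innerSL ℂ (tmulH (bv s) (bv t) : HPi)).smulRight (tmulH (bv s) (bv t))

theorem isCompactOperator_unitProj (s : ℕ) (t : ℤ) : IsCompactOperator (unitProj s t) :=
  isCompactOperator_rankOne _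

theorem unitProj_apply (s s' : ℕ) (t t' : ℤ) : unitProj s t (tmulH (bv s') (bv t')) =
    if s' = s ∧ t' = t then tmulH (bv s') (bv t') else 0 := by
  change ⟪(tmulH (bv s) (bv t) : HPi), tmulH (bv s') (bv t')⟫_ℂ • (tmulH (bv s) (bv t) : HPi) = _
  rw [inner_tmulH, inner_bv, inner_bv, bv_apply, bv_apply]
  by_cases h1 : s' = s
  · subst h1
    by_cases h2 : t' = t
    · subst h2
      simp
    · simp [h2, Ne.symm h2]
  · simp [h1, Ne.symm h1]

section
variable {H K : Type} [NormedAddCommGroup H] [InnerProductSpace ℂ H]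
  [NormedAddCommGroup K] [InnerProductSpace ℂ K]

theorem tmulH_smul_left (c : ℂ) (x : H) (y : K) : tmulH (c • x) y = c • tmulH x y := by
  simp only [tmulH, ← TensorProduct.smul_tmul', UniformSpace.Completion.coe_smul]

theorem tmulH_smul_right (c : ℂ) (x : H) (y : K) : tmulH x (c • y) = c • tmulH x y := by
  simp only [tmulH, TensorProduct.tmul_smul, UniformSpace.Completion.coe_smul]

theorem tmulH_add_right (x : H) (y y' : K) : tmulH x (y + y') = tmulH x y + tmulH x y' := by
  simp only [tmulH, TensorProduct.tmul_add, UniformSpace.Completion.coe_add]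

theorem tmulH_zero_right (x : H) : tmulH x (0 : K) = 0 := by
  simpa using tmulH_smul_right 0 x (0 : K)

theorem opTensor_add_right (S : H →L[ℂ] H) (T T' : K →L[ℂ] K) :
    opTensor S (T + T') = opTensor S T + opTensor S T' :=
  opTensor_ext fun x y => by simp only [opTensor_tmulH, add_apply, tmulH_add_right]

theorem opTensor_smul_right (c : ℂ) (S : H →L[ℂ] H) (T : K →L[ℂ] K) :
    opTensor S (c • T) = c • opTensor S T :=
  opTensor_ext fun x y => by simp only [opTensor_tmulH, smul_apply, tmulH_smul_right]

end

/-- For fixed (s,t) the entries form a convergent sequence in r, hence a Toeplitz diagonal, tensored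
with a rank one projection. Truncating to finitely many (s,t) converges in norm because the entries
decay in s + |t| uniformly in r. -/
theorem mem_toeplitzCompact_of_isDiag {w : ℕ → ℕ → ℤ → ℝ} {x : ℝ} (hx0 : 0 ≤ x) (hx1 : x < 1)
    (hw : ∀ r s t, |w r s t| ≤ x ^ (s + t.natAbs))
    (hl : ∀ s t, ∃ l, Tendsto (fun r => w r s t) atTop (𝓝 l)) {T : HTot →L[ℂ] HTot}
    (hT : IsDiag w T) : T ∈ toeplitzCompact := by
  have hw1 : ∀ r s t, |w r s t| ≤ 1 := fun r s t => (hw r s t).trans (pow_le_one₀ hx0 hx1.le)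
  set F : ℕ → HTot →L[ℂ] HTot := fun n =>
    ∑ p ∈ Finset.range n ×ˢ Finset.Icc (-n : ℤ) n,
      opTensor (diag (fun r => w r p.1 p.2) fun r => hw1 r p.1 p.2) (unitProj p.1 p.2) with hF
  have hFm : ∀ n, F n ∈ toeplitzCompact := fun n => sum_mem fun p _ => by
    obtain ⟨l, hl⟩ := hl p.1 p.2
    exact opTensor_mem_toeplitzCompact (diag_mem_toeplitz _ hl) (isCompactOperator_unitProj _ _)
  have hFb : ∀ n, IsDiag (fun r s t => if s < n ∧ t.natAbs ≤ n then 0 else w r s t) (T - F n) := by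
    intro n r s t
    have hs : F n (eT r s t) =
        ((if s < n ∧ t.natAbs ≤ n then w r s t else 0 : ℝ) : ℂ) • eT r s t := by
      have hterm : ∀ p : ℕ × ℤ,
          opTensor (diag (fun r => w r p.1 p.2) fun r => hw1 r p.1 p.2) (unitProj p.1 p.2)
            (eT r s t) = if (s, t) = p then (w r s t : ℂ) • eT r s t else 0 := by
        rintro ⟨s', t'⟩
        rw [eT, opTensor_tmulH, unitProj_apply, diag_bv]
        by_cases h : s = s' ∧ t = t'
        · obtain ⟨rfl, rfl⟩ := h
          rw [if_pos ⟨rfl, rfl⟩, if_pos rfl, tmulH_smul_left]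
        · rw [if_neg h, if_neg (by simpa using h), tmulH_zero_right]
      rw [hF, sum_apply, Finset.sum_congr rfl fun p _ => hterm p, Finset.sum_ite_eq]
      have : ((s, t) ∈ Finset.range n ×ˢ Finset.Icc (-n : ℤ) n) ↔ s < n ∧ t.natAbs ≤ n := by
        simp only [Finset.mem_product, Finset.mem_range, Finset.mem_Icc]
        omega
      by_cases h : s < n ∧ t.natAbs ≤ n
      · rw [if_pos (this.2 h), if_pos h]
      · rw [if_neg (fun h' => h (this.1 h')), if_neg h]
        simp
    rw [sub_apply, hs, hT]
    by_cases h : s < n ∧ t.natAbs ≤ n <;> simp [h]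
  have hlim : Tendsto F atTop (𝓝 T) := by
    refine tendsto_clm fun ε hε => ?_
    obtain ⟨n₀, hn₀⟩ := Metric.tendsto_atTop.1
      (tendsto_pow_atTop_nhds_zero_of_lt_one hx0 hx1) (ε / 2) (half_pos hε)
    refine ⟨n₀, fun n hn => ?_⟩
    refine ((hFb n).norm_le (half_pos hε) fun r s t => ?_).trans_lt (half_lt_self hε)
    split_ifs with h
    · simpa using (half_pos hε).le
    -- Outside the box s < n, |t| ≤ n one has s + |t| ≥ n.
    · have := hn₀ (s + t.natAbs) (by omega)
      rw [dist_zero_right, Real.norm_eq_abs] at this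
      exact (hw r s t).trans ((le_abs_self _).trans this.le)
  exact isClosed_toeplitzCompact.mem_of_tendsto hlim (Eventually.of_forall hFm)

/-- A self-adjoint element of `𝒯 ⊗ K(H_π)` with prescribed rapidly decreasing diagonal entries. -/
theorem exists_isDiag_mem {w : ℕ → ℕ → ℤ → ℝ} {x C : ℝ} (hx0 : 0 ≤ x) (hx1 : x < 1) (hC : 0 < C)
    (hw : ∀ r s t, |w r s t| ≤ C * x ^ (s + t.natAbs))
    (hl : ∀ s t, ∃ l, Tendsto (fun r => w r s t) atTop (𝓝 l)) :
    ∃ T ∈ toeplitzCompact, IsDiag w T ∧ star T = T := by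
  have hw1 : ∀ r s t, |w r s t| ≤ C := fun r s t =>
    (hw r s t).trans (mul_le_of_le_one_right hC.le (pow_le_one₀ hx0 hx1.le))
  obtain ⟨T, h1, h2, -⟩ := exists_isDiag hC hw1
  refine ⟨T, ?_, h1, h2⟩
  have hC' : (C : ℂ) ≠ 0 := by exact_mod_cast hC.ne'
  have h3 : (C : ℂ)⁻¹ • T ∈ toeplitzCompact := by
    refine mem_toeplitzCompact_of_isDiag (w := fun r s t => C⁻¹ * w r s t) hx0 hx1 (fun r s t => ?_)
      (fun s t => ?_) fun r s t => ?_
    · rw [abs_mul, abs_of_pos (inv_pos.2 hC), inv_mul_le_iff₀ hC]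
      exact hw r s t
    · obtain ⟨l, hl⟩ := hl s t
      exact ⟨C⁻¹ * l, hl.const_mul _⟩
    · rw [smul_apply, h1, smul_smul]
      push_cast
      rfl
  have := toeplitzCompact.smul_mem (C : ℂ) h3
  rwa [smul_smul, mul_inv_cancel₀ hC', one_smul] at this

/-! ### Estimates for the coefficients -/

section
variable {q : ℝ}

theorem g_nonneg (n : ℕ) : 0 ≤ g q n := Real.sqrt_nonneg _

theorem g_le_one (n : ℕ) : g q n ≤ 1 := (le_abs_self _).trans (abs_g_le_one q n)

theorem g_zero : g q 0 = 0 := by simp [g]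

theorem g_mono (hq : |q| < 1) {m n : ℕ} (h : m ≤ n) : g q m ≤ g q n := by
  rw [← gZ_natCast, ← gZ_natCast]
  exact gZ_mono hq (by omega) (by exact_mod_cast h)

theorem g_mul_g_le_one (m n : ℕ) : g q m * g q n ≤ 1 :=
  mul_le_one₀ (g_le_one m) (g_nonneg n) (g_le_one n)

theorem le_g_mul_g (hq : |q| < 1) {k m n : ℕ} (hm : k ≤ m) (hn : k ≤ n) :
    1 - q ^ (2 * k) ≤ g q m * g q n :=
  calc 1 - q ^ (2 * k) = g q k * g q k := (Real.mul_self_sqrt (one_sub_nonneg hq k)).symm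
    _ ≤ g q m * g q n := mul_le_mul (g_mono hq hm) (g_mono hq hn) (g_nonneg _) (g_nonneg _)

theorem g_mul_g_div_mem (hq : |q| < 1) {k l m n : ℕ} (h1 : k ≤ m) (h2 : l ≤ n) :
    |g q k * g q l / (g q m * g q n)| ≤ 1 := by
  rw [abs_of_nonneg (div_nonneg (mul_nonneg (g_nonneg _) (g_nonneg _))
    (mul_nonneg (g_nonneg _) (g_nonneg _)))]
  exact div_le_one_of_le₀ (mul_le_mul (g_mono hq h1) (g_mono hq h2) (g_nonneg _)
    (g_nonneg _)) (mul_nonneg (g_nonneg _) (g_nonneg _))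

theorem one_sub_sq_pos (hq : |q| < 1) : 0 < 1 - q ^ 2 :=
  sub_pos.2 ((sq_lt_one_iff_abs_lt_one q).2 hq)

/-- The numerator |x - y| is at most q^{2m} ≤ |q|^m. Since m ≥ 1, the denominator is at least 1 -
q^{2m} ≥ 1 - q². -/
theorem abs_div_sub_one_le (hq : |q| < 1) {m : ℕ} (hm : m ≠ 0) {x y : ℝ}
    (hx : 1 - q ^ (2 * m) ≤ x) (hx1 : x ≤ 1) (hy : 1 - q ^ (2 * m) ≤ y) (hy1 : y ≤ 1) :
    |x / y - 1| ≤ (1 - q ^ 2)⁻¹ * |q| ^ m := by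
  have h0 := one_sub_sq_pos hq
  have h1 : q ^ (2 * m) ≤ q ^ 2 := by
    rw [pow_mul]
    exact pow_le_of_le_one (sq_nonneg q) (by linarith) hm
  have h2 : q ^ (2 * m) ≤ |q| ^ m := by
    rw [pow_mul, ← sq_abs, ← pow_mul]
    exact pow_le_pow_of_le_one (abs_nonneg q) hq.le (by omega)
  have hy0 : 0 < y := by linarith
  rw [div_sub_one hy0.ne', abs_div, abs_of_pos hy0, inv_mul_eq_div]
  refine div_le_div₀ (by positivity) ?_ h0 (by linarith)
  rw [abs_le]
  constructor <;> linarith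

theorem pow_le_inv_mul_pow (hq : |q| < 1) (n : ℕ) : |q| ^ n ≤ (1 - q ^ 2)⁻¹ * |q| ^ n :=
  le_mul_of_one_le_left (by positivity)
    ((one_le_inv₀ (one_sub_sq_pos hq)).2 (by linarith [sq_nonneg q]))

theorem abs_pow_mul_le (hq : |q| < 1) {n m : ℕ} (h : m ≤ n) {x : ℝ} (hx : |x| ≤ 1) :
    |q ^ n * x| ≤ (1 - q ^ 2)⁻¹ * |q| ^ m := by
  rw [abs_mul, abs_pow]
  exact (mul_le_of_le_one_right (by positivity) hx).trans
    ((pow_le_pow_of_le_one (abs_nonneg q) hq.le h).trans (pow_le_inv_mul_pow hq m))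

theorem tendsto_g (hq : |q| < 1) {f : ℕ → ℕ} (hf : ∀ r, r ≤ f r) :
    Tendsto (fun r => g q (f r)) atTop (𝓝 1) := by
  have h1 : Tendsto (fun r => 2 * f r) atTop atTop :=
    tendsto_atTop_mono (fun r => by have := hf r; dsimp only [id]; omega) tendsto_id
  have h2 := ((tendsto_pow_atTop_nhds_zero_of_abs_lt_one hq).comp h1).const_sub 1
  have h3 := (Real.continuous_sqrt.tendsto _).comp h2
  rwa [sub_zero, Real.sqrt_one] at h3

end

/-! ### The diagonal entries -/

/-- The diagonal entries of the raising part of `λ_q(α)`. -/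
def alphaUp (q : ℝ) (r s : ℕ) (t : ℤ) : ℝ :=
  q ^ (s + (s + t.natAbs) + 1) * (g q (r + 1) * g q (r + t.natAbs + 1) /
    (g q (r + s + t.natAbs + 1) * g q (r + s + t.natAbs + 2)))

/-- The diagonal entries of the lowering part of `λ_q(α)`, relative to those of `π_q(α)`. -/
def alphaDown (q : ℝ) (r s : ℕ) (t : ℤ) : ℝ :=
  g q s * (g q (s + t.natAbs) / (g q (r + s + t.natAbs) * g q (r + s + t.natAbs + 1)) - 1)

/-- The diagonal entries of the part of `λ_q(β)` that shifts `t` only, relative to those of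
`π_q(β)`. -/
def betaFix (q : ℝ) (r s : ℕ) (t : ℤ) : ℝ :=
  q ^ s * ((if 0 < t then g q (s + t.natAbs) * g q (r + t.natAbs) /
      (g q (r + s + t.natAbs) * g q (r + s + t.natAbs + 1))
    else g q (r + t.natAbs + 1) * g q (s + t.natAbs + 1) /
      (g q (r + s + t.natAbs + 1) * g q (r + s + t.natAbs + 2))) - 1)

/-- The diagonal entries of the part of `λ_q(β)` that raises `r` and `s`. -/
def betaUp (q : ℝ) (r s : ℕ) (t : ℤ) : ℝ :=
  if 0 < t then q ^ (s + t.natAbs) * -(g q (r + 1) * g q (s + 1) /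
    (g q (r + s + t.natAbs + 1) * g q (r + s + t.natAbs + 2))) else 0

/-- The diagonal entries of the part of `λ_q(β)` that lowers `r` and `s`. -/
def betaDown (q : ℝ) (r s : ℕ) (t : ℤ) : ℝ :=
  if 0 < t then 0 else q ^ (s + t.natAbs) * -(g q s * g q r /
    (g q (r + s + t.natAbs) * g q (r + s + t.natAbs + 1)))

section
variable {q : ℝ} (hq : |q| < 1)
include hq

theorem abs_alphaUp_le (r s : ℕ) (t : ℤ) :
    |alphaUp q r s t| ≤ (1 - q ^ 2)⁻¹ * |q| ^ (s + t.natAbs) :=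
  abs_pow_mul_le hq (by omega) (g_mul_g_div_mem hq (by omega) (by omega))

theorem abs_alphaDown_le (r s : ℕ) (t : ℤ) :
    |alphaDown q r s t| ≤ (1 - q ^ 2)⁻¹ * |q| ^ (s + t.natAbs) := by
  have h0 := one_sub_sq_pos hq
  -- For s = 0 the factor g(s) kills the entry; otherwise the exponent s + |t| is nonzero, as the
  -- comparison lemma requires.
  rcases Nat.eq_zero_or_pos s with rfl | hs
  · rw [alphaDown, g_zero, zero_mul, abs_zero]
    positivity
  · rw [alphaDown, abs_mul]
    refine (mul_le_of_le_one_left (abs_nonneg _) (abs_g_le_one q s)).trans ?_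
    refine abs_div_sub_one_le hq (by omega) ?_ (g_le_one _)
      (le_g_mul_g hq (by omega) (by omega)) (g_mul_g_le_one _ _)
    exact (le_g_mul_g hq le_rfl le_rfl).trans (mul_le_of_le_one_right (g_nonneg _) (g_le_one _))

theorem abs_betaFix_le (r s : ℕ) (t : ℤ) :
    |betaFix q r s t| ≤ (1 - q ^ 2)⁻¹ * |q| ^ (s + t.natAbs) := by
  have h0 := one_sub_sq_pos hq
  rw [betaFix, abs_mul, abs_pow, pow_add, mul_left_comm]
  refine mul_le_mul_of_nonneg_left ?_ (by positivity)
  split_ifs with ht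
  · exact abs_div_sub_one_le hq (by omega) (le_g_mul_g hq (by omega) (by omega))
      (g_mul_g_le_one _ _) (le_g_mul_g hq (by omega) (by omega)) (g_mul_g_le_one _ _)
  -- The prefactor q^s already supplies the decay in s. Since t may be 0 here, the comparison uses
  -- |t| + 1 in place of |t|.
  · refine (abs_div_sub_one_le hq (m := t.natAbs + 1) (by omega)
      (le_g_mul_g hq (by omega) (by omega))
      (g_mul_g_le_one _ _) (le_g_mul_g hq (by omega) (by omega)) (g_mul_g_le_one _ _)).trans ?_
    exact mul_le_mul_of_nonneg_left
      (pow_le_pow_of_le_one (abs_nonneg q) hq.le (by omega)) (by positivity)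

theorem abs_betaUp_le (r s : ℕ) (t : ℤ) :
    |betaUp q r s t| ≤ (1 - q ^ 2)⁻¹ * |q| ^ (s + t.natAbs) := by
  have h0 := one_sub_sq_pos hq
  rw [betaUp]
  split_ifs with ht
  · refine abs_pow_mul_le hq le_rfl ?_
    rw [abs_neg]
    exact g_mul_g_div_mem hq (by omega) (by omega)
  · rw [abs_zero]
    positivity

theorem abs_betaDown_le (r s : ℕ) (t : ℤ) :
    |betaDown q r s t| ≤ (1 - q ^ 2)⁻¹ * |q| ^ (s + t.natAbs) := by
  have h0 := one_sub_sq_pos hq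
  rw [betaDown]
  split_ifs with ht
  · rw [abs_zero]
    positivity
  · refine abs_pow_mul_le hq le_rfl ?_
    rw [abs_neg]
    exact g_mul_g_div_mem hq (by omega) (by omega)

/-- With s and t fixed, every g whose argument contains r tends to 1, so the entries converge. -/
theorem tendsto_alphaUp (s : ℕ) (t : ℤ) : ∃ l, Tendsto (alphaUp q · s t) atTop (𝓝 l) :=
  ⟨_, tendsto_const_nhds.mul (((tendsto_g hq fun r => by omega).mul
    (tendsto_g hq fun r => by omega)).div ((tendsto_g hq fun r => by omega).mul
    (tendsto_g hq fun r => by omega)) (by norm_num))⟩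

theorem tendsto_alphaDown (s : ℕ) (t : ℤ) : ∃ l, Tendsto (alphaDown q · s t) atTop (𝓝 l) :=
  ⟨_, tendsto_const_nhds.mul ((tendsto_const_nhds.div ((tendsto_g hq fun r => by omega).mul
    (tendsto_g hq fun r => by omega)) (by norm_num)).sub_const 1)⟩

theorem tendsto_betaFix (s : ℕ) (t : ℤ) : ∃ l, Tendsto (betaFix q · s t) atTop (𝓝 l) := by
  by_cases ht : 0 < t
  · simp only [betaFix, if_pos ht]
    exact ⟨_, tendsto_const_nhds.mul (((tendsto_const_nhds.mul
      (tendsto_g hq fun r => by omega)).div ((tendsto_g hq fun r => by omega).mul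
      (tendsto_g hq fun r => by omega)) (by norm_num)).sub_const 1)⟩
  · simp only [betaFix, if_neg ht]
    exact ⟨_, tendsto_const_nhds.mul ((((tendsto_g hq fun r => by omega).mul
      tendsto_const_nhds).div ((tendsto_g hq fun r => by omega).mul
      (tendsto_g hq fun r => by omega)) (by norm_num)).sub_const 1)⟩

theorem tendsto_betaUp (s : ℕ) (t : ℤ) : ∃ l, Tendsto (betaUp q · s t) atTop (𝓝 l) := by
  by_cases ht : 0 < t
  · simp only [betaUp, if_pos ht]
    exact ⟨_, tendsto_const_nhds.mul (((tendsto_g hq fun r => by omega).mul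
      tendsto_const_nhds).div ((tendsto_g hq fun r => by omega).mul
      (tendsto_g hq fun r => by omega)) (by norm_num)).neg⟩
  · simp only [betaUp, if_neg ht]
    exact ⟨0, tendsto_const_nhds⟩

theorem tendsto_betaDown (s : ℕ) (t : ℤ) : ∃ l, Tendsto (betaDown q · s t) atTop (𝓝 l) := by
  by_cases ht : 0 < t
  · simp only [betaDown, if_pos ht]
    exact ⟨0, tendsto_const_nhds⟩
  · simp only [betaDown, if_neg ht]
    exact ⟨_, tendsto_const_nhds.mul ((tendsto_const_nhds.mul
      (tendsto_g hq fun r => le_rfl)).div ((tendsto_g hq fun r => by omega).mul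
      (tendsto_g hq fun r => by omega)) (by norm_num)).neg⟩

end

/-! ### The generators on the basis `e(r,s,t)` -/

theorem U_eG_of_le (r s k : ℕ) : U (eG (r + s + k) s (s + k)) = eT r s k := by
  rw [eG, dif_pos ⟨by omega, by omega⟩, U_apply, UVec]
  dsimp only
  rw [max_eq_right (by omega), min_eq_left (by omega), Nat.sub_self, pow_zero, one_smul]
  congr 1 <;> omega

theorem U_eG_of_ge (r s k : ℕ) :
    U (eG (r + s + k) (s + k) s) = (-1 : ℂ) ^ k • eT r s (-k) := by
  rw [eG, dif_pos ⟨by omega, by omega⟩, U_apply, UVec]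
  dsimp only
  rw [max_eq_left (by omega), min_eq_right (by omega), Nat.add_sub_cancel_left]
  congr 2 <;> omega

theorem eT_neg (r s k : ℕ) : eT r s (-k) = (-1 : ℂ) ^ k • U (eG (r + s + k) (s + k) s) := by
  rw [U_eG_of_ge, smul_smul, ← mul_pow]
  simp

theorem opTensor_eT (X Y : L2 ℕ →L[ℂ] L2 ℕ) (Z : L2 ℤ →L[ℂ] L2 ℤ) (r s : ℕ) (t : ℤ) :
    opTensor X (opTensor Y Z) (eT r s t) = tmulH (X (bv r)) (tmulH (Y (bv s)) (Z (bv t))) := by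
  rw [eT, opTensor_tmulH, opTensor_tmulH]

theorem opTensor_one_eT (X : L2 ℕ →L[ℂ] L2 ℕ) (r s : ℕ) (t : ℤ) :
    opTensor X (1 : HPi →L[ℂ] HPi) (eT r s t) = tmulH (X (bv r)) (tmulH (bv s) (bv t)) := by
  rw [eT, opTensor_tmulH, one_apply_eq_self]

section
variable {q : ℝ}

/-- Since α preserves j - i, it fixes t and the sign. Its raising term changes only r, and its
lowering term changes only s. -/
theorem conjU_regAlpha_eT (hq : |q| < 1) (r s : ℕ) (t : ℤ) : conjU (regAlpha hq) (eT r s t) =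
    (alphaUp q r s t : ℂ) • opTensor (star shiftN) (1 : HPi →L[ℂ] HPi) (eT r s t) +
      ((alphaDown q r s t + g q s : ℝ) : ℂ) •
        opTensor (1 : L2 ℕ →L[ℂ] L2 ℕ) (opTensor shiftN (1 : L2 ℤ →L[ℂ] L2 ℤ)) (eT r s t) := by
  have hdown : ∀ k : ℕ, t.natAbs = k → alphaDown q r s t + g q s =
      g q (s + k) * g q s / (g q (r + s + k) * g q (r + s + k + 1)) := by
    rintro k rfl
    rw [alphaDown]
    ring
  rw [opTensor_one_eT, opTensor_eT, star_shiftN_bv, one_apply_eq_self, one_apply_eq_self]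
  obtain ⟨k, rfl | rfl⟩ := t.eq_nat_or_neg
  · rw [← U_eG_of_le, conjU_apply_U, regAlpha_eG hq (by omega) (by omega), map_add, map_smul,
      map_smul, hdown k (by omega)]
    congr 1
    · rw [aPlus, alphaUp, show r + s + k + 1 = r + 1 + s + k by omega, U_eG_of_le, eT,
        show r + s + k - (s + k) + 1 = r + 1 by omega, show r + s + k - s + 1 = r + k + 1 by omega,
        Int.natAbs_natCast, mul_div_assoc,
        show r + 1 + s + k = r + s + k + 1 by omega]
    · rw [aMinus]
      cases s with
      | zero => simp [g_zero]
      | succ s =>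
        rw [show r + (s + 1) + k - 1 = r + s + k by omega, show s + 1 + k - 1 = s + k by omega,
          Nat.add_sub_cancel, U_eG_of_le, shiftN_bv_succ, eT]
  · rw [eT_neg, map_smul, conjU_apply_U, regAlpha_eG hq (by omega) (by omega), map_add, map_smul,
      map_smul, hdown k (by omega), smul_add]
    congr 1
    · rw [aPlus, alphaUp, show r + s + k + 1 = r + 1 + s + k by omega, smul_comm, ← eT_neg, eT,
        show r + s + k - (s + k) + 1 = r + 1 by omega, show r + s + k - s + 1 = r + k + 1 by omega,
        Int.natAbs_neg, Int.natAbs_natCast, mul_div_assoc,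
        show r + 1 + s + k = r + s + k + 1 by omega, add_comm (s + k) s,
        mul_comm (g q (r + k + 1))]
    · rw [aMinus]
      cases s with
      | zero => simp [g_zero]
      | succ s =>
        rw [show r + (s + 1) + k - 1 = r + s + k by omega, show s + 1 + k - 1 = s + k by omega,
          Nat.add_sub_cancel, smul_comm, ← eT_neg, shiftN_bv_succ, eT, mul_comm (g q (s + 1))]

theorem opTensor_piAlpha_eT (r s : ℕ) (t : ℤ) :
    opTensor (1 : L2 ℕ →L[ℂ] L2 ℕ) (opTensor (piAlpha q) (1 : L2 ℤ →L[ℂ] L2 ℤ)) (eT r s t) =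
      (g q s : ℂ) •
        opTensor (1 : L2 ℕ →L[ℂ] L2 ℕ) (opTensor shiftN (1 : L2 ℤ →L[ℂ] L2 ℤ)) (eT r s t) := by
  rw [opTensor_eT, opTensor_eT, piAlpha, l2_mul, diag_bv, map_smul, tmulH_smul_left,
    tmulH_smul_right]

theorem opTensor_piBeta_eT (hq : |q| < 1) (r s : ℕ) (t : ℤ) :
    opTensor (1 : L2 ℕ →L[ℂ] L2 ℕ) (opTensor (piBeta q hq) shiftZ) (eT r s t) =
      ((q ^ s : ℝ) : ℂ) •
        opTensor (1 : L2 ℕ →L[ℂ] L2 ℕ) (opTensor (1 : L2 ℕ →L[ℂ] L2 ℕ) shiftZ) (eT r s t) := by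
  rw [opTensor_eT, opTensor_eT, piBeta, diag_bv, tmulH_smul_left, tmulH_smul_right,
    one_apply_eq_self (bv s)]

/-- For j > i the lowering term decreases the larger index along with N, so r and s stay fixed; the
raising term increases both r and s. -/
theorem conjU_regBeta_eT_pos (hq : |q| < 1) (r s k : ℕ) :
    conjU (regBeta hq) (eT r s ((k + 1 : ℕ) : ℤ)) =
      ((q ^ s * (g q (s + (k + 1)) * g q (r + (k + 1)) /
        (g q (r + s + (k + 1)) * g q (r + s + (k + 1) + 1))) : ℝ) : ℂ) • eT r s k +
      ((q ^ (s + (k + 1)) * -(g q (r + 1) * g q (s + 1) /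
        (g q (r + s + (k + 1) + 1) * g q (r + s + (k + 1) + 2))) : ℝ) : ℂ) •
          eT (r + 1) (s + 1) k := by
  have h1 : eG (r + s + (k + 1) + 1) (s + 1) (s + (k + 1)) =
      eG (r + 1 + (s + 1) + k) (s + 1) (s + 1 + k) := by congr 1 <;> omega
  have h2 : eG (r + s + (k + 1) - 1) s (s + (k + 1) - 1) = eG (r + s + k) s (s + k) := by
    congr 1
  rw [← U_eG_of_le, conjU_apply_U, regBeta_eG hq (by omega) (by omega), map_add, map_smul,
    map_smul, add_comm, h1, h2, U_eG_of_le, U_eG_of_le, bMinus, bPlus,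
    show r + s + (k + 1) - s = r + (k + 1) by omega,
    show r + s + (k + 1) - (s + (k + 1)) + 1 = r + 1 by omega]
  congr 3 <;> ring

/-- For i ≥ j the two terms exchange roles: the raising term now fixes r and s. The sign in U
changes as t drops by one, turning the minus sign of b_+ into a plus, so the leading coefficient is
again near q^s. -/
theorem conjU_regBeta_eT_neg (hq : |q| < 1) (r s k : ℕ) :
    conjU (regBeta hq) (eT r s (-k)) =
      ((q ^ s * (g q (r + k + 1) * g q (s + k + 1) /
        (g q (r + s + k + 1) * g q (r + s + k + 2))) : ℝ) : ℂ) • eT r s (-((k + 1 : ℕ) : ℤ)) +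
      ((q ^ (s + k) * -(g q s * g q r / (g q (r + s + k) * g q (r + s + k + 1))) : ℝ) : ℂ) •
        tmulH (shiftN (bv r)) (tmulH (shiftN (bv s)) (bv (-((k + 1 : ℕ) : ℤ)))) := by
  rw [eT_neg, map_smul, conjU_apply_U, regBeta_eG hq (by omega) (by omega), map_add, map_smul,
    map_smul, smul_add]
  congr 1
  · rw [eT_neg, bPlus, ← add_assoc, ← add_assoc, show r + s + k - s + 1 = r + k + 1 by omega,
      smul_smul, smul_smul]
    congr 1
    push_cast
    ring
  · rw [bMinus, show r + s + k - (s + k) = r by omega]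
    cases s with
    | zero => simp [g_zero]
    | succ s =>
      cases r with
      | zero => simp [g_zero]
      | succ r =>
        have h : eG (r + 1 + (s + 1) + k - 1) (s + 1 + k) (s + 1 - 1) =
            eG (r + s + (k + 1)) (s + (k + 1)) s := by congr 1 <;> omega
        rw [shiftN_bv_succ, shiftN_bv_succ, ← eT, eT_neg, h, smul_smul, smul_smul]
        congr 1
        push_cast
        ring

theorem conjU_regBeta_eT (hq : |q| < 1) (r s : ℕ) (t : ℤ) : conjU (regBeta hq) (eT r s t) =
    ((betaFix q r s t + q ^ s : ℝ) : ℂ) •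
        opTensor (1 : L2 ℕ →L[ℂ] L2 ℕ) (opTensor (1 : L2 ℕ →L[ℂ] L2 ℕ) shiftZ) (eT r s t) +
      (betaUp q r s t : ℂ) •
        opTensor (star shiftN) (opTensor (star shiftN) shiftZ) (eT r s t) +
      (betaDown q r s t : ℂ) • opTensor shiftN (opTensor shiftN shiftZ) (eT r s t) := by
  rw [opTensor_eT, opTensor_eT, opTensor_eT, star_shiftN_bv, star_shiftN_bv, one_apply_eq_self,
    one_apply_eq_self, shiftZ_bv]
  rcases lt_or_ge 0 t with ht | ht
  · obtain ⟨k, rfl⟩ : ∃ k : ℕ, t = ((k + 1 : ℕ) : ℤ) := ⟨t.toNat - 1, by omega⟩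
    have h : ((k + 1 : ℕ) : ℤ) - 1 = (k : ℕ) := by omega
    rw [conjU_regBeta_eT_pos, betaFix, betaUp, betaDown, if_pos ht, if_pos ht, if_pos ht,
      Int.natAbs_natCast, Complex.ofReal_zero, zero_smul, add_zero, h, mul_sub_one,
      sub_add_cancel, eT, eT]
  · obtain ⟨k, rfl⟩ : ∃ k : ℕ, t = -(k : ℤ) := ⟨t.natAbs, by omega⟩
    have h : -(k : ℤ) - 1 = -((k + 1 : ℕ) : ℤ) := by omega
    rw [conjU_regBeta_eT_neg, betaFix, betaUp, betaDown, if_neg ht.not_gt, if_neg ht.not_gt,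
      if_neg ht.not_gt, Int.natAbs_neg, Int.natAbs_natCast, Complex.ofReal_zero, zero_smul,
      add_zero, h, mul_sub_one, sub_add_cancel, eT]

end

/-! ### The difference of the two representations -/

section
variable {H : Type} [NormedAddCommGroup H] [InnerProductSpace ℂ H]

theorem sub_apply_eq_of_diag₂ {T P A₁ A₂ W₁ W₂ : H →L[ℂ] H} {x : H} {c₁ c₂ d : ℝ}
    (hT : T x = (c₁ : ℂ) • A₁ x + ((c₂ + d : ℝ) : ℂ) • A₂ x) (hP : P x = (d : ℂ) • A₂ x)
    (h₁ : W₁ x = (c₁ : ℂ) • x) (h₂ : W₂ x = (c₂ : ℂ) • x) :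
    (T - P) x = (A₁ * W₁ + A₂ * W₂) x := by
  change T x - P x = A₁ (W₁ x) + A₂ (W₂ x)
  rw [hT, hP, h₁, h₂, map_smul, map_smul]
  push_cast
  module

theorem sub_apply_eq_of_diag₃ {T P A₁ A₂ A₃ W₁ W₂ W₃ : H →L[ℂ] H} {x : H} {c₁ c₂ c₃ d : ℝ}
    (hT : T x = ((c₁ + d : ℝ) : ℂ) • A₁ x + (c₂ : ℂ) • A₂ x + (c₃ : ℂ) • A₃ x)
    (hP : P x = (d : ℂ) • A₁ x) (h₁ : W₁ x = (c₁ : ℂ) • x) (h₂ : W₂ x = (c₂ : ℂ) • x)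
    (h₃ : W₃ x = (c₃ : ℂ) • x) :
    (T - P) x = (A₁ * W₁ + A₂ * W₂ + A₃ * W₃) x := by
  change T x - P x = A₁ (W₁ x) + A₂ (W₂ x) + A₃ (W₃ x)
  rw [hT, hP, h₁, h₂, h₃, map_smul, map_smul, map_smul]
  push_cast
  module

end

/-- Because the diagonal factors are self-adjoint, the adjoint of the difference has the same shape
with the factors reversed, which handles α* and β*. -/
theorem star_add_mul₂ {B : Type} [Ring B] [StarRing B] {X A₁ A₂ W₁ W₂ : B}
    (hX : X = A₁ * W₁ + A₂ * W₂) (h₁ : star W₁ = W₁) (h₂ : star W₂ = W₂) :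
    star X = W₁ * star A₁ + W₂ * star A₂ := by
  rw [hX, star_add, star_mul, star_mul, h₁, h₂]

theorem star_add_mul₃ {B : Type} [Ring B] [StarRing B] {X A₁ A₂ A₃ W₁ W₂ W₃ : B}
    (hX : X = A₁ * W₁ + A₂ * W₂ + A₃ * W₃) (h₁ : star W₁ = W₁) (h₂ : star W₂ = W₂)
    (h₃ : star W₃ = W₃) : star X = W₁ * star A₁ + W₂ * star A₂ + W₃ * star A₃ := by
  rw [hX, star_add, star_add, star_mul, star_mul, star_mul, h₁, h₂, h₃]

theorem mul_star_opTensor_mem {S : L2 ℕ →L[ℂ] L2 ℕ} (hS : S ∈ toeplitz) (Y : HPi →L[ℂ] HPi)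
    {X : HTot →L[ℂ] HTot} (hX : X ∈ toeplitzCompact) :
    X * star (opTensor S Y) ∈ toeplitzCompact := by
  rw [opTensor_star]
  exact mul_opTensor_mem (star_mem hS) _ hX

section
variable {q : ℝ}

set_option maxHeartbeats 800000 in
theorem regAlpha_sub_mem (hq : |q| < 1) :
    conjU (regAlpha hq) -
        opTensor (1 : L2 ℕ →L[ℂ] L2 ℕ) (opTensor (piAlpha q) (1 : L2 ℤ →L[ℂ] L2 ℤ)) ∈
      toeplitzCompact ∧
    star (conjU (regAlpha hq) -
        opTensor (1 : L2 ℕ →L[ℂ] L2 ℕ) (opTensor (piAlpha q) (1 : L2 ℤ →L[ℂ] L2 ℤ))) ∈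
      toeplitzCompact := by
  have h0 := inv_pos.2 (one_sub_sq_pos hq)
  obtain ⟨W₁, hm₁, hd₁, hs₁⟩ := exists_isDiag_mem (abs_nonneg q) hq h0 (abs_alphaUp_le hq)
    (tendsto_alphaUp hq)
  obtain ⟨W₂, hm₂, hd₂, hs₂⟩ := exists_isDiag_mem (abs_nonneg q) hq h0 (abs_alphaDown_le hq)
    (tendsto_alphaDown hq)
  have key := eT_ext fun r s t => sub_apply_eq_of_diag₂ (conjU_regAlpha_eT hq r s t)
    (opTensor_piAlpha_eT r s t) (hd₁ r s t) (hd₂ r s t)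
  rw [star_add_mul₂ key hs₁ hs₂, key]
  exact ⟨add_mem (opTensor_mul_mem (star_mem shiftN_mem_toeplitz) _ hm₁)
    (opTensor_mul_mem (one_mem _) _ hm₂),
    add_mem (mul_star_opTensor_mem (star_mem shiftN_mem_toeplitz) _ hm₁)
    (mul_star_opTensor_mem (one_mem _) _ hm₂)⟩

set_option maxHeartbeats 800000 in
theorem regBeta_sub_mem (hq : |q| < 1) :
    conjU (regBeta hq) -
        opTensor (1 : L2 ℕ →L[ℂ] L2 ℕ) (opTensor (piBeta q hq) shiftZ) ∈ toeplitzCompact ∧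
    star (conjU (regBeta hq) -
        opTensor (1 : L2 ℕ →L[ℂ] L2 ℕ) (opTensor (piBeta q hq) shiftZ)) ∈ toeplitzCompact := by
  have h0 := inv_pos.2 (one_sub_sq_pos hq)
  obtain ⟨W₁, hm₁, hd₁, hs₁⟩ := exists_isDiag_mem (abs_nonneg q) hq h0 (abs_betaFix_le hq)
    (tendsto_betaFix hq)
  obtain ⟨W₂, hm₂, hd₂, hs₂⟩ := exists_isDiag_mem (abs_nonneg q) hq h0 (abs_betaUp_le hq)
    (tendsto_betaUp hq)
  obtain ⟨W₃, hm₃, hd₃, hs₃⟩ := exists_isDiag_mem (abs_nonneg q) hq h0 (abs_betaDown_le hq)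
    (tendsto_betaDown hq)
  have key := eT_ext fun r s t => sub_apply_eq_of_diag₃ (conjU_regBeta_eT hq r s t)
    (opTensor_piBeta_eT hq r s t) (hd₁ r s t) (hd₂ r s t) (hd₃ r s t)
  rw [star_add_mul₃ key hs₁ hs₂ hs₃, key]
  exact ⟨add_mem (add_mem (opTensor_mul_mem (one_mem _) _ hm₁)
    (opTensor_mul_mem (star_mem shiftN_mem_toeplitz) _ hm₂))
    (opTensor_mul_mem shiftN_mem_toeplitz _ hm₃),
    add_mem (add_mem (mul_star_opTensor_mem (one_mem _) _ hm₁)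
    (mul_star_opTensor_mem (star_mem shiftN_mem_toeplitz) _ hm₂))
    (mul_star_opTensor_mem shiftN_mem_toeplitz _ hm₃)⟩

end

/-! ### From the generators to the whole algebra -/

/-- The representation `T ↦ I ⊗ T`. -/
def oneTensor (H K : Type) [NormedAddCommGroup H] [InnerProductSpace ℂ H] [CompleteSpace H]
    [NormedAddCommGroup K] [InnerProductSpace ℂ K] [CompleteSpace K] :
    (K →L[ℂ] K) →⋆ₐ[ℂ] (HTensor H K →L[ℂ] HTensor H K) where
  toFun T := opTensor 1 T
  map_one' := opTensor_one
  map_mul' S T := by rw [opTensor_mul, one_mul]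
  map_zero' := by simpa using opTensor_smul_right 0 (1 : H →L[ℂ] H) (0 : K →L[ℂ] K)
  map_add' S T := opTensor_add_right 1 S T
  commutes' c := by
    rw [Algebra.algebraMap_eq_smul_one, opTensor_smul_right, opTensor_one,
      Algebra.algebraMap_eq_smul_one]
  map_star' T := by rw [opTensor_star, star_one]

-- The set of good elements is closed, so words suffice. Writing φ = ψ + δ, the product rule is
-- δ(xy) = δ(x)δ(y) + δ(x)ψ(y) + ψ(x)δ(y), and each summand stays in K.
open scoped CStarAlgebra in
theorem sub_mem_of_generators {H : Type} [NormedAddCommGroup H] [InnerProductSpace ℂ H]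
    [CompleteSpace H] {q : ℝ} (φ ψ : A q →⋆ₐ[ℂ] (H →L[ℂ] H)) {K : Submodule ℂ (H →L[ℂ] H)}
    (hK : IsClosed (K : Set (H →L[ℂ] H))) (hmul : ∀ x ∈ K, ∀ y ∈ K, x * y ∈ K)
    (hl : ∀ a, ∀ x ∈ K, ψ a * x ∈ K) (hr : ∀ a, ∀ x ∈ K, x * ψ a ∈ K)
    (hα : φ (alpha q) - ψ (alpha q) ∈ K ∧ star (φ (alpha q) - ψ (alpha q)) ∈ K)
    (hβ : φ (beta q) - ψ (beta q) ∈ K ∧ star (φ (beta q) - ψ (beta q)) ∈ K) (a : A q) :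
    φ a - ψ a ∈ K := by
  have hcl : IsClosed {a : A q | φ a - ψ a ∈ K} :=
    hK.preimage ((map_continuous φ).sub (map_continuous ψ))
  refine (denseRange_ev q).induction_on a hcl fun p => ?_
  induction p using FreeAlgebra.induction with
  | grade0 c =>
    rw [AlgHom.commutes, AlgHomClass.commutes, AlgHomClass.commutes, sub_self]
    exact zero_mem _
  | grade1 x =>
    rw [ev, FreeAlgebra.lift_ι_apply]
    cases x
    · exact hα.1
    · exact hβ.1
    · dsimp only
      rw [map_star, map_star, ← star_sub]
      exact hα.2
    · dsimp only
      rw [map_star, map_star, ← star_sub]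
      exact hβ.2
  | mul x y hx hy =>
    have h : φ (ev q (x * y)) - ψ (ev q (x * y)) =
        (φ (ev q x) - ψ (ev q x)) * (φ (ev q y) - ψ (ev q y)) +
        (φ (ev q x) - ψ (ev q x)) * ψ (ev q y) + ψ (ev q x) * (φ (ev q y) - ψ (ev q y)) := by
      rw [map_mul, map_mul, map_mul]
      noncomm_ring
    rw [h]
    exact add_mem (add_mem (hmul _ hx _ hy) (hr _ _ hx)) (hl _ _ hy)
  | add x y hx hy =>
    rw [map_add, map_add, map_add, add_sub_add_comm]
    exact add_mem hx hy

/-- The representation `a ↦ U λ_q(a) U^*`. -/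
def conjReg {q : ℝ} (hq : |q| < 1) (hq0 : q ≠ 0) : A q →⋆ₐ[ℂ] (HTot →L[ℂ] HTot) :=
  (conjUEquiv : (L2 Gam →L[ℂ] L2 Gam) →⋆ₐ[ℂ] (HTot →L[ℂ] HTot)).comp (regRep hq hq0)

/-- The representation `a ↦ I ⊗ π_q(a)`. -/
def idTensorPi (q : ℝ) (hq : |q| < 1) : A q →⋆ₐ[ℂ] (HTot →L[ℂ] HTot) :=
  (oneTensor (L2 ℕ) HPi).comp (piRep q hq)

theorem conjReg_sub_idTensorPi_mem {q : ℝ} (hq : |q| < 1) (hq0 : q ≠ 0) (a : A q) :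
    conjReg hq hq0 a - idTensorPi q hq a ∈ toeplitzCompact := by
  refine sub_mem_of_generators (H := HTot) (conjReg hq hq0) (idTensorPi q hq)
    (K := toeplitzCompact) isClosed_toeplitzCompact ?_ ?_ ?_ ?_ ?_ a
  · exact fun _ hx _ hy => mul_mem_toeplitzCompact hx hy
  · exact fun a _ hx => opTensor_mul_mem (one_mem _) (piRep q hq a) hx
  · exact fun a _ hx => mul_opTensor_mem (one_mem _) (piRep q hq a) hx
  · exact regAlpha_sub_mem hq
  · exact regBeta_sub_mem hq

end SUq2

end

theorem mainTheorem2 (q : ℝ) (hq : |q| < 1) (hq0 : q ≠ 0) :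
    (∃ h : SUq2.A q →ₚ[ℂ] ℂ, SUq2.IsHaarState h) ∧
    ∀ h : SUq2.A q →ₚ[ℂ] ℂ, SUq2.IsHaarState h →
      ∃ V : h.GNS ≃ₗᵢ[ℂ] SUq2.L2 SUq2.Gam, SUq2.IsPeterWeyl h V ∧
        ∀ a : SUq2.A q,
          SUq2.conjU (SUq2.lam h V a) - SUq2.opTensor 1 (SUq2.piRep q hq a) ∈
            SUq2.toeplitzCompact := by
  refine ⟨⟨SUq2.haar hq hq0, SUq2.isHaarState_haar hq hq0⟩, fun h H => ?_⟩
  -- Uniqueness replaces an arbitrary Haar state by the vector state constructed above, whose GNS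
  -- space is already identified.
  obtain rfl := H.unique (SUq2.isHaarState_haar hq hq0)
  refine ⟨SUq2.gnsEquiv hq hq0, SUq2.isPeterWeyl hq hq0, fun a => ?_⟩
  rw [SUq2.lam_gnsEquiv]
  exact SUq2.conjReg_sub_idTensorPi_mem hq hq0 a
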